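/- Fix $x>0$ and, for real $\nu\neq 0$, let $$K_{i\nu}(x)=\frac{\pi i}{2\sinh \pi\nu}\{I_{i\nu}(x)-I_{-i\nu}(x)\},\qquad I_{\mu}(x)=\frac{(x/2)^{\mu}}{\Gamma(1+\mu)}\sum_{k\ge 0}\frac{(x/2)^{2k}}{k!\,(1+\mu)_k}.$$ The positive zeros of $\nu\mapsto K_{i\nu}(x)$ form an infinite increasing sequence $\nu_1<\nu_2<\cdots$, and $$\nu_n\sim \frac{m}{W(\lambda m)}+\frac{B_0}{m}+\frac{B_1}{m^3}+\frac{B_2}{m^5}+\cdots\qquad(n\to\infty),$$ where $m=m_-=(n-\tfrac14)\pi$, $\lambda=2/(ex)$ and, for $z>0$, $W(z)$ is the positive solution of $W(z)e^{W(z)}=z$. The meaning of the expansion is that, for every fixed $N\ge 0$, $$\nu_n=\frac{m}{W(\lambda m)}+\sum_{k=0}^{N-1}\frac{B_k}{m^{2k+1}}+O\!\left(\frac{W(\lambda m)^{2N}}{m^{2N+1}}\right)\qquad(n\to\infty).$$ In particular $\nu_n\sim m/\log(\lambda m)$, in the sense that the ratio tends to $1$. The coefficients $B_k$ (which depend on $x$,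 and on $n$ through $q$ below) are defined as follows. Let $\gamma_k$ be the Stirling coefficients, $1/\Gamma(1+z)\sim(2\pi z)^{-1/2}e^{z}z^{-z}\sum_k\gamma_kz^{-k}$, let $C_k(y)$ be the coefficients in $\sum_j \frac{y^j}{j!\,(1+z)_j}\sim\sum_k C_k(y)z^{-k}$ as $z\to\infty$, and put $a_k=\sum_{r=0}^k\gamma_rC_{k-r}(x^2/4)$. Let $A_k$ be the coefficients of the formal series $$\frac{A_0}{\nu}+\frac{A_1}{\nu^3}+\frac{A_2}{\nu^5}+\cdots=\arctan\frac{a_1/\nu-a_3/\nu^3+a_5/\nu^5-\cdots}{1-a_2/\nu^2+a_4/\nu^4-\cdots}.$$ Let $\xi=m/W(\lambda m)$, so that $\xi\log\lambda\xi=m$, let $q=\xi/m$, so that $1+\log\lambda\xi=(1+q)/q$, and let $\nu=\xi+b_0/\xi+b_1/\xi^3+b_2/\xi^5+\cdots$ be the formal solution of $\nu\log\lambda\nu=m-A_0/\nu-A_1/\nu^3-A_2/\nu^5-\cdots$ obtained by equating coefficients of like powers of $\xi$, with $1+\log\lambda\xi$ treated as a constant. Then $B_k=b_k/q^{2k+1}$.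 The first coefficients are $$A_0=a_1,\qquad A_1=a_1a_2-a_3-\tfrac13a_1^3,\qquad A_2=a_1a_2^2+a_1^2a_3-a_1^3a_2-a_2a_3-a_1a_4+a_5+\tfrac15a_1^5,$$ $$B_0=\frac{-A_0}{1+q},\qquad B_1=\frac{A_0b_0-A_1-\frac12b_0^2}{q^2(1+q)},\qquad B_2=\frac{3A_1b_0-A_0(b_0^2-b_1)-A_2-b_0b_1+\frac16b_0^3}{q^4(1+q)},$$ with $$b_0=\frac{-A_0}{1+\log\lambda\xi},\qquad b_1=\frac{A_0b_0-A_1-\frac12b_0^2}{1+\log\lambda\xi}.$$ -/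

import Mathlib

noncomputable section

namespace NuZeros

/-! ### The Bessel functions of imaginary order -/

/-- The modified Bessel function of the first kind `I_μ(x)` of complex order `μ` at `x > 0`:
`(x/2)^μ / Γ(1+μ) * ∑_{k ≥ 0} (x/2)^(2k) / (k! (1+μ)_k)`, with `(a)_k` the Pochhammer symbol. -/
def besselI (μ : ℂ) (x : ℝ) : ℂ :=
  ((x / 2 : ℝ) : ℂ) ^ μ / Complex.Gamma (1 + μ) *
    ∑' k : ℕ, ((x / 2 : ℝ) : ℂ) ^ (2 * k) /
      ((k.factorial : ℂ) * (ascPochhammer ℂ k).eval (1 + μ))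

/-- The modified Bessel function of the second kind of imaginary order, `K_{iν}(x)`, for real
`ν ≠ 0` and `x > 0`: `π i / (2 sinh (π ν)) * (I_{iν}(x) - I_{-iν}(x))`. -/
def besselKImag (ν x : ℝ) : ℂ :=
  (Real.pi : ℂ) * Complex.I / ((2 * Real.sinh (Real.pi * ν) : ℝ) : ℂ) *
    (besselI (Complex.I * (ν : ℂ)) x - besselI (-(Complex.I * (ν : ℂ))) x)

/-- The set of positive `ν`-zeros of `K_{iν}(x)` for fixed `x`. -/
def positiveZeros (x : ℝ) : Set ℝ := {ν : ℝ | 0 < ν ∧ besselKImag ν x = 0}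

/-! ### The Lambert function -/

/-- The Lambert function `W(z)`, the positive solution of `W e^W = z`, for `z > 0`. -/
def lambertW (z : ℝ) : ℝ :=
  Function.invFunOn (fun w : ℝ => w * Real.exp w) (Set.Ioi 0) z

theorem lambertW_spec {z : ℝ} (hz : 0 < z) :
    0 < lambertW z ∧ lambertW z * Real.exp (lambertW z) = z := by
  have hex : ∃ w ∈ Set.Ioi (0 : ℝ), w * Real.exp w = z := by
    have hc : ContinuousOn (fun w : ℝ => w * Real.exp w) (Set.Icc 0 z) := by fun_prop
    have h1 : z ∈ Set.Icc ((fun w : ℝ => w * Real.exp w) 0)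
        ((fun w : ℝ => w * Real.exp w) z) := by
      refine ⟨by simpa using hz.le, ?_⟩
      have h2 : 1 ≤ Real.exp z := Real.one_le_exp hz.le
      show z ≤ z * Real.exp z
      nlinarith
    obtain ⟨w, hw, hwz⟩ := intermediate_value_Icc hz.le hc h1
    refine ⟨w, ?_, hwz⟩
    rcases hw.1.lt_or_eq with h | h
    · exact h
    · exfalso
      rw [← h] at hwz
      simp at hwz
      exact hz.ne hwz
  exact ⟨Function.invFunOn_mem (f := fun w : ℝ => w * Real.exp w) hex,
    Function.invFunOn_eq (f := fun w : ℝ => w * Real.exp w) hex⟩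

/-! ### The coefficients

All series are formal power series; every infinite sum is cut at a point beyond which the
summands do not contribute to the coefficient in question. -/

/-- The series `-∑_{j ≥ 1} b_{j+1} / (j (j+1)) u^j` (with `b_j` the Bernoulli numbers), that is,
the Stirling series of `-log (Γ(1+z) / (√(2πz) e^{-z} z^z))` in `u = 1/z`. -/
def stirlingExponent : PowerSeries ℝ :=
  PowerSeries.mk fun j : ℕ =>
    if j = 0 then 0 else -((bernoulli (j + 1) : ℚ) : ℝ) / ((j : ℝ) * ((j : ℝ) + 1))

/-- The Stirling coefficients `γ_k` in
`1/Γ(1+z) ~ (2πz)^{-1/2} e^z z^{-z} ∑_k γ_k / z^k`: the coefficients of the exponential of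
`stirlingExponent`. -/
def stirlingCoeff (k : ℕ) : ℝ :=
  PowerSeries.coeff k
    (∑ j ∈ Finset.range (k + 1), PowerSeries.C (1 / (j.factorial : ℝ)) * stirlingExponent ^ j)

/-- The coefficients `C_k(y)` in `∑_j y^j / (j! (1+z)_j) ~ ∑_k C_k(y) / z^k`; here
`(-1)^(k-j) S(k,j)`, with `S(k,j)` the Stirling numbers of the second kind, is the coefficient
of `z^{-k}` in `1 / (1+z)_j`. -/
def sumCoeff (y : ℝ) (k : ℕ) : ℝ :=
  ∑ j ∈ Finset.range (k + 1),
    (-1 : ℝ) ^ (k - j) * (Nat.stirlingSecond k j : ℝ) * y ^ j / (j.factorial : ℝ)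

/-- The coefficients `a_k = C_k(x²/4) + ∑_{r=1}^k γ_r C_{k-r}(x²/4)` (note `γ_0 = 1`) in
`I_{iν}(x) ~ e^{πν/2} (2πν)^{-1/2} e^{-iΦ} ∑_k a_k / (iν)^k`. -/
def aCoeff (x : ℝ) (k : ℕ) : ℝ :=
  ∑ r ∈ Finset.range (k + 1), stirlingCoeff r * sumCoeff (x ^ 2 / 4) (k - r)

/-- The series `1 - a₂ v² + a₄ v⁴ - ⋯` in `v = 1/ν`. -/
def evenSeries (x : ℝ) : PowerSeries ℝ :=
  PowerSeries.mk fun k : ℕ => if Even k then (-1 : ℝ) ^ (k / 2) * aCoeff x k else 0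

/-- The series `a₁ v - a₃ v³ + a₅ v⁵ - ⋯` in `v = 1/ν`. -/
def oddSeries (x : ℝ) : PowerSeries ℝ :=
  PowerSeries.mk fun k : ℕ => if Even k then 0 else (-1 : ℝ) ^ (k / 2) * aCoeff x k

/-- The coefficients `A_k` in `ε = A₀/ν + A₁/ν³ + A₂/ν⁵ + ⋯`, where
`tan ε = (a₁/ν - a₃/ν³ + ⋯) / (1 - a₂/ν² + ⋯)`: the coefficients of the arctangent series
`∑_j (-1)^j T^(2j+1) / (2j+1)` at the quotient `T` of the two series. -/
def ACoeff (x : ℝ) (k : ℕ) : ℝ :=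
  PowerSeries.coeff (2 * k + 1)
    (∑ j ∈ Finset.range (k + 1), PowerSeries.C ((-1 : ℝ) ^ j / (2 * (j : ℝ) + 1)) *
      (oddSeries x * (evenSeries x)⁻¹) ^ (2 * j + 1))

/-- The part `(1+δ) log(1+δ) - δ + ∑_i A_i t^(i+1) (1+δ)^(-(2i+1))` of the equation for `δ` below,
correct up to the coefficient of `t^(k+1)` if `δ` has constant term `0`; the power series
variable is `t`, and `(1+δ) log(1+δ) - δ = ∑_{j ≥ 2} (-1)^j δ^j / (j (j-1))`. -/
def formalRemainder (x : ℝ) (k : ℕ) (δ : PowerSeries ℝ) : PowerSeries ℝ :=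
  ∑ j ∈ Finset.Icc 2 (k + 1),
      PowerSeries.C ((-1 : ℝ) ^ j / ((j : ℝ) * ((j : ℝ) - 1))) * δ ^ j +
    ∑ i ∈ Finset.range (k + 1),
      PowerSeries.C (ACoeff x i) * PowerSeries.X ^ (i + 1) * ((1 + δ)⁻¹) ^ (2 * i + 1)

/-- The coefficients `b_k` of the formal solution `ν = ξ + b₀/ξ + b₁/ξ³ + b₂/ξ⁵ + ⋯` of
`ν log (lam ν) = m - A₀/ν - A₁/ν³ - ⋯`, where `ξ log (lam ξ) = m`, as functions of `q = ξ/m`.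
With `t = ξ⁻²` and `ν = ξ (1 + δ)`, `δ = b₀ t + b₁ t² + ⋯`, and because
`1 + log (lam ξ) = (1+q)/q`, the equation reads
`(1+q)/q δ + ((1+δ) log(1+δ) - δ) + ∑_i A_i t^(i+1) (1+δ)^(-(2i+1)) = 0`;
comparing the coefficients of `t^(k+1)` gives `b_k` in terms of `b_0, …, b_{k-1}`. -/
def bCoeff (x q : ℝ) (k : ℕ) : ℝ :=
  -(q / (1 + q)) * PowerSeries.coeff (k + 1)
    (formalRemainder x k (∑ j : Fin k, PowerSeries.C (bCoeff x q j.1) * PowerSeries.X ^ (j.1 + 1)))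
termination_by k
decreasing_by exact j.2

/-- `λ = 2/(e x)`. -/
def lam (x : ℝ) : ℝ := 2 / (Real.exp 1 * x)

/-- `m_- = (n - 1/4) π`. -/
def mMinus (n : ℕ) : ℝ := ((n : ℝ) - 1 / 4) * Real.pi

/-- `ξ = m / W(λ m)`, the solution of `ξ log (λ ξ) = m`. -/
def xi (x m : ℝ) : ℝ := m / lambertW (lam x * m)

/-- The ratio `ξ/m`. -/
def ratio (x m : ℝ) : ℝ := xi x m / m

/-- The coefficients `B_k`, for which `B_k / m^(2k+1) = b_k / ξ^(2k+1)`. -/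
def BCoeff (x m : ℝ) (k : ℕ) : ℝ := bCoeff x (ratio x m) k / ratio x m ^ (2 * k + 1)

end NuZeros

end

/-!
# The zeros of `ν ↦ K_{iν}(x)`

For real `ν > 0` the functions `I_{iν}(x)` and `I_{-iν}(x)` are complex conjugate, so `K_{iν}(x)`
vanishes if and only if the argument of `I_{iν}(x)` is a multiple of `π`. Everything rests on a
continuous choice of this argument, `besselPhase ν w` with `w = x²/4`. It is the sum of
`(ν/2) log w`, of minus the argument of `Γ(1+iν)` in Binet's form (`gammaPhase`) and of the argument
of the series `S = ∑ w^k / (k! (1+iν)_k)`, which has no zeros for `w ≥ 0`.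

*The zeros.* The square `P = |S|²` is the power series `∑ binom(2k,k) w^k / ∏_{1 ≤ j ≤ k} (j² + ν²)`
(`hasSum_pCoeff`), because `P` satisfies a third-order differential equation; its terms decrease in
`ν`. By the Wronskian relation (`im_wronskian`) the phase has the `w`-derivative `ν / (2 w P)`, which
therefore strictly increases with `ν`. For `w → ∞` the phase tends to `0`: comparison of the series
with that of `I₀` shows that `exp (i phase) → 1` (`tendsto_exp_besselPhase`), and the multiple of `2π`
is excluded by continuity in `ν` (`tendsto_besselPhase_atTop`). Integrating from infinity, the phase
strictly decreases in `ν` (`besselPhase_lt`), from `0` at `ν = 0` to `-∞`. Hence the zeros are the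
numbers `ν_n`, `n ≥ 1`, at which the phase is `-nπ` (`exists_zeros`).

*The equation for the zeros.* Binet's form of Stirling's formula gives
`-phase = ν log (λν) + π/4 + ε(ν)` (`neg_besselPhase_eq`), where `ε` is minus the argument of
`exp (-J(iν)) S` with Binet's function `J`. Stirling's series for `J` (`binetJ_expansion`) and the
expansion of the Pochhammer symbols in `1/(iν)` show that this function has the asymptotic series
`∑ a_k / (iν)^k`; real and imaginary part and the Taylor series of the arctangent then give
`ε ~ A₀/ν + A₁/ν³ + ⋯` (`phaseCorrection_isBigO`). Such manipulations of expansions are covered by the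
calculus of `HasExpansion`.

*The inversion.* With `ξ = m/W(λm)` one has `ξ log (λξ) = m`. The truncated formal solution
`ξ (1 + b₀/ξ² + ⋯)` satisfies `ν log (λν) + ε(ν) = m` up to `O(ξ^(-2N-1))` (`residual_isBigO`), and the
coefficients `b_k` stay bounded as `q → 0`. As `ν log (λν)` expands distances near `ξ` by a factor of
at least `W` (`mul_abs_sub_le_abs_mul_log_sub`), while `ε` is Lipschitz continuous up to an error of
the same order, the distance between `ν_n` and the truncated solution is
`O(ξ^(-2N-1) / W) = O(W^(2N) / m^(2N+1))` (`sub_expansion_isBigO`).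
-/

namespace NuZeros

open Asymptotics Filter Topology MeasureTheory

/-! ### Asymptotic expansions with varying coefficients -/

section Expansion

variable {ι 𝕜 : Type*} [NormedField 𝕜] {l : Filter ι} {v : ι → 𝕜} {N : ℕ}

/-- `f` has, along `l` and to the order `N` in the small quantity `v`, the expansion given by the
power series `p`. The series may depend on the index, as long as its relevant coefficients stay
bounded; this is needed because the `b_k` depend on `q`. -/
def HasExpansion (l : Filter ι) (v : ι → 𝕜) (N : ℕ) (f : ι → 𝕜) (p : ι → PowerSeries 𝕜) : Prop :=
  (∀ k < N, (fun i => PowerSeries.coeff k (p i)) =O[l] (fun _ => (1 : ℝ))) ∧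
    (fun i => f i - ∑ k ∈ Finset.range N, PowerSeries.coeff k (p i) * v i ^ k) =O[l]
      (fun i => v i ^ N)

theorem pow_isBigO_pow (hv : v =O[l] (fun _ => (1 : ℝ))) {M N : ℕ} (h : M ≤ N) :
    (fun i => v i ^ N) =O[l] (fun i => v i ^ M) := by
  obtain ⟨k, rfl⟩ := Nat.exists_eq_add_of_le h
  have h1 : (fun i => v i ^ k) =O[l] (fun _ => (1 : ℝ)) := by
    simpa using hv.pow k
  have h2 := (isBigO_refl (fun i => ‖v i ^ M‖) l).mul h1.norm_left
  refine (IsBigO.of_norm_left ?_).trans (h2.trans ?_)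
  · refine (isBigO_refl _ l).congr_left fun i => ?_
    rw [pow_add, norm_mul]
  · simpa using (isBigO_refl (fun i => v i ^ M) l).norm_left

theorem HasExpansion.mono (hv : v =O[l] (fun _ => (1 : ℝ))) {f : ι → 𝕜}
    {p : ι → PowerSeries 𝕜} (h : HasExpansion l v N f p) {M : ℕ} (hM : M ≤ N) :
    HasExpansion l v M f p := by
  refine ⟨fun k hk => h.1 k (hk.trans_le hM), ?_⟩
  have h1 : (fun i => ∑ k ∈ Finset.Ico M N, PowerSeries.coeff k (p i) * v i ^ k) =O[l]
      (fun i => v i ^ M) := by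
    refine IsBigO.fun_sum fun k hk => ?_
    rw [Finset.mem_Ico] at hk
    have := (h.1 k hk.2).mul (pow_isBigO_pow hv hk.1).norm_right
    refine (this.congr_right (fun i => one_mul _)).of_norm_right
  refine ((h.2.trans (pow_isBigO_pow hv hM)).add h1).congr_left fun i => ?_
  rw [← Finset.sum_range_add_sum_Ico _ hM]
  ring

theorem HasExpansion.isBigO_one (hv : v =O[l] (fun _ => (1 : ℝ))) {f : ι → 𝕜}
    {p : ι → PowerSeries 𝕜} (h : HasExpansion l v N f p) : f =O[l] (fun _ => (1 : ℝ)) := by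
  have := (h.mono hv (Nat.zero_le N)).2
  simp only [Finset.range_zero, Finset.sum_empty, sub_zero, pow_zero] at this
  exact this.trans (IsBigO.of_bound 1 (by simp))

theorem HasExpansion.congr_coeff {f : ι → 𝕜} {p q : ι → PowerSeries 𝕜}
    (h : HasExpansion l v N f p)
    (hpq : ∀ i, ∀ k < N, PowerSeries.coeff k (p i) = PowerSeries.coeff k (q i)) :
    HasExpansion l v N f q := by
  refine ⟨fun k hk => (h.1 k hk).congr_left fun i => hpq i k hk, h.2.congr_left fun i => ?_⟩
  congr 1
  exact Finset.sum_congr rfl fun k hk => by rw [hpq i k (Finset.mem_range.1 hk)]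

theorem HasExpansion.of_sub_isBigO {f g : ι → 𝕜} {p : ι → PowerSeries 𝕜}
    (h : HasExpansion l v N f p) (hg : (fun i => g i - f i) =O[l] (fun i => v i ^ N)) :
    HasExpansion l v N g p :=
  ⟨h.1, (hg.add h.2).congr_left fun i => by ring⟩

theorem HasExpansion.congr_left {f g : ι → 𝕜} {p : ι → PowerSeries 𝕜}
    (h : HasExpansion l v N f p) (hg : f =ᶠ[l] g) : HasExpansion l v N g p :=
  ⟨h.1, h.2.congr' (by filter_upwards [hg] with i hi; rw [hi]) (EventuallyEq.refl _ _)⟩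

theorem hasExpansion_const {c : ι → 𝕜} (hc : c =O[l] (fun _ => (1 : ℝ))) :
    HasExpansion l v N c (fun i => PowerSeries.C (c i)) := by
  refine ⟨fun k _ => ?_, ?_⟩
  · rcases eq_or_ne k 0 with rfl | hk
    · simpa using hc
    · simp only [PowerSeries.coeff_C, hk, if_false]
      exact isBigO_zero _ _
  · rcases Nat.eq_zero_or_pos N with rfl | hN
    · simpa using hc.trans (isBigO_const_const (1 : ℝ) (one_ne_zero (α := 𝕜)) l)
    · have : ∀ i, c i - ∑ k ∈ Finset.range N, PowerSeries.coeff k (PowerSeries.C (c i)) * v i ^ k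
          = 0 := by
        intro i
        rw [Finset.sum_eq_single 0]
        · simp
        · intro b _ hb
          simp [PowerSeries.coeff_C, hb]
        · intro h
          simp at h
          omega
      simp only [this]
      exact isBigO_zero _ _

theorem hasExpansion_var (hv : v =O[l] (fun _ => (1 : ℝ))) :
    HasExpansion l v N v (fun _ => PowerSeries.X) := by
  refine ⟨fun k _ => isBigO_const_const _ one_ne_zero _, ?_⟩
  rcases Nat.lt_or_ge 1 N with hN | hN
  · have : ∀ i, v i - ∑ k ∈ Finset.range N, PowerSeries.coeff k (PowerSeries.X) * v i ^ k
        = 0 := by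
      intro i
      rw [Finset.sum_eq_single 1]
      · simp
      · intro b _ hb
        simp [PowerSeries.coeff_X, hb]
      · intro h
        simp at h
        omega
    simp only [this]
    exact isBigO_zero _ _
  · have h1 : ∀ i, ∑ k ∈ Finset.range N, PowerSeries.coeff k (PowerSeries.X) * v i ^ k = 0 := by
      intro i
      refine Finset.sum_eq_zero fun k hk => ?_
      rw [Finset.mem_range] at hk
      rw [PowerSeries.coeff_X, if_neg (by omega), zero_mul]
    simp only [h1, sub_zero]
    have := pow_isBigO_pow hv hN
    simpa using this

theorem HasExpansion.add {f g : ι → 𝕜} {p q : ι → PowerSeries 𝕜}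
    (hf : HasExpansion l v N f p) (hg : HasExpansion l v N g q) :
    HasExpansion l v N (fun i => f i + g i) (fun i => p i + q i) := by
  refine ⟨fun k hk => ?_, ?_⟩
  · simpa using (hf.1 k hk).add (hg.1 k hk)
  · refine (hf.2.add hg.2).congr_left fun i => ?_
    simp only [map_add, add_mul, Finset.sum_add_distrib]
    ring

theorem HasExpansion.mul (hv : v =O[l] (fun _ => (1 : ℝ))) {f g : ι → 𝕜}
    {p q : ι → PowerSeries 𝕜}
    (hf : HasExpansion l v N f p) (hg : HasExpansion l v N g q) :
    HasExpansion l v N (fun i => f i * g i) (fun i => p i * q i) := by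
  refine ⟨fun k hk => ?_, ?_⟩
  · simp only [PowerSeries.coeff_mul]
    refine IsBigO.fun_sum fun a ha => ?_
    have ha' := Finset.HasAntidiagonal.mem_antidiagonal.1 ha
    simpa using (hf.1 a.1 (by omega)).mul (hg.1 a.2 (by omega))
  · have key : ∀ i, ∑ k ∈ Finset.range N, PowerSeries.coeff k (p i * q i) * v i ^ k =
        ∑ a ∈ Finset.range N, PowerSeries.coeff a (p i) * v i ^ a *
          ∑ b ∈ Finset.range (N - a), PowerSeries.coeff b (q i) * v i ^ b := by
      intro i
      simp only [Finset.mul_sum]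
      rw [← Finset.sum_range_diag_flip N (fun a b => PowerSeries.coeff a (p i) * v i ^ a *
        (PowerSeries.coeff b (q i) * v i ^ b))]
      refine Finset.sum_congr rfl fun k _ => ?_
      rw [PowerSeries.coeff_mul, Finset.Nat.sum_antidiagonal_eq_sum_range_succ_mk, Finset.sum_mul]
      refine Finset.sum_congr rfl fun a ha => ?_
      have : a ≤ k := Nat.lt_succ_iff.1 (Finset.mem_range.1 ha)
      rw [mul_mul_mul_comm, ← pow_add, Nat.add_sub_cancel' this]
    have h1 : (fun i => ∑ a ∈ Finset.range N, PowerSeries.coeff a (p i) * v i ^ a *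
        (g i - ∑ b ∈ Finset.range (N - a), PowerSeries.coeff b (q i) * v i ^ b)) =O[l]
        (fun i => v i ^ N) := by
      refine IsBigO.fun_sum fun a ha => ?_
      have ha' := Finset.mem_range.1 ha
      have h2 := (((hf.1 a ha').norm_left.mul (isBigO_refl (fun i => ‖v i ^ a‖) l))).mul
        (hg.mono hv (Nat.sub_le N a)).2.norm_norm
      refine (IsBigO.of_norm_left ?_).of_norm_right
      refine h2.congr (fun i => by rw [norm_mul, norm_mul]) (fun i => ?_)
      rw [one_mul, ← norm_mul, ← pow_add, Nat.add_sub_cancel' ha'.le]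
    have h3 := (hf.2.norm_norm.mul (hg.isBigO_one hv).norm_left)
    have h4 : (fun i => (f i - ∑ k ∈ Finset.range N, PowerSeries.coeff k (p i) * v i ^ k) * g i)
        =O[l] (fun i => v i ^ N) :=
      ((IsBigO.of_norm_left (h3.congr (fun i => (norm_mul _ _).symm) (fun i => mul_one _)))
        ).of_norm_right
    refine (h1.add h4).congr_left fun i => ?_
    rw [key]
    simp only [mul_sub, Finset.sum_sub_distrib, sub_mul, Finset.sum_mul]
    ring

theorem HasExpansion.pow (hv : v =O[l] (fun _ => (1 : ℝ))) {f : ι → 𝕜}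
    {p : ι → PowerSeries 𝕜} (hf : HasExpansion l v N f p) (n : ℕ) :
    HasExpansion l v N (fun i => f i ^ n) (fun i => p i ^ n) := by
  induction n with
  | zero =>
    have := hasExpansion_const (l := l) (v := v) (N := N) (c := fun _ => (1 : 𝕜))
      (isBigO_const_const _ one_ne_zero _)
    simpa using this
  | succ n ih =>
    simp only [pow_succ]
    exact ih.mul hv hf

theorem HasExpansion.sum {α : Type*} (s : Finset α) {f : α → ι → 𝕜}
    {p : α → ι → PowerSeries 𝕜} (hf : ∀ a ∈ s, HasExpansion l v N (f a) (p a)) :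
    HasExpansion l v N (fun i => ∑ a ∈ s, f a i) (fun i => ∑ a ∈ s, p a i) := by
  classical
  induction s using Finset.induction_on with
  | empty =>
    have := hasExpansion_const (l := l) (v := v) (N := N) (c := fun _ => (0 : 𝕜))
      (isBigO_const_const _ one_ne_zero _)
    simpa using this
  | insert a s ha ih =>
    simp only [Finset.sum_insert ha]
    exact (hf a (Finset.mem_insert_self a s)).add
      (ih fun b hb => hf b (Finset.mem_insert_of_mem hb))

theorem HasExpansion.const_mul (hv : v =O[l] (fun _ => (1 : ℝ))) {f : ι → 𝕜}
    {p : ι → PowerSeries 𝕜} (hf : HasExpansion l v N f p) {c : ι → 𝕜}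
    (hc : c =O[l] (fun _ => (1 : ℝ))) :
    HasExpansion l v N (fun i => c i * f i) (fun i => PowerSeries.C (c i) * p i) :=
  (hasExpansion_const hc).mul hv hf

/-- Substitution of an expansion into a function with a known Taylor polynomial. -/
theorem HasExpansion.comp (hv : v =O[l] (fun _ => (1 : ℝ))) {f g : ι → 𝕜}
    {p : ι → PowerSeries 𝕜} (hf : HasExpansion l v N f p) (hfv : f =O[l] v) (c : ℕ → 𝕜)
    (hg : (fun i => g i - ∑ j ∈ Finset.range N, c j * f i ^ j) =O[l] (fun i => f i ^ N)) :
    HasExpansion l v N g (fun i => ∑ j ∈ Finset.range N, PowerSeries.C (c j) * p i ^ j) :=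
  (HasExpansion.sum (Finset.range N) fun j _ => (hf.pow hv j).const_mul hv (c := fun _ => c j)
    (isBigO_const_const _ one_ne_zero _)).of_sub_isBigO (hg.trans (hfv.pow N))

/-- The coefficients of a reciprocal are polynomials in those of the series. -/
theorem coeff_inv_isBigO {p : ι → PowerSeries 𝕜} (h0 : ∀ i, PowerSeries.constantCoeff (p i) = 1)
    (hp : ∀ k < N, (fun i => PowerSeries.coeff k (p i)) =O[l] (fun _ => (1 : ℝ))) :
    ∀ k < N, (fun i => PowerSeries.coeff k (p i)⁻¹) =O[l] (fun _ => (1 : ℝ)) := by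
  intro k
  induction k using Nat.strong_induction_on with
  | _ k ih =>
    intro hk
    have hc := fun i => PowerSeries.coeff_inv k (p i)
    simp only [h0, inv_one] at hc
    refine IsBigO.congr_left ?_ (fun i => (hc i).symm)
    split_ifs with hk0
    · exact isBigO_const_const _ one_ne_zero _
    · simp only [neg_mul, one_mul]
      refine IsBigO.neg_left (IsBigO.fun_sum fun a ha => ?_)
      have ha' := Finset.HasAntidiagonal.mem_antidiagonal.1 ha
      split_ifs with hlt
      · simpa using (hp a.1 (by omega)).mul (ih a.2 hlt (by omega))
      · exact isBigO_zero _ _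

theorem hasExpansion_partialSum {p : ι → PowerSeries 𝕜}
    (hp : ∀ k < N, (fun i => PowerSeries.coeff k (p i)) =O[l] (fun _ => (1 : ℝ))) :
    HasExpansion l v N (fun i => ∑ k ∈ Finset.range N, PowerSeries.coeff k (p i) * v i ^ k) p :=
  ⟨hp, by simpa using isBigO_zero _ _⟩

/-- Reciprocals of functions tending to `1`. -/
theorem HasExpansion.inv (hv : v =O[l] (fun _ => (1 : ℝ))) {f : ι → 𝕜}
    {p : ι → PowerSeries 𝕜} (hf : HasExpansion l v N f p)
    (h0 : ∀ i, PowerSeries.constantCoeff (p i) = 1) (hf1 : Tendsto f l (𝓝 1)) :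
    HasExpansion l v N (fun i => (f i)⁻¹) (fun i => (p i)⁻¹) := by
  have hq := coeff_inv_isBigO h0 hf.1
  refine ⟨hq, ?_⟩
  have h1 := (hf.mul hv (hasExpansion_partialSum hq)).2
  have hinv : Tendsto (fun i => (f i)⁻¹) l (𝓝 1) := by
    simpa using hf1.inv₀ one_ne_zero
  have h2 : (fun i => (f i)⁻¹) =O[l] (fun _ => (1 : ℝ)) := hinv.isBigO_one ℝ
  have hne : ∀ᶠ i in l, f i ≠ 0 := hf1.eventually_ne one_ne_zero
  have hone : (fun i => (1 : 𝕜) - ∑ k ∈ Finset.range N,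
      PowerSeries.coeff k (p i * (p i)⁻¹) * v i ^ k) =O[l] (fun i => v i ^ N) := by
    have := (hasExpansion_const (l := l) (v := v) (N := N) (c := fun _ => (1 : 𝕜))
      (isBigO_const_const _ one_ne_zero _)).2
    refine this.congr_left fun i => ?_
    rw [PowerSeries.mul_inv_cancel _ (by rw [h0]; exact one_ne_zero)]
    simp
  have h3 := hone.sub h1
  have h4 := h2.norm_left.mul h3.norm_norm
  refine (IsBigO.of_norm_left ?_).of_norm_right
  refine h4.congr' ?_ (Eventually.of_forall fun i => one_mul _)
  filter_upwards [hne] with i hi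
  rw [← norm_mul]
  congr 1
  field_simp
  ring

end Expansion

/-! ### The formal series -/

section Formal

open PowerSeries

theorem coeff_evenSeries (x : ℝ) (k : ℕ) :
    coeff k (evenSeries x) = if Even k then (-1 : ℝ) ^ (k / 2) * aCoeff x k else 0 := by
  simp [evenSeries]

theorem coeff_oddSeries (x : ℝ) (k : ℕ) :
    coeff k (oddSeries x) = if Even k then 0 else (-1 : ℝ) ^ (k / 2) * aCoeff x k := by
  simp [oddSeries]

theorem aCoeff_zero (x : ℝ) : aCoeff x 0 = 1 := by
  simp [aCoeff, stirlingCoeff, sumCoeff]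

theorem constantCoeff_evenSeries (x : ℝ) : constantCoeff (evenSeries x) = 1 := by
  rw [← coeff_zero_eq_constantCoeff_apply, coeff_evenSeries]
  simp [aCoeff_zero]

theorem constantCoeff_oddSeries (x : ℝ) : constantCoeff (oddSeries x) = 0 := by
  rw [← coeff_zero_eq_constantCoeff_apply, coeff_oddSeries]
  simp

/-- The quotient `T = (a₁ v - a₃ v³ + ⋯) / (1 - a₂ v² + ⋯)`; the `A_k` are the coefficients of
`arctan T`. -/
noncomputable def tangentSeries (x : ℝ) : PowerSeries ℝ := oddSeries x * (evenSeries x)⁻¹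

/-- The first coefficients of the quotient, from `evenSeries x * tangentSeries x = oddSeries x`. -/
theorem tangentSeries_eq_X_mul (x : ℝ) : ∃ U : PowerSeries ℝ, tangentSeries x = X * U ∧
    coeff 0 U = aCoeff x 1 ∧ coeff 1 U = 0 ∧ coeff 2 U = aCoeff x 1 * aCoeff x 2 - aCoeff x 3 ∧
    coeff 4 U = aCoeff x 1 * (aCoeff x 2 ^ 2 - aCoeff x 4) - aCoeff x 3 * aCoeff x 2
      + aCoeff x 5 := by
  have h0 : constantCoeff (tangentSeries x) = 0 := by
    rw [tangentSeries, map_mul, constantCoeff_oddSeries, zero_mul]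
  obtain ⟨U, hU⟩ := X_dvd_iff.2 h0
  have hm : evenSeries x * tangentSeries x = oddSeries x := by
    rw [tangentSeries, mul_left_comm, PowerSeries.mul_inv_cancel, mul_one]
    rw [constantCoeff_evenSeries]; exact one_ne_zero
  have hc : ∀ k, coeff (k + 1) (oddSeries x) = coeff k (evenSeries x * U) := by
    intro k
    rw [← hm, hU, mul_left_comm, coeff_succ_X_mul]
  have e0 := hc 0
  have e1 := hc 1
  have e2 := hc 2
  have e3 := hc 3
  have e4 := hc 4
  have n1 : ¬ Even 1 := by decide
  have n3 : ¬ Even 3 := by decide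
  have n5 : ¬ Even 5 := by decide
  have p2 : Even 2 := by decide
  have p4 : Even 4 := by decide
  simp only [coeff_mul, Finset.Nat.antidiagonal_succ, Finset.Nat.antidiagonal_zero,
    coeff_evenSeries, coeff_oddSeries, Finset.sum_cons, Finset.map_cons,
    Finset.map_singleton, Finset.sum_singleton, Function.Embedding.prodMap,
    Function.Embedding.coeFn_mk, Prod.map, Function.Embedding.refl_apply, Nat.succ_eq_add_one,
    Nat.reduceAdd, Nat.reduceDiv, aCoeff_zero, n1, n3, n5, p2, p4, if_true, if_false,
    Even.zero] at e0 e1 e2 e3 e4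
  norm_num at e0 e1 e2 e3 e4
  refine ⟨U, hU, by simpa using e0.symm, e1.symm, ?_, ?_⟩
  · rw [e0]
    linarith
  · have e2' : coeff 2 U = aCoeff x 2 * coeff 0 U - aCoeff x 3 := by
      simp only [coeff_zero_eq_constantCoeff] at *
      linarith
    have e4' : coeff 4 U = aCoeff x 5 + aCoeff x 2 * coeff 2 U - aCoeff x 4 * coeff 0 U := by
      simp only [coeff_zero_eq_constantCoeff] at *
      linarith
    have e0' : coeff 0 U = aCoeff x 1 := by simpa using e0.symm
    rw [e4', e2', e0']
    ring

theorem ACoeff_zero (x : ℝ) : ACoeff x 0 = aCoeff x 1 := by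
  obtain ⟨U, hU, h0, -⟩ := tangentSeries_eq_X_mul x
  rw [ACoeff, ← tangentSeries, hU]
  simpa [mul_comm X] using h0

theorem coeff_X_mul_pow (U : PowerSeries ℝ) (n k : ℕ) :
    coeff (k + n) ((X * U) ^ n) = coeff k (U ^ n) := by
  rw [mul_pow, mul_comm, coeff_mul_X_pow]

theorem ACoeff_one (x : ℝ) :
    ACoeff x 1 = aCoeff x 1 * aCoeff x 2 - aCoeff x 3 - aCoeff x 1 ^ 3 / 3 := by
  obtain ⟨U, hU, h0, h1, h2, -⟩ := tangentSeries_eq_X_mul x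
  rw [ACoeff, ← tangentSeries, hU]
  simp only [Finset.sum_range_succ, Finset.range_zero, Finset.sum_empty, map_add, coeff_C_mul]
  have a3 := coeff_X_mul_pow U 3 0
  norm_num at a3 ⊢
  rw [a3]
  simp only [coeff_zero_eq_constantCoeff] at h0
  rw [h0, h2]
  ring

theorem ACoeff_two (x : ℝ) :
    ACoeff x 2 = aCoeff x 1 * aCoeff x 2 ^ 2 + aCoeff x 1 ^ 2 * aCoeff x 3
        - aCoeff x 1 ^ 3 * aCoeff x 2 - aCoeff x 2 * aCoeff x 3 - aCoeff x 1 * aCoeff x 4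
        + aCoeff x 5 + aCoeff x 1 ^ 5 / 5 := by
  obtain ⟨U, hU, h0, h1, h2, h4⟩ := tangentSeries_eq_X_mul x
  rw [ACoeff, ← tangentSeries, hU]
  simp only [Finset.sum_range_succ, Finset.range_zero, Finset.sum_empty, map_add, coeff_C_mul]
  have a3 := coeff_X_mul_pow U 3 2
  have a5 := coeff_X_mul_pow U 5 0
  have u3 : coeff 2 (U ^ 3) = 3 * coeff 0 U ^ 2 * coeff 2 U := by
    simp [pow_succ, coeff_mul, Finset.Nat.antidiagonal_succ, h1]
    ring
  norm_num at a3 a5 ⊢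
  rw [a3, a5, u3]
  simp only [coeff_zero_eq_constantCoeff] at h0 ⊢
  rw [h0, h2, h4]
  ring

theorem bCoeff_eq (x q : ℝ) (k : ℕ) : bCoeff x q k = -(q / (1 + q)) * coeff (k + 1)
    (formalRemainder x k (∑ j ∈ Finset.range k, C (bCoeff x q j) * X ^ (j + 1))) := by
  rw [bCoeff, Finset.sum_range]

theorem bCoeff_zero (x q : ℝ) : bCoeff x q 0 = -(q / (1 + q)) * ACoeff x 0 := by
  rw [bCoeff_eq]
  simp [formalRemainder]

theorem coeff_one_inv {d : PowerSeries ℝ} (h : constantCoeff d = 0) :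
    coeff 1 (1 + d)⁻¹ = -coeff 1 d := by
  have := coeff_inv 1 (1 + d)
  simpa [h, Finset.Nat.antidiagonal_succ, coeff_one] using this

theorem coeff_two_inv {d : PowerSeries ℝ} (h : constantCoeff d = 0) :
    coeff 2 (1 + d)⁻¹ = coeff 1 d ^ 2 - coeff 2 d := by
  have := coeff_inv 2 (1 + d)
  rw [this]
  simp [h, Finset.Nat.antidiagonal_succ, coeff_one, coeff_one_inv h]
  ring

theorem bCoeff_one (x q : ℝ) : bCoeff x q 1 = -(q / (1 + q)) *
    (bCoeff x q 0 ^ 2 / 2 - ACoeff x 0 * bCoeff x q 0 + ACoeff x 1) := by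
  rw [bCoeff_eq]
  congr 1
  set b0 := bCoeff x q 0
  have hd : ∑ j ∈ Finset.range 1, C (bCoeff x q j) * X ^ (j + 1) = C b0 * X := by simp [b0]
  rw [hd]
  have hd0 : constantCoeff (C b0 * X) = 0 := by simp
  have e0 : coeff 0 (1 + C b0 * X)⁻¹ = 1 := by simp
  have e1 := coeff_one_inv hd0
  have f1 : coeff 1 (C b0 * X) = b0 := by simp
  rw [f1] at e1
  simp only [formalRemainder, Finset.sum_range_succ, Finset.range_zero, Finset.sum_empty, map_add]
  have s2 : coeff 2 ((C b0 * X) ^ 2) = b0 ^ 2 := by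
    rw [mul_pow, ← map_pow, coeff_C_mul]; simp
  rw [show Finset.Icc 2 (1 + 1) = {2} from rfl, Finset.sum_singleton, coeff_C_mul, s2]
  simp only [mul_assoc, coeff_C_mul, coeff_X_pow_mul']
  norm_num [e1, e0]
  ring

theorem bCoeff_two (x q : ℝ) : bCoeff x q 2 = -(q / (1 + q)) *
    (bCoeff x q 0 * bCoeff x q 1 - bCoeff x q 0 ^ 3 / 6 +
      ACoeff x 0 * (bCoeff x q 0 ^ 2 - bCoeff x q 1) - 3 * ACoeff x 1 * bCoeff x q 0
      + ACoeff x 2) := by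
  rw [bCoeff_eq]
  congr 1
  set b0 := bCoeff x q 0
  set b1 := bCoeff x q 1
  have hd : ∑ j ∈ Finset.range 2, C (bCoeff x q j) * X ^ (j + 1) = X * (C b0 + C b1 * X) := by
    simp [Finset.sum_range_succ, b0, b1]; ring
  rw [hd]
  set d : PowerSeries ℝ := X * (C b0 + C b1 * X) with hdd
  have hd0 : constantCoeff d = 0 := by simp [hdd]
  have f1 : coeff 1 d = b0 := by simp [hdd]
  have f2 : coeff 2 d = b1 := by
    rw [hdd, coeff_succ_X_mul]; simp [coeff_C]
  have e0 : coeff 0 (1 + d)⁻¹ = 1 := by simp [hd0]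
  have e1 := coeff_one_inv hd0
  have e2 := coeff_two_inv hd0
  rw [f1] at e1 e2
  rw [f2] at e2
  have s2 : coeff 3 (d ^ 2) = 2 * b0 * b1 := by
    rw [hdd, show (3 : ℕ) = 1 + 2 from rfl, coeff_X_mul_pow]
    simp [pow_succ, coeff_mul, Finset.Nat.antidiagonal_succ]
    ring
  have s3 : coeff 3 (d ^ 3) = b0 ^ 3 := by
    rw [hdd, show (3 : ℕ) = 0 + 3 from rfl, coeff_X_mul_pow]
    simp
  simp only [formalRemainder, Finset.sum_range_succ, Finset.range_zero, Finset.sum_empty, map_add]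
  rw [show Finset.Icc 2 (2 + 1) = {2, 3} from rfl, Finset.sum_pair (by norm_num), map_add,
    coeff_C_mul, coeff_C_mul, s2, s3]
  have g1 : coeff 1 ((1 + d)⁻¹ ^ 3) = -(3 * b0) := by
    have g : ∀ u : PowerSeries ℝ, coeff 1 (u ^ 3) = 3 * coeff 0 u ^ 2 * coeff 1 u := by
      intro u
      simp [pow_succ, coeff_mul, Finset.Nat.antidiagonal_succ]
      ring
    rw [g, e0, e1]
    ring
  simp only [mul_assoc, coeff_C_mul, coeff_X_pow_mul']
  norm_num [e1, e0, e2, g1, hd0]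
  ring

/-! The recursion for the `b_k` states that the coefficients of the full equation vanish, because
each of them depends on finitely many terms only. -/

theorem X_pow_dvd_pow_sub_pow {a b : PowerSeries ℝ} {n : ℕ} (h : X ^ n ∣ a - b) (j : ℕ) :
    X ^ n ∣ a ^ j - b ^ j := h.trans (sub_dvd_pow_sub_pow a b j)

theorem X_pow_dvd_inv_sub_inv {a b : PowerSeries ℝ} {n : ℕ} (ha : constantCoeff a ≠ 0)
    (hb : constantCoeff b ≠ 0) (h : X ^ n ∣ a - b) : X ^ n ∣ a⁻¹ - b⁻¹ := by
  have : a⁻¹ - b⁻¹ = (a - b) * (-(a⁻¹ * b⁻¹)) := by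
    have h1 := PowerSeries.mul_inv_cancel a ha
    have h2 := PowerSeries.mul_inv_cancel b hb
    linear_combination (-a⁻¹) * h2 + b⁻¹ * h1
  rw [this]
  exact h.mul_right _

/-- The coefficient of `t^(k+1)` in the remainder only involves the terms of `δ` below
`t^(k+1)`. -/
theorem coeff_formalRemainder_congr (x : ℝ) {k K : ℕ} (hkK : k ≤ K) {d e : PowerSeries ℝ}
    (hd : constantCoeff d = 0) (he : constantCoeff e = 0) (h : X ^ (k + 1) ∣ d - e) :
    coeff (k + 1) (formalRemainder x K d) = coeff (k + 1) (formalRemainder x k e) := by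
  have hsub : X ^ (k + 2) ∣ formalRemainder x K d - formalRemainder x k e := by
    have hpow : ∀ j, 2 ≤ j → X ^ (k + 2) ∣ d ^ j - e ^ j := by
      intro j hj
      obtain ⟨i, rfl⟩ := Nat.exists_eq_add_of_le' hj
      have : d ^ (i + 2) - e ^ (i + 2) = (d ^ (i + 1) - e ^ (i + 1)) * d +
          e ^ i * (e * (d - e)) := by ring
      rw [this]
      have hX : X ∣ d := X_dvd_iff.2 hd
      have hX' : X ∣ e := X_dvd_iff.2 he
      refine dvd_add ?_ (Dvd.dvd.mul_left ?_ _)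
      · rw [pow_succ]
        exact mul_dvd_mul (X_pow_dvd_pow_sub_pow h _) hX
      · rw [pow_succ, mul_comm]
        exact mul_dvd_mul hX' h
    have hlarge : ∀ j, k + 2 ≤ j → X ^ (k + 2) ∣ d ^ j := fun j hj =>
      (pow_dvd_pow_of_dvd (X_dvd_iff.2 hd) _).trans (pow_dvd_pow d hj)
    have h1 : X ^ (k + 2) ∣ ∑ j ∈ Finset.Icc 2 (K + 1),
          C ((-1 : ℝ) ^ j / ((j : ℝ) * ((j : ℝ) - 1))) * d ^ j -
        ∑ j ∈ Finset.Icc 2 (k + 1), C ((-1 : ℝ) ^ j / ((j : ℝ) * ((j : ℝ) - 1))) * e ^ j := by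
      have hs : Finset.Icc 2 (k + 1) ⊆ Finset.Icc 2 (K + 1) :=
        Finset.Icc_subset_Icc_right (by omega)
      rw [← Finset.sum_sdiff hs, add_sub_assoc, ← Finset.sum_sub_distrib]
      refine dvd_add (Finset.dvd_sum fun j hj => (hlarge j ?_).mul_left _)
        (Finset.dvd_sum fun j hj => ?_)
      · simp only [Finset.mem_sdiff, Finset.mem_Icc] at hj
        omega
      · rw [← mul_sub]
        exact (hpow j (Finset.mem_Icc.1 hj).1).mul_left _
    have h2 : X ^ (k + 2) ∣ ∑ i ∈ Finset.range (K + 1),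
          C (ACoeff x i) * X ^ (i + 1) * ((1 + d)⁻¹) ^ (2 * i + 1) -
        ∑ i ∈ Finset.range (k + 1),
          C (ACoeff x i) * X ^ (i + 1) * ((1 + e)⁻¹) ^ (2 * i + 1) := by
      have hs : Finset.range (k + 1) ⊆ Finset.range (K + 1) :=
        Finset.range_subset_range.2 (by omega)
      rw [← Finset.sum_sdiff hs, add_sub_assoc, ← Finset.sum_sub_distrib]
      refine dvd_add (Finset.dvd_sum fun i hi => ?_) (Finset.dvd_sum fun i hi => ?_)
      · simp only [Finset.mem_sdiff, Finset.mem_range] at hi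
        exact ((pow_dvd_pow X (by omega)).mul_left _).mul_right _
      · rw [← mul_sub, mul_assoc]
        refine Dvd.dvd.mul_left ?_ _
        have h3 : X ^ (k + 1) ∣ (1 + d)⁻¹ ^ (2 * i + 1) - (1 + e)⁻¹ ^ (2 * i + 1) :=
          X_pow_dvd_pow_sub_pow (X_pow_dvd_inv_sub_inv (by simp [hd]) (by simp [he])
            (by simpa using h)) _
        rw [show k + 2 = 1 + (k + 1) by omega, pow_add X 1 (k + 1)]
        exact mul_dvd_mul (pow_dvd_pow X (by omega)) h3
    have : formalRemainder x K d - formalRemainder x k e = (∑ j ∈ Finset.Icc 2 (K + 1),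
          C ((-1 : ℝ) ^ j / ((j : ℝ) * ((j : ℝ) - 1))) * d ^ j -
        ∑ j ∈ Finset.Icc 2 (k + 1), C ((-1 : ℝ) ^ j / ((j : ℝ) * ((j : ℝ) - 1))) * e ^ j) +
        (∑ i ∈ Finset.range (K + 1),
          C (ACoeff x i) * X ^ (i + 1) * ((1 + d)⁻¹) ^ (2 * i + 1) -
        ∑ i ∈ Finset.range (k + 1),
          C (ACoeff x i) * X ^ (i + 1) * ((1 + e)⁻¹) ^ (2 * i + 1)) := by
      simp only [formalRemainder]; ring
    rw [this]
    exact dvd_add h1 h2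
  have := X_pow_dvd_iff.1 hsub (k + 1) (by omega)
  rwa [map_sub, sub_eq_zero] at this

/-- The truncated formal solution `b₀ t + ⋯ + b_{N-1} t^N`. -/
noncomputable def deltaSeries (x q : ℝ) (N : ℕ) : PowerSeries ℝ :=
  ∑ j ∈ Finset.range N, C (bCoeff x q j) * X ^ (j + 1)

theorem constantCoeff_deltaSeries (x q : ℝ) (N : ℕ) : constantCoeff (deltaSeries x q N) = 0 := by
  simp [deltaSeries]

/-- Up to the order `t^N` the truncated formal solution satisfies the equation for `δ`. -/
theorem coeff_formalRemainder_deltaSeries (x : ℝ) {q : ℝ} (hq : 0 < q) {k N : ℕ} (hk : k < N) :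
    coeff (k + 1) (formalRemainder x N (deltaSeries x q N)) = -((1 + q) / q) * bCoeff x q k := by
  rw [coeff_formalRemainder_congr x hk.le (constantCoeff_deltaSeries x q N)
    (constantCoeff_deltaSeries x q k), bCoeff_eq x q k, ← deltaSeries]
  · have : 1 + q ≠ 0 := by positivity
    field_simp
  · have hs : Finset.range k ⊆ Finset.range N := Finset.range_subset_range.2 hk.le
    rw [deltaSeries, deltaSeries, ← Finset.sum_sdiff hs, add_sub_cancel_right]
    refine Finset.dvd_sum fun j hj => Dvd.dvd.mul_left (pow_dvd_pow X ?_) _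
    simp only [Finset.mem_sdiff, Finset.mem_range] at hj
    omega

theorem constantCoeff_formalRemainder (x : ℝ) (K : ℕ) {d : PowerSeries ℝ}
    (hd : constantCoeff d = 0) : constantCoeff (formalRemainder x K d) = 0 := by
  simp only [formalRemainder, map_add, map_sum, map_mul, map_pow, hd, constantCoeff_X]
  rw [Finset.sum_eq_zero, Finset.sum_eq_zero, add_zero]
  · intro i _
    simp
  · intro j hj
    rw [zero_pow (by have := (Finset.mem_Icc.1 hj).1; omega), mul_zero]

end Formal

/-! ### Binet's function and its asymptotic series -/

section Binet

open Complex

theorem add_ofReal_mem_slitPlane {z : ℂ} (hz : 0 ≤ z.re) (hz0 : z ≠ 0) {t : ℝ} (ht : 0 ≤ t) :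
    z + t ∈ slitPlane := by
  rw [mem_slitPlane_iff]
  by_cases h : z.im = 0
  · left
    have : z.re ≠ 0 := fun h0 => hz0 (Complex.ext h0 h)
    have : 0 < z.re := lt_of_le_of_ne hz this.symm
    simp
    linarith
  · right
    simpa using h

theorem norm_add_ofReal_sq {z : ℂ} (hz : 0 ≤ z.re) {t : ℝ} (ht : 0 ≤ t) :
    ‖z‖ ^ 2 + t ^ 2 ≤ ‖z + t‖ ^ 2 := by
  rw [← normSq_eq_norm_sq, ← normSq_eq_norm_sq, normSq_apply, normSq_apply]
  simp
  nlinarith [mul_nonneg hz ht]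

theorem norm_le_norm_add_ofReal {z : ℂ} (hz : 0 ≤ z.re) {t : ℝ} (ht : 0 ≤ t) :
    ‖z‖ ≤ ‖z + t‖ := by
  have := norm_add_ofReal_sq hz ht
  nlinarith [norm_nonneg z, norm_nonneg (z + t), sq_nonneg t]

/-- The integral `∫₀¹ B_n(t) (z+t)^(-n) dt` with the Bernoulli polynomial `B_n`. Integration by parts
relates two consecutive ones. -/
noncomputable def bernoulliIntegral (n : ℕ) (z : ℂ) : ℂ :=
  ∫ t in (0 : ℝ)..1, (bernoulliFun n t : ℂ) * ((z + t)⁻¹) ^ n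

/-- The quantity `(z + 1/2) log ((z+1)/z) - 1`, the difference of two consecutive values of Binet's
function. The logarithms are kept apart: both are principal values on the slit plane. -/
noncomputable def binetTerm (z : ℂ) : ℂ := (z + 1 / 2) * (log (z + 1) - log z) - 1

/-- Binet's function, the difference between `log Γ(1+z)` and `(z + 1/2) log z - z + log(2π)/2`, as
a series that converges on the closed right half-plane without `0`. -/
noncomputable def binetJ (z : ℂ) : ℂ := ∑' k : ℕ, binetTerm (z + k)

theorem continuousOn_inv_add {z : ℂ} (hz : 0 ≤ z.re) (hz0 : z ≠ 0) :
    ContinuousOn (fun t : ℝ => (z + t)⁻¹) (Set.uIcc 0 1) := by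
  refine ContinuousOn.inv₀ (by fun_prop) fun t ht => ?_
  rw [Set.uIcc_of_le zero_le_one] at ht
  exact slitPlane_ne_zero (add_ofReal_mem_slitPlane hz hz0 ht.1)

theorem continuous_ofReal_bernoulliFun (n : ℕ) :
    Continuous (fun t : ℝ => (bernoulliFun n t : ℂ)) :=
  continuous_ofReal.comp (continuous_bernoulliFun n)

theorem binetTerm_eq {z : ℂ} (hz : 0 ≤ z.re) (hz0 : z ≠ 0) :
    binetTerm z = -bernoulliIntegral 1 z := by
  have hslit : ∀ t ∈ Set.uIcc (0 : ℝ) 1, z + t ∈ slitPlane := fun t ht => by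
    rw [Set.uIcc_of_le zero_le_one] at ht
    exact add_ofReal_mem_slitPlane hz hz0 ht.1
  have hd : ∀ t ∈ Set.uIcc (0 : ℝ) 1, HasDerivAt (fun t : ℝ => (z + 1 / 2) * log (z + t) - t)
      (-((bernoulliFun 1 t : ℂ) * ((z + t)⁻¹) ^ 1)) t := by
    intro t ht
    have h1 : HasDerivAt (fun t : ℝ => z + (t : ℂ)) 1 t := by
      simpa using (hasDerivAt_id t).ofReal_comp.const_add z
    have h2 := ((h1.clog_real (hslit t ht)).const_mul (z + 1 / 2)).sub
      (hasDerivAt_id t).ofReal_comp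
    convert! h2 using 1
    have := slitPlane_ne_zero (hslit t ht)
    rw [bernoulliFun_one]
    push_cast
    field_simp
    ring
  have := intervalIntegral.integral_eq_sub_of_hasDerivAt hd (ContinuousOn.intervalIntegrable
    (((continuous_ofReal_bernoulliFun 1).continuousOn.mul
      ((continuousOn_inv_add hz hz0).pow 1)).neg))
  rw [intervalIntegral.integral_neg] at this
  rw [bernoulliIntegral, this, binetTerm]
  push_cast
  ring_nf

theorem bernoulliIntegral_succ {z : ℂ} (hz : 0 ≤ z.re) (hz0 : z ≠ 0) {n : ℕ} (hn : 1 ≤ n) :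
    (n + 1) * bernoulliIntegral n z =
      ((bernoulli (n + 1) : ℚ) : ℂ) * (((z + 1)⁻¹) ^ n - (z⁻¹) ^ n) +
        n * bernoulliIntegral (n + 1) z := by
  have hu : ∀ t ∈ Set.uIcc (0 : ℝ) 1, HasDerivAt (fun t : ℝ => (bernoulliFun (n + 1) t : ℂ))
      ((n + 1) * (bernoulliFun n t : ℂ)) t := by
    intro t _
    have := (hasDerivAt_bernoulliFun (n + 1) t).ofReal_comp
    simpa using this
  have hv : ∀ t ∈ Set.uIcc (0 : ℝ) 1, HasDerivAt (fun t : ℝ => ((z + t)⁻¹) ^ n)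
      (-(n * ((z + t)⁻¹) ^ (n + 1))) t := by
    intro t ht
    rw [Set.uIcc_of_le zero_le_one] at ht
    have hne := slitPlane_ne_zero (add_ofReal_mem_slitPlane hz hz0 ht.1)
    have h1 : HasDerivAt (fun t : ℝ => z + (t : ℂ)) 1 t := by
      simpa using (hasDerivAt_id t).ofReal_comp.const_add z
    have h2 := (h1.fun_inv hne).fun_pow n
    convert! h2 using 1
    obtain ⟨m, rfl⟩ := Nat.exists_eq_add_of_le' hn
    simp only [Nat.add_sub_cancel, div_eq_mul_inv, ← inv_pow]
    ring
  have hcB := fun m => (continuous_ofReal_bernoulliFun m).continuousOn (s := Set.uIcc 0 1)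
  have hci := continuousOn_inv_add hz hz0
  have h := intervalIntegral.integral_deriv_mul_eq_sub hu hv
    (ContinuousOn.intervalIntegrable (continuousOn_const.mul (hcB n)))
    (ContinuousOn.intervalIntegrable ((continuousOn_const.mul (hci.pow (n + 1))).neg))
  have h3 : ∀ t : ℝ, (n + 1) * (bernoulliFun n t : ℂ) * ((z + t)⁻¹) ^ n +
      (bernoulliFun (n + 1) t : ℂ) * -(n * ((z + t)⁻¹) ^ (n + 1)) =
      (n + 1) * ((bernoulliFun n t : ℂ) * ((z + t)⁻¹) ^ n) -
        n * ((bernoulliFun (n + 1) t : ℂ) * ((z + t)⁻¹) ^ (n + 1)) := fun t => by ring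
  simp only [h3] at h
  have hint : ∀ (c : ℂ) (m : ℕ), IntervalIntegrable
      (fun t : ℝ => c * ((bernoulliFun m t : ℂ) * ((z + t)⁻¹) ^ (m - 1 + 1))) volume 0 1 :=
    fun c m => ContinuousOn.intervalIntegrable
      (continuousOn_const.mul ((hcB m).mul (hci.pow (m - 1 + 1))))
  have hint1 := hint (n + 1) n
  have hint2 := hint n (n + 1)
  rw [Nat.sub_add_cancel hn] at hint1
  rw [Nat.add_sub_cancel] at hint2
  rw [intervalIntegral.integral_sub hint1 hint2,
    intervalIntegral.integral_const_mul, intervalIntegral.integral_const_mul,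
    bernoulliFun_endpoints_eq_of_ne_one (by omega), bernoulliFun_eval_zero] at h
  simp only [bernoulliIntegral]
  push_cast at h
  linear_combination h

theorem norm_bernoulliIntegral_le (n : ℕ) : ∃ C : ℝ, 0 ≤ C ∧ ∀ z : ℂ, 0 ≤ z.re → z ≠ 0 →
    ‖bernoulliIntegral n z‖ ≤ C / ‖z‖ ^ n := by
  obtain ⟨C, hC⟩ := isCompact_Icc.exists_bound_of_continuousOn (s := Set.Icc (0 : ℝ) 1)
    (continuous_bernoulliFun n).continuousOn
  refine ⟨C, (norm_nonneg _).trans (hC 0 (by simp)), fun z hz hz0 => ?_⟩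
  have hb : ∀ t ∈ Set.uIoc (0 : ℝ) 1, ‖(bernoulliFun n t : ℂ) * ((z + t)⁻¹) ^ n‖ ≤
      C / ‖z‖ ^ n := by
    intro t ht
    rw [Set.uIoc_of_le zero_le_one] at ht
    have hpos : 0 < ‖z‖ := norm_pos_iff.2 hz0
    have h1 := norm_le_norm_add_ofReal hz ht.1.le
    rw [norm_mul, norm_pow, norm_inv, inv_pow, norm_real, div_eq_mul_inv]
    have h2 := hC t ⟨ht.1.le, ht.2⟩
    gcongr
    exact (norm_nonneg _).trans h2
  have h := intervalIntegral.norm_integral_le_of_norm_le_const hb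
  rwa [sub_zero, abs_one, mul_one] at h

/-- The coefficient `B_{j+2} / ((j+1)(j+2))` of `z^{-(j+1)}` in the Stirling series. -/
noncomputable def stirlingBeta (j : ℕ) : ℝ :=
  ((bernoulli (j + 2) : ℚ) : ℝ) / (((j : ℝ) + 1) * ((j : ℝ) + 2))

theorem binetTerm_expansion {z : ℂ} (hz : 0 ≤ z.re) (hz0 : z ≠ 0) (M : ℕ) :
    binetTerm z = ∑ j ∈ Finset.range M, (stirlingBeta j : ℂ) *
      ((z⁻¹) ^ (j + 1) - ((z + 1)⁻¹) ^ (j + 1)) - bernoulliIntegral (M + 1) z / (M + 1) := by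
  induction M with
  | zero => simp [binetTerm_eq hz hz0]
  | succ M ih =>
    rw [ih, Finset.sum_range_succ]
    have h := bernoulliIntegral_succ hz hz0 (n := M + 1) (by omega)
    have h1 : (M : ℂ) + 1 ≠ 0 := by exact_mod_cast Nat.succ_ne_zero M
    have h2 : (M : ℂ) + 1 + 1 ≠ 0 := by exact_mod_cast Nat.succ_ne_zero (M + 1)
    have h3 : (M : ℂ) + 2 ≠ 0 := by exact_mod_cast Nat.succ_ne_zero (M + 1)
    simp only [stirlingBeta]
    push_cast at h ⊢
    have h4 : bernoulliIntegral (M + 1) z =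
      (((bernoulli (M + 1 + 1) : ℚ) : ℂ) * (((z + 1)⁻¹) ^ (M + 1) - (z⁻¹) ^ (M + 1)) +
        (M + 1) * bernoulliIntegral (M + 1 + 1) z) / (M + 1 + 1) := by
      rw [eq_div_iff h2, ← h]; ring
    rw [h4]
    field_simp
    ring

theorem add_nat_ne_zero {z : ℂ} (hz : 0 ≤ z.re) (hz0 : z ≠ 0) (k : ℕ) : z + k ≠ 0 := by
  have := slitPlane_ne_zero (add_ofReal_mem_slitPlane hz hz0 (t := k) (Nat.cast_nonneg k))
  simpa using this

theorem re_add_nat_nonneg {z : ℂ} (hz : 0 ≤ z.re) (k : ℕ) : 0 ≤ (z + k).re := by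
  simp; positivity

theorem norm_binetTerm_le : ∃ C : ℝ, 0 ≤ C ∧ ∀ z : ℂ, 0 ≤ z.re → z ≠ 0 →
    ‖binetTerm z‖ ≤ C / ‖z‖ ^ 2 := by
  obtain ⟨C, hC0, hC⟩ := norm_bernoulliIntegral_le 2
  refine ⟨|stirlingBeta 0| + C, by positivity, fun z hz hz0 => ?_⟩
  have h := binetTerm_expansion hz hz0 1
  have hpos : 0 < ‖z‖ := norm_pos_iff.2 hz0
  have hz1 : z + 1 ≠ 0 := by simpa using add_nat_ne_zero hz hz0 1
  have h1 : ‖z‖ ≤ ‖z + 1‖ := by simpa using norm_le_norm_add_ofReal hz zero_le_one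
  have h2 : z⁻¹ - (z + 1)⁻¹ = (z * (z + 1))⁻¹ := by field_simp; ring
  rw [h, Finset.sum_range_one, zero_add, pow_one, pow_one, h2, add_div]
  refine (norm_sub_le _ _).trans (add_le_add ?_ ?_)
  · rw [norm_mul, norm_inv, norm_mul, norm_real, Real.norm_eq_abs, sq, div_eq_mul_inv]
    gcongr
  · rw [norm_div]
    refine (div_le_self (norm_nonneg _) ?_).trans (hC z hz hz0)
    norm_num

theorem summable_inv_nat_succ_sq (C : ℝ) : Summable (fun k : ℕ => C / ((k : ℝ) + 1) ^ 2) := by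
  have := (summable_nat_add_iff 1).2 (Real.summable_one_div_nat_pow.2 one_lt_two)
  simpa [div_eq_mul_inv] using this.mul_left C

theorem norm_binetTerm_succ_le : ∃ C : ℝ, 0 ≤ C ∧ ∀ z : ℂ, 0 ≤ z.re → ∀ k : ℕ,
    ‖binetTerm (z + 1 + k)‖ ≤ C / ((k : ℝ) + 1) ^ 2 := by
  obtain ⟨C, hC0, hC⟩ := norm_binetTerm_le
  refine ⟨C, hC0, fun z hz k => ?_⟩
  have hre : (k : ℝ) + 1 ≤ (z + 1 + k).re := by simp; linarith
  have hk : (0 : ℝ) < k + 1 := by positivity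
  have hne : z + 1 + k ≠ 0 := fun h => by rw [h] at hre; simp at hre; linarith
  refine (hC _ (by linarith) hne).trans ?_
  gcongr
  exact hre.trans (re_le_norm _)

theorem summable_binetTerm {z : ℂ} (hz : 0 ≤ z.re) : Summable (fun k : ℕ => binetTerm (z + k)) := by
  obtain ⟨C, hC0, hC⟩ := norm_binetTerm_succ_le
  refine (summable_nat_add_iff 1).1 (Summable.of_norm_bounded (summable_inv_nat_succ_sq C)
    fun k => ?_)
  convert! hC z hz k using 3
  push_cast; ring

theorem binetJ_eq_add {z : ℂ} (hz : 0 ≤ z.re) :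
    binetJ z = binetTerm z + ∑' k : ℕ, binetTerm (z + 1 + k) := by
  rw [binetJ, (summable_binetTerm hz).tsum_eq_zero_add]
  simp only [Nat.cast_zero, add_zero, Nat.cast_add, Nat.cast_one]
  congr 2
  ext k
  ring_nf

theorem continuousOn_binetTerm : ContinuousOn binetTerm {z : ℂ | 0 ≤ z.re ∧ z ≠ 0} := by
  unfold binetTerm
  refine (ContinuousOn.mul (by fun_prop) (ContinuousOn.sub ?_ ?_)).sub continuousOn_const
  · refine ContinuousOn.clog (by fun_prop) fun z hz => ?_
    simpa using add_ofReal_mem_slitPlane hz.1 hz.2 zero_le_one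
  · refine ContinuousOn.clog (by fun_prop) fun z hz => ?_
    simpa using add_ofReal_mem_slitPlane hz.1 hz.2 le_rfl

theorem continuousOn_tsum_binetTerm_succ :
    ContinuousOn (fun z : ℂ => ∑' k : ℕ, binetTerm (z + 1 + k)) {z : ℂ | 0 ≤ z.re} := by
  obtain ⟨C, hC0, hC⟩ := norm_binetTerm_succ_le
  refine continuousOn_tsum (fun k => ?_) (summable_inv_nat_succ_sq C) fun k z hz => hC z hz k
  refine continuousOn_binetTerm.comp (by fun_prop) fun z hz => ?_
  have hz' : 0 ≤ z.re := hz
  have h1 : 0 < (z + 1 + k).re := by simp; positivity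
  exact ⟨h1.le, fun h => by rw [h] at h1; simp at h1⟩

theorem continuousOn_binetJ : ContinuousOn binetJ {z : ℂ | 0 ≤ z.re ∧ z ≠ 0} :=
  (continuousOn_binetTerm.add (continuousOn_tsum_binetTerm_succ.mono fun _ h => h.1)).congr
    fun _ h => binetJ_eq_add h.1

/-- Stirling's series for Binet's function, with a (lossy) bound for the remainder. -/
theorem binetJ_expansion (N : ℕ) : ∃ C : ℝ, ∀ z : ℂ, 0 ≤ z.re → 1 ≤ ‖z‖ →
    ‖binetJ z - ∑ j ∈ Finset.range (N + 1), (stirlingBeta j : ℂ) * (z⁻¹) ^ (j + 1)‖ ≤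
      C * ‖z⁻¹‖ ^ N := by
  obtain ⟨C, hC0, hC⟩ := norm_bernoulliIntegral_le (N + 2)
  have hsum : Summable (fun k : ℕ => C / (1 + (k : ℝ) ^ 2)) := by
    refine (summable_nat_add_iff 1).1 (Summable.of_nonneg_of_le (fun k => by positivity)
      (fun k => ?_) (summable_inv_nat_succ_sq C))
    gcongr
    push_cast
    linarith
  refine ⟨∑' k : ℕ, C / (1 + (k : ℝ) ^ 2), fun z hz hz1 => ?_⟩
  have hz0 : z ≠ 0 := norm_pos_iff.1 (by linarith)
  have hzpos : 0 < ‖z‖ := by linarith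
  set g : ℂ → ℂ := fun w => ∑ j ∈ Finset.range (N + 1), (stirlingBeta j : ℂ) * (w⁻¹) ^ (j + 1)
    with hg
  set ρ : ℕ → ℂ := fun k => bernoulliIntegral (N + 2) (z + k) / (N + 2) with hρ
  -- Up to the remainder `ρ`, the terms of Binet's series telescope.
  have hterm : ∀ k : ℕ, binetTerm (z + k) = (g (z + k) - g (z + (k + 1 : ℕ))) - ρ k := by
    intro k
    rw [binetTerm_expansion (re_add_nat_nonneg hz k) (add_nat_ne_zero hz hz0 k) (N + 1)]
    have e1 : z + ((k + 1 : ℕ) : ℂ) = z + k + 1 := by push_cast; ring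
    have e2 : ((N + 1 : ℕ) : ℂ) + 1 = N + 2 := by push_cast; ring
    simp only [hg, hρ, mul_sub, Finset.sum_sub_distrib]
    rw [e1, e2]
  have hρb : ∀ k : ℕ, ‖ρ k‖ ≤ (C / (1 + (k : ℝ) ^ 2)) * ‖z⁻¹‖ ^ N := by
    intro k
    have h1 := hC (z + k) (re_add_nat_nonneg hz k) (add_nat_ne_zero hz hz0 k)
    have h2 : ‖z‖ ^ 2 + (k : ℝ) ^ 2 ≤ ‖z + k‖ ^ 2 := by
      simpa using norm_add_ofReal_sq hz (t := k) (Nat.cast_nonneg k)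
    have h3 : ‖z‖ ≤ ‖z + k‖ := by
      simpa using norm_le_norm_add_ofReal hz (t := k) (Nat.cast_nonneg k)
    have h4 : ‖ρ k‖ ≤ ‖bernoulliIntegral (N + 2) (z + k)‖ := by
      rw [hρ]
      simp only [norm_div]
      refine div_le_self (norm_nonneg _) ?_
      have : ((N : ℂ) + 2) = ((N + 2 : ℕ) : ℂ) := by push_cast; ring
      rw [this, Complex.norm_natCast]
      push_cast
      have : (0 : ℝ) ≤ N := Nat.cast_nonneg N
      linarith
    refine (h4.trans h1).trans ?_
    rw [norm_inv, inv_pow, div_mul_eq_mul_div, ← div_eq_mul_inv, div_div]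
    have h5 : (1 + (k : ℝ) ^ 2) ≤ ‖z + k‖ ^ 2 := by nlinarith
    have h6 : ‖z‖ ^ N ≤ ‖z + k‖ ^ N := by gcongr
    have h7 : ‖z‖ ^ N * (1 + (k : ℝ) ^ 2) ≤ ‖z + k‖ ^ (N + 2) := by
      rw [pow_add]
      exact mul_le_mul h6 h5 (by positivity) (by positivity)
    gcongr
  have hρs : Summable ρ := Summable.of_norm_bounded (hsum.mul_right _) hρb
  have hinv : Tendsto (fun n : ℕ => (z + (n : ℂ))⁻¹) atTop (𝓝 0) := by
    rw [tendsto_zero_iff_norm_tendsto_zero]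
    refine squeeze_zero' (Eventually.of_forall fun _ => norm_nonneg _)
      (eventually_gt_atTop 0 |>.mono fun n hn => ?_) (tendsto_inv_atTop_nhds_zero_nat (𝕜 := ℝ))
    rw [norm_inv]
    have hn' : (0 : ℝ) < n := by exact_mod_cast hn
    refine inv_anti₀ hn' ?_
    have : (n : ℝ) ≤ (z + n).re := by simp [hz]
    exact this.trans (re_le_norm _)
  have hglim : Tendsto (fun n : ℕ => g (z + n)) atTop (𝓝 0) := by
    have : Tendsto (fun n : ℕ => g (z + n)) atTop
        (𝓝 (∑ j ∈ Finset.range (N + 1), (stirlingBeta j : ℂ) * (0 : ℂ) ^ (j + 1))) :=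
      tendsto_finsetSum _ fun j _ => (hinv.pow (j + 1)).const_mul _
    simpa using this
  have hlim1 := (summable_binetTerm hz).hasSum.tendsto_sum_nat
  have hlim2 : Tendsto (fun n : ℕ => ∑ k ∈ Finset.range n, binetTerm (z + k)) atTop
      (𝓝 (g z - 0 - ∑' k, ρ k)) := by
    have h1 : ∀ n : ℕ, ∑ k ∈ Finset.range n, binetTerm (z + k) =
        g z - g (z + n) - ∑ k ∈ Finset.range n, ρ k := by
      intro n
      simp only [hterm, Finset.sum_sub_distrib]
      have := Finset.sum_range_sub' (fun k : ℕ => g (z + k)) n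
      simp only [Finset.sum_sub_distrib, Nat.cast_zero, add_zero] at this
      rw [this]
    simp only [h1]
    exact (tendsto_const_nhds.sub hglim).sub hρs.hasSum.tendsto_sum_nat
  have heq := tendsto_nhds_unique hlim1 hlim2
  have : binetJ z - g z = -∑' k, ρ k := by
    rw [binetJ, heq]; ring
  rw [this, norm_neg]
  calc ‖∑' k, ρ k‖ ≤ ∑' k : ℕ, (C / (1 + (k : ℝ) ^ 2)) * ‖z⁻¹‖ ^ N :=
        tsum_of_norm_bounded (hsum.mul_right _).hasSum hρb
    _ = _ := tsum_mul_right

end Binet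

/-! ### Binet's form of Stirling's formula and the argument of `Γ(1+iν)` -/

section GammaFormula

open Complex

/-- The partial sums of Binet's series, as a product over the factors in Gauss's formula for
`Γ(1+z)`. -/
theorem exp_sum_binetTerm_mul_prod {z : ℂ} (hz : 0 ≤ z.re) (hz0 : z ≠ 0) (n : ℕ) :
    exp (∑ k ∈ Finset.range n, binetTerm (z + k) + (z + 1 / 2) * log z - z) *
      ∏ j ∈ Finset.range n, (z + (j + 1 : ℕ)) =
      exp ((z + n + 1 / 2) * log (z + n) - n - z) := by
  induction n with
  | zero => simp
  | succ n ih =>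
    have e1 : z + ((n + 1 : ℕ) : ℂ) = z + n + 1 := by push_cast; ring
    have hne : z + n + 1 ≠ 0 := by
      rw [← e1]; exact add_nat_ne_zero hz hz0 (n + 1)
    have h2 : exp (∑ k ∈ Finset.range (n + 1), binetTerm (z + k) + (z + 1 / 2) * log z - z) =
        exp (∑ k ∈ Finset.range n, binetTerm (z + k) + (z + 1 / 2) * log z - z) *
          exp (binetTerm (z + n)) := by
      rw [← exp_add, Finset.sum_range_succ]; ring_nf
    rw [h2, Finset.prod_range_succ, mul_mul_mul_comm, ih, e1]
    have h3 : z + n + 1 = exp (log (z + n + 1)) := (exp_log hne).symm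
    conv_lhs => rw [h3]
    rw [← exp_add, ← exp_add, binetTerm]
    push_cast
    ring_nf

/-- Stirling's formula in Binet's form, on the closed right half-plane. -/
theorem Gamma_one_add_eq_exp_binetJ {z : ℂ} (hz : 0 ≤ z.re) (hz0 : z ≠ 0) :
    Gamma (1 + z) = (Real.sqrt (2 * Real.pi) : ℝ) *
      exp (binetJ z + (z + 1 / 2) * log z - z) := by
  have hlim1 : Tendsto (fun n : ℕ => z * GammaSeq z n) atTop (𝓝 (Gamma (1 + z))) := by
    rw [add_comm, Gamma_add_one z hz0]
    exact (GammaSeq_tendsto_Gamma z).const_mul z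
  have hE : Tendsto (fun n : ℕ =>
      exp (∑ k ∈ Finset.range n, binetTerm (z + k) + (z + 1 / 2) * log z - z)) atTop
      (𝓝 (exp (binetJ z + (z + 1 / 2) * log z - z))) :=
    (continuous_exp.tendsto _).comp
      (((summable_binetTerm hz).hasSum.tendsto_sum_nat.add_const _).sub_const _)
  have hlog : Tendsto (fun n : ℕ => (n : ℂ) * log (1 + z / n)) atTop (𝓝 z) := by
    refine tendsto_nat_mul_log_one_add_of_tendsto ?_
    refine tendsto_const_nhds.congr' ?_
    filter_upwards [eventually_gt_atTop 0] with n hn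
    have : (n : ℂ) ≠ 0 := by exact_mod_cast hn.ne'
    field_simp
  have hinv : Tendsto (fun n : ℕ => z / (n : ℂ)) atTop (𝓝 0) := by
    simpa [div_eq_mul_inv] using (tendsto_inv_atTop_nhds_zero_nat (𝕜 := ℂ)).const_mul z
  have hlog0 : Tendsto (fun n : ℕ => log (1 + z / n)) atTop (𝓝 0) := by
    have h1 : ContinuousAt (fun w : ℂ => log (1 + w)) 0 := by
      refine ContinuousAt.clog (by fun_prop) (by simp)
    have := h1.tendsto.comp hinv
    rw [add_zero, log_one] at this
    exact this
  -- The factor by which `z * GammaSeq z n` differs from the exponential of the partial sum; it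
  -- contains Stirling's formula for `n!`.
  have hfac : Tendsto (fun n : ℕ => (Stirling.stirlingSeq n : ℂ) * (Real.sqrt 2 : ℝ) *
      exp (z - ((n : ℂ) * log (1 + z / n) + (z + 1 / 2) * log (1 + z / n)))) atTop
      (𝓝 ((Real.sqrt Real.pi : ℝ) * (Real.sqrt 2 : ℝ) * exp (z - (z + (z + 1 / 2) * 0)))) := by
    refine Tendsto.mul (Tendsto.mul_const _ ?_) ?_
    · exact (continuous_ofReal.tendsto _).comp Stirling.tendsto_stirlingSeq_sqrt_pi
    · exact (continuous_exp.tendsto _).comp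
        (tendsto_const_nhds.sub (hlog.add (hlog0.const_mul _)))
  have hlim2 : Tendsto (fun n : ℕ => z * GammaSeq z n) atTop
      (𝓝 (exp (binetJ z + (z + 1 / 2) * log z - z) *
        ((Real.sqrt Real.pi : ℝ) * (Real.sqrt 2 : ℝ) * exp (z - (z + (z + 1 / 2) * 0))))) := by
    refine (hE.mul hfac).congr' ?_
    filter_upwards [eventually_gt_atTop 0] with n hn
    have hn0 : (n : ℂ) ≠ 0 := by exact_mod_cast hn.ne'
    have hnr : (0 : ℝ) < n := by exact_mod_cast hn
    have hprod : ∏ j ∈ Finset.range n, (z + (j + 1 : ℕ)) ≠ 0 :=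
      Finset.prod_ne_zero_iff.2 fun j _ => add_nat_ne_zero hz hz0 (j + 1)
    have hseq : z * GammaSeq z n = (n : ℂ) ^ z * (n.factorial : ℂ) /
        ∏ j ∈ Finset.range n, (z + (j + 1 : ℕ)) := by
      rw [GammaSeq, Finset.prod_range_succ']
      simp only [Nat.cast_zero, add_zero]
      field_simp
    have hst : (n.factorial : ℂ) = (Stirling.stirlingSeq n : ℂ) * (Real.sqrt 2 : ℝ) *
        exp ((n + 1 / 2) * Real.log n - n) := by
      have h1 : (n.factorial : ℝ) = Stirling.stirlingSeq n * Real.sqrt 2 *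
          Real.exp ((n + 1 / 2) * Real.log n - n) := by
        have h2 : Real.exp ((n + 1 / 2) * Real.log n - n) =
            Real.sqrt n * (n / Real.exp 1) ^ n := by
          rw [Real.sqrt_eq_rpow, Real.rpow_def_of_pos hnr, div_pow, ← Real.exp_nat_mul,
            ← Real.rpow_natCast, Real.rpow_def_of_pos hnr, ← Real.exp_sub, ← Real.exp_add]
          ring_nf
        rw [h2, Stirling.stirlingSeq, Real.sqrt_mul (by norm_num)]
        have h3 : Real.sqrt n ≠ 0 := (Real.sqrt_pos.2 hnr).ne'
        have h4 : Real.sqrt 2 ≠ 0 := by positivity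
        field_simp
      have := congrArg (fun r : ℝ => (r : ℂ)) h1
      push_cast at this
      simpa using this
    have hlogn : log (z + n) = Real.log n + log (1 + z / n) := by
      rw [← log_ofReal_mul hnr]
      · congr 1
        push_cast
        field_simp
        ring
      · intro h0
        have : z + n = n * (1 + z / n) := by field_simp; ring
        rw [h0, mul_zero] at this
        exact add_nat_ne_zero hz hz0 n this
    have hpow : (n : ℂ) ^ z = exp (Real.log n * z) := by
      rw [cpow_def_of_ne_zero hn0, ← ofReal_natCast, ofReal_log hnr.le]
    rw [hseq, hst, hpow, eq_div_iff hprod]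
    have key := exp_sum_binetTerm_mul_prod hz hz0 n
    calc _ = (exp (∑ k ∈ Finset.range n, binetTerm (z + k) + (z + 1 / 2) * log z - z) *
          ∏ j ∈ Finset.range n, (z + (j + 1 : ℕ))) * ((Stirling.stirlingSeq n : ℂ) *
          (Real.sqrt 2 : ℝ) *
          exp (z - ((n : ℂ) * log (1 + z / n) + (z + 1 / 2) * log (1 + z / n)))) := by ring
      _ = (Stirling.stirlingSeq n : ℂ) * (Real.sqrt 2 : ℝ) *
          (exp ((z + n + 1 / 2) * log (z + n) - n - z) *
          exp (z - ((n : ℂ) * log (1 + z / n) + (z + 1 / 2) * log (1 + z / n)))) := by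
        rw [key]; ring
      _ = (Stirling.stirlingSeq n : ℂ) * (Real.sqrt 2 : ℝ) *
          (exp (Real.log n * z) * exp ((n + 1 / 2) * Real.log n - n)) := by
        rw [← exp_add, ← exp_add, hlogn]
        ring_nf
      _ = _ := by ring
  rw [tendsto_nhds_unique hlim1 hlim2, Real.sqrt_mul (by norm_num)]
  push_cast
  simp
  ring

/-- The argument of `Γ(1+iν)`, `ν > 0`, as a continuous function tending to `0` for `ν → 0`. -/
noncomputable def gammaPhase (ν : ℝ) : ℝ :=
  ν * Real.log ν + Real.pi / 4 - ν + (binetJ (I * ν)).im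

theorem I_mul_mem {ν : ℝ} (hν : 0 < ν) : (I * (ν : ℂ)) ∈ {z : ℂ | 0 ≤ z.re ∧ z ≠ 0} := by
  refine ⟨by simp, mul_ne_zero I_ne_zero (by exact_mod_cast hν.ne')⟩

theorem log_I_mul {ν : ℝ} (hν : 0 < ν) : log (I * (ν : ℂ)) = Real.log ν + Real.pi / 2 * I := by
  rw [log_mul_ofReal ν hν I I_ne_zero, log_I]

theorem Gamma_eq_norm_mul_exp_gammaPhase {ν : ℝ} (hν : 0 < ν) :
    ∃ r : ℝ, 0 < r ∧ Gamma (1 + I * ν) = r * exp (I * gammaPhase ν) := by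
  set E : ℂ := binetJ (I * ν) + (I * ν + 1 / 2) * log (I * ν) - I * ν with hE
  refine ⟨Real.sqrt (2 * Real.pi) * Real.exp E.re, by positivity, ?_⟩
  rw [Gamma_one_add_eq_exp_binetJ (I_mul_mem hν).1 (I_mul_mem hν).2]
  have him : E.im = gammaPhase ν := by
    rw [hE, log_I_mul hν, gammaPhase]
    simp
    ring
  have : E = E.re + I * gammaPhase ν := by
    rw [← him, mul_comm]; exact (re_add_im E).symm
  rw [← hE]
  conv_lhs => rw [this]
  rw [exp_add, ← ofReal_exp]
  push_cast
  ring

theorem continuousOn_gammaPhase : ContinuousOn gammaPhase (Set.Ioi 0) := by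
  unfold gammaPhase
  refine ((((continuousOn_id.mul (Real.continuousOn_log.mono ?_)).add continuousOn_const).sub
    continuousOn_id).add ?_)
  · intro ν hν
    exact (ne_of_gt hν : ν ≠ 0)
  · refine continuous_im.comp_continuousOn (continuousOn_binetJ.comp (by fun_prop) ?_)
    intro ν hν
    exact I_mul_mem hν

theorem binetTerm_conj {z : ℂ} (hz : z ∈ slitPlane) (hz1 : z + 1 ∈ slitPlane) :
    binetTerm (starRingEnd ℂ z) = starRingEnd ℂ (binetTerm z) := by
  simp only [binetTerm, map_sub, map_mul, map_add, map_one, map_div₀, map_ofNat]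
  rw [← log_conj z (mem_slitPlane_iff_arg.1 hz).1, ← log_conj (z + 1) (mem_slitPlane_iff_arg.1 hz1).1]
  simp

/-- The first term of Binet's series compensates `ν log ν + π/4`;
the other terms are real at `ν = 0`. -/
theorem tendsto_gammaPhase_zero : Tendsto gammaPhase (𝓝[>] 0) (𝓝 0) := by
  set K : ℂ → ℂ := fun z => ∑' k : ℕ, binetTerm (z + 1 + k) with hK
  have hK0 : (K 0).im = 0 := by
    have h1 : starRingEnd ℂ (K 0) = K 0 := by
      rw [hK]
      simp only [conj_tsum]
      refine tsum_congr fun k => ?_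
      have hs : (0 + 1 + k : ℂ) ∈ slitPlane := by
        rw [mem_slitPlane_iff]; left; simp; positivity
      have hs1 : (0 + 1 + k + 1 : ℂ) ∈ slitPlane := by
        rw [mem_slitPlane_iff]; left; simp; positivity
      rw [← binetTerm_conj hs hs1]
      simp
    exact conj_eq_iff_im.1 h1
  have hKlim : Tendsto (fun ν : ℝ => (K (I * ν)).im) (𝓝[>] 0) (𝓝 0) := by
    have h1 : ContinuousWithinAt K {z : ℂ | 0 ≤ z.re} 0 :=
      continuousOn_tsum_binetTerm_succ 0 (by simp)
    have h2 : Tendsto (fun ν : ℝ => I * (ν : ℂ)) (𝓝[>] 0) (𝓝[{z : ℂ | 0 ≤ z.re}] 0) := by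
      refine tendsto_nhdsWithin_iff.2 ⟨?_, Eventually.of_forall fun ν => by simp⟩
      have : Continuous (fun ν : ℝ => I * (ν : ℂ)) := by fun_prop
      have h3 := (this.tendsto 0).mono_left (nhdsWithin_le_nhds (s := Set.Ioi 0))
      simpa using h3
    have h3 := (continuous_im.tendsto _).comp (h1.tendsto.comp h2)
    rw [hK0] at h3
    exact h3
  have hrep : ∀ ν : ℝ, 0 < ν → gammaPhase ν = (ν * (log (1 + I * ν)).re +
      (log (1 + I * ν)).im / 2 - ν) + (K (I * ν)).im := by
    intro ν hν
    rw [gammaPhase, binetJ_eq_add (I_mul_mem hν).1, binetTerm, log_I_mul hν, add_comm (I * (ν : ℂ)) 1]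
    simp [hK]
    ring_nf
  have hlog : Tendsto (fun ν : ℝ => ν * (log (1 + I * ν)).re + (log (1 + I * ν)).im / 2 - ν)
      (𝓝[>] 0) (𝓝 0) := by
    have h1 : ContinuousAt (fun ν : ℝ => log (1 + I * ν)) 0 :=
      ContinuousAt.clog (by fun_prop) (by simp)
    have h2 : ContinuousAt (fun ν : ℝ => ν * (log (1 + I * ν)).re +
        (log (1 + I * ν)).im / 2 - ν) 0 :=
      ((continuousAt_id.mul (continuous_re.continuousAt.comp h1)).add
        ((continuous_im.continuousAt.comp h1).div_const 2)).sub continuousAt_id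
    have := h2.tendsto
    simp only [ofReal_zero, mul_zero, add_zero, log_one, zero_re, zero_im, zero_div, sub_zero] at this
    exact this.mono_left nhdsWithin_le_nhds
  have := hlog.add hKlim
  rw [add_zero] at this
  refine this.congr' ?_
  filter_upwards [self_mem_nhdsWithin] with ν hν
  rw [hrep ν hν]

end GammaFormula

/-! ### The power series of the Bessel function and its modulus -/

section BesselSeries

/-- The coefficient of `w^k` in `∑ w^k / (k! (1+iν)_k)`. -/
noncomputable def sCoeff (ν : ℝ) (k : ℕ) : ℂ :=
  1 / ((k.factorial : ℂ) * (ascPochhammer ℂ k).eval (1 + Complex.I * ν))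

/-- The coefficient of `w^k` in `|∑ w^k / (k! (1+iν)_k)|²`. -/
noncomputable def pCoeff (ν : ℝ) (k : ℕ) : ℝ :=
  (k.centralBinom : ℝ) / ∏ j ∈ Finset.range k, (((j : ℝ) + 1) ^ 2 + ν ^ 2)

theorem norm_one_add_I_mul_add_nat (ν : ℝ) (k : ℕ) :
    (k : ℝ) + 1 ≤ ‖(1 + Complex.I * ν + k : ℂ)‖ := by
  have : (k : ℝ) + 1 = (1 + Complex.I * ν + k : ℂ).re := by simp; ring
  rw [this]
  exact Complex.re_le_norm _

theorem one_add_I_mul_add_nat_ne (ν : ℝ) (k : ℕ) : (1 + Complex.I * ν + k : ℂ) ≠ 0 := by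
  intro h
  have := norm_one_add_I_mul_add_nat ν k
  rw [h, norm_zero] at this
  have : (0 : ℝ) ≤ k := Nat.cast_nonneg k
  linarith

theorem factorial_le_norm_ascPochhammer (ν : ℝ) (k : ℕ) :
    (k.factorial : ℝ) ≤ ‖(ascPochhammer ℂ k).eval (1 + Complex.I * ν)‖ := by
  induction k with
  | zero => simp
  | succ k ih =>
    rw [ascPochhammer_succ_eval, norm_mul, Nat.factorial_succ, mul_comm (k + 1)]
    push_cast
    exact mul_le_mul ih (norm_one_add_I_mul_add_nat ν k) (by positivity) (norm_nonneg _)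

theorem ascPochhammer_eval_ne (ν : ℝ) (k : ℕ) :
    (ascPochhammer ℂ k).eval (1 + Complex.I * ν) ≠ 0 := by
  intro h
  have := factorial_le_norm_ascPochhammer ν k
  rw [h, norm_zero] at this
  have : (0 : ℝ) < k.factorial := by exact_mod_cast k.factorial_pos
  linarith

theorem sCoeff_zero (ν : ℝ) : sCoeff ν 0 = 1 := by simp [sCoeff]

theorem sCoeff_succ (ν : ℝ) (k : ℕ) :
    ((k : ℂ) + 1) * ((k : ℂ) + 1 + Complex.I * ν) * sCoeff ν (k + 1) = sCoeff ν k := by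
  have h1 := ascPochhammer_eval_ne ν k
  have h2 := one_add_I_mul_add_nat_ne ν k
  have h3 : (k.factorial : ℂ) ≠ 0 := by exact_mod_cast k.factorial_ne_zero
  have h4 : (k : ℂ) + 1 ≠ 0 := by exact_mod_cast k.succ_ne_zero
  rw [sCoeff, sCoeff, ascPochhammer_succ_eval, Nat.factorial_succ]
  push_cast
  field_simp
  ring

theorem sCoeff_neg (ν : ℝ) (k : ℕ) : sCoeff (-ν) k = starRingEnd ℂ (sCoeff ν k) := by
  induction k with
  | zero => simp [sCoeff]
  | succ k ih =>
    have h1 := sCoeff_succ ν k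
    have h2 := sCoeff_succ (-ν) k
    have h3 := congrArg (starRingEnd ℂ) h1
    rw [← ih, ← h2] at h3
    simp only [map_mul, map_add, map_natCast, map_one, Complex.conj_I, Complex.conj_ofReal] at h3
    have hne : ((k : ℂ) + 1) * ((k : ℂ) + 1 + Complex.I * ((-ν : ℝ) : ℂ)) ≠ 0 := by
      refine mul_ne_zero (by exact_mod_cast k.succ_ne_zero) ?_
      have := one_add_I_mul_add_nat_ne (-ν) k
      intro h; apply this; rw [← h]; ring
    apply mul_left_cancel₀ hne
    rw [← h3]
    push_cast
    ring

theorem norm_sCoeff_le (ν : ℝ) (k : ℕ) : ‖sCoeff ν k‖ ≤ 1 / (k.factorial : ℝ) ^ 2 := by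
  have h0 : (0 : ℝ) < k.factorial := by exact_mod_cast k.factorial_pos
  rw [sCoeff, norm_div, norm_one, norm_mul, Complex.norm_natCast, sq]
  have := factorial_le_norm_ascPochhammer ν k
  gcongr

theorem one_le_factorial_cast (k : ℕ) : (1 : ℝ) ≤ k.factorial := by
  exact_mod_cast k.factorial_pos

theorem norm_sCoeff_le' (ν : ℝ) (k : ℕ) : ‖sCoeff ν k‖ ≤ 1 / (k.factorial : ℝ) := by
  refine (norm_sCoeff_le ν k).trans ?_
  have h0 := one_le_factorial_cast k
  gcongr
  nlinarith

theorem norm_succ_mul_sCoeff_le (ν : ℝ) (k : ℕ) :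
    ‖((k : ℂ) + 1) * sCoeff ν (k + 1)‖ ≤ 1 / (k.factorial : ℝ) := by
  have h0 := one_le_factorial_cast k
  have hk : (0 : ℝ) < k + 1 := by positivity
  have h1 := norm_sCoeff_le ν (k + 1)
  have h2 : ‖((k : ℂ) + 1)‖ = k + 1 := by
    have := Complex.norm_natCast (k + 1)
    push_cast at this
    exact this
  rw [norm_mul, h2]
  refine (mul_le_mul_of_nonneg_left h1 hk.le).trans ?_
  rw [Nat.factorial_succ]
  push_cast
  rw [mul_one_div, div_le_div_iff₀ (by positivity) (by positivity)]
  have : (0 : ℝ) ≤ k := Nat.cast_nonneg k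
  have h3 : 0 < (k.factorial : ℝ) := by linarith
  nlinarith [mul_nonneg this h3.le, mul_pos hk h3, mul_nonneg (mul_pos hk h3).le (sub_nonneg.2 h0),
    mul_nonneg (mul_nonneg (mul_pos hk h3).le h3.le) this]

theorem summable_mul_pow {c : ℕ → ℂ} (hc : ∀ k, ‖c k‖ ≤ 1 / (k.factorial : ℝ)) (w : ℂ) :
    Summable (fun k => ‖c k * w ^ k‖) := by
  refine Summable.of_nonneg_of_le (fun _ => norm_nonneg _) (fun k => ?_)
    (Real.summable_pow_div_factorial ‖w‖)
  rw [norm_mul, norm_pow, div_eq_mul_one_div, mul_comm]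
  exact mul_le_mul_of_nonneg_left (hc k) (by positivity)

theorem continuous_tsum_mul_pow {α : Type*} [TopologicalSpace α] {c : ℕ → α → ℂ}
    (hcont : ∀ k, Continuous (c k)) (hc : ∀ k a, ‖c k a‖ ≤ 1 / (k.factorial : ℝ)) :
    Continuous (fun p : α × ℝ => ∑' k, c k p.1 * (p.2 : ℂ) ^ k) := by
  rw [continuous_iff_continuousAt]
  rintro ⟨a, w⟩
  have hopen : IsOpen {p : α × ℝ | |p.2| < |w| + 1} :=
    isOpen_lt (by fun_prop) continuous_const
  have hon : ContinuousOn (fun p : α × ℝ => ∑' k, c k p.1 * (p.2 : ℂ) ^ k)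
      {p : α × ℝ | |p.2| < |w| + 1} := by
    have hcon : ∀ k, Continuous (fun p : α × ℝ => c k p.1 * (p.2 : ℂ) ^ k) := fun k =>
      ((hcont k).comp continuous_fst).mul ((Complex.continuous_ofReal.comp continuous_snd).pow k)
    have hbd : ∀ k, ∀ p ∈ {p : α × ℝ | |p.2| < |w| + 1}, ‖c k p.1 * (p.2 : ℂ) ^ k‖ ≤
        (|w| + 1) ^ k / (k.factorial : ℝ) := by
      intro k p hp
      have hp' : |p.2| < |w| + 1 := hp
      have h1 : |p.2| ^ k ≤ (|w| + 1) ^ k := pow_le_pow_left₀ (abs_nonneg _) hp'.le k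
      rw [norm_mul, norm_pow, Complex.norm_real, Real.norm_eq_abs, div_eq_mul_one_div, mul_comm]
      exact mul_le_mul h1 (hc k p.1) (norm_nonneg _) (by positivity)
    exact continuousOn_tsum (fun k => (hcon k).continuousOn)
      (Real.summable_pow_div_factorial _) hbd
  exact hon.continuousAt (hopen.mem_nhds (by simp))

theorem hasDerivAt_tsum_mul_pow {c : ℕ → ℂ} (hc : ∀ k, ‖c k‖ ≤ 1 / (k.factorial : ℝ)) (w : ℂ) :
    HasDerivAt (fun w : ℂ => ∑' k, c k * w ^ k) (∑' k : ℕ, ((k : ℂ) + 1) * c (k + 1) * w ^ k) w := by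
  have hu : Summable (fun k : ℕ => (k : ℝ) * (‖w‖ + 1) ^ (k - 1) / (k.factorial : ℝ)) := by
    refine (summable_nat_add_iff 1).1 ?_
    refine (Real.summable_pow_div_factorial (‖w‖ + 1)).congr fun k => ?_
    rw [Nat.factorial_succ]
    push_cast
    have : (k : ℝ) + 1 ≠ 0 := by positivity
    field_simp
  have hw0 : w ∈ Metric.ball (0 : ℂ) (‖w‖ + 1) := by simp
  have h := hasDerivAt_tsum_of_isPreconnected (t := Metric.ball (0 : ℂ) (‖w‖ + 1))
    (g := fun k w => c k * w ^ k) (g' := fun k w => c k * ((k : ℂ) * w ^ (k - 1))) hu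
    Metric.isOpen_ball (convex_ball _ _).isPreconnected
    (fun k y _ => (hasDerivAt_pow k y).const_mul (c k))
    (fun k y hy => by
      have hy' : ‖y‖ < ‖w‖ + 1 := by simpa using hy
      rw [norm_mul, norm_mul, norm_pow, Complex.norm_natCast]
      rw [div_eq_mul_one_div, mul_comm]
      have h1 := hc k
      have : (k : ℝ) * ‖y‖ ^ (k - 1) ≤ k * (‖w‖ + 1) ^ (k - 1) := by gcongr
      exact mul_le_mul this h1 (norm_nonneg _) (by positivity))
    (y₀ := w) hw0 (summable_mul_pow hc w).of_norm hw0
  convert! h using 1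
  have hs : Summable (fun k : ℕ => c k * ((k : ℂ) * w ^ (k - 1))) := by
    refine Summable.of_norm_bounded hu fun k => ?_
    rw [norm_mul, norm_mul, norm_pow, Complex.norm_natCast, div_eq_mul_one_div, mul_comm]
    have h1 := hc k
    have : (k : ℝ) * ‖w‖ ^ (k - 1) ≤ k * (‖w‖ + 1) ^ (k - 1) := by gcongr; simp
    exact mul_le_mul this h1 (norm_nonneg _) (by positivity)
  rw [hs.tsum_eq_zero_add]
  simp only [Nat.cast_zero, zero_mul, mul_zero, zero_add, Nat.cast_add, Nat.cast_one,
    Nat.add_sub_cancel]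
  exact tsum_congr fun k => by ring

/-- The sum `∑ w^k / (k! (1+iν)_k)`, so that `I_{iν}(x) = (x/2)^{iν} / Γ(1+iν)` times its value at
`w = x²/4`. -/
noncomputable def besselS (ν w : ℝ) : ℂ := ∑' k, sCoeff ν k * (w : ℂ) ^ k

/-- The derivative of `besselS` with respect to `w`. -/
noncomputable def besselS' (ν w : ℝ) : ℂ := ∑' k : ℕ, ((k : ℂ) + 1) * sCoeff ν (k + 1) * (w : ℂ) ^ k

theorem hasDerivAt_besselS (ν w : ℝ) : HasDerivAt (besselS ν) (besselS' ν w) w :=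
  (hasDerivAt_tsum_mul_pow (norm_sCoeff_le' ν) (w : ℂ)).comp_ofReal

theorem continuous_sCoeff (k : ℕ) : Continuous (fun ν => sCoeff ν k) := by
  unfold sCoeff
  refine continuous_const.div (continuous_const.mul ?_) fun ν =>
    mul_ne_zero (by exact_mod_cast k.factorial_ne_zero) (ascPochhammer_eval_ne ν k)
  exact (ascPochhammer ℂ k).continuous.comp (by fun_prop)

theorem continuous_besselS : Continuous (fun p : ℝ × ℝ => besselS p.1 p.2) :=
  continuous_tsum_mul_pow continuous_sCoeff fun k ν => norm_sCoeff_le' ν k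

theorem continuous_besselS' : Continuous (fun p : ℝ × ℝ => besselS' p.1 p.2) :=
  continuous_tsum_mul_pow (c := fun k ν => ((k : ℂ) + 1) * sCoeff ν (k + 1))
    (fun k => continuous_const.mul (continuous_sCoeff (k + 1)))
    fun k ν => norm_succ_mul_sCoeff_le ν k

theorem besselS_zero (ν : ℝ) : besselS ν 0 = 1 := by
  rw [besselS, tsum_eq_single 0]
  · simp [sCoeff_zero]
  · intro k hk
    simp [hk]

theorem besselS_neg (ν w : ℝ) : besselS (-ν) w = starRingEnd ℂ (besselS ν w) := by
  simp only [besselS, Complex.conj_tsum, map_mul, map_pow, Complex.conj_ofReal, sCoeff_neg]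

theorem mul_besselS' (ν w : ℝ) : (w : ℂ) * besselS' ν w =
    ∑' k : ℕ, ((k : ℂ) * sCoeff ν k) * (w : ℂ) ^ k := by
  have hs : Summable (fun k : ℕ => ((k : ℂ) * sCoeff ν k) * (w : ℂ) ^ k) := by
    refine (summable_nat_add_iff 1).1 ?_
    refine ((summable_mul_pow (norm_succ_mul_sCoeff_le ν) (w : ℂ)).of_norm.mul_left
      (w : ℂ)).congr fun k => ?_
    push_cast
    ring
  rw [hs.tsum_eq_zero_add, besselS', ← tsum_mul_left]
  simp only [Nat.cast_zero, zero_mul, zero_add]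
  refine tsum_congr fun k => ?_
  push_cast
  ring

open PowerSeries in
/-- The formal counterparts of the Wronskian relation and of the differential equation of third
order for `|∑ w^k / (k! (1+iν)_k)|²`; with `D = w d/dw` and `μ = iν` both follow from
`D² S = w S - μ D S`. -/
theorem coeff_wronskian_and_modulus (ν : ℝ) (k : ℕ) :
    coeff k (mk (sCoeff (-ν)) * mk (fun j => (j : ℂ) * sCoeff ν j) -
        mk (sCoeff ν) * mk (fun j => (j : ℂ) * sCoeff (-ν) j)) =
      (if k = 0 then 0 else -(Complex.I * ν) *
        coeff k (mk (sCoeff (-ν)) * mk (sCoeff ν))) ∧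
    coeff k (mk (sCoeff (-ν)) * mk (sCoeff ν)) = (pCoeff ν k : ℂ) := by
  set μ : ℂ := Complex.I * ν with hμ
  set a : PowerSeries ℂ := mk (sCoeff ν) with ha
  set b : PowerSeries ℂ := mk (sCoeff (-ν)) with hb
  set D : Derivation ℂ (PowerSeries ℂ) (PowerSeries ℂ) := (X : PowerSeries ℂ) • d⁄dX ℂ with hD
  have hDc : ∀ (f : PowerSeries ℂ) (j : ℕ), coeff j (D f) = (j : ℂ) * coeff j f := by
    intro f j
    have : D f = X * d⁄dX ℂ f := by simp [hD]
    rw [this]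
    cases j with
    | zero => simp
    | succ j =>
      rw [coeff_succ_X_mul, coeff_derivative]
      push_cast; ring
  have hDa : mk (fun j => (j : ℂ) * sCoeff ν j) = D a := by
    ext j; rw [hDc, ha]; simp
  have hDb : mk (fun j => (j : ℂ) * sCoeff (-ν) j) = D b := by
    ext j; rw [hDc, hb]; simp
  have hode : ∀ (τ : ℝ), D (D (mk (sCoeff τ))) = X * mk (sCoeff τ) -
      C (Complex.I * τ) * D (mk (sCoeff τ)) := by
    intro τ
    ext j
    rw [map_sub, coeff_C_mul, hDc, hDc]
    cases j with
    | zero => simp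
    | succ j =>
      rw [coeff_succ_X_mul, coeff_mk, coeff_mk, ← sCoeff_succ τ j]
      push_cast; ring
  have ha2 : D (D a) = X * a - C μ * D a := hode ν
  have hb2 : D (D b) = X * b + C μ * D b := by
    have := hode (-ν)
    rw [← hb] at this
    rw [this, hμ]
    simp only [Complex.ofReal_neg, mul_neg, map_neg, neg_mul, sub_neg_eq_add]
  have hDX : D X = X := by simp [hD]
  have hDC : ∀ c : ℂ, D (C c) = 0 := by
    intro c; simp [hD]
  have leib : ∀ f g : PowerSeries ℂ, D (f * g) = f * D g + g * D f := fun f g => by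
    simp [Derivation.leibniz]
  have hQ : D (b * D a - a * D b) = -(C μ * D (b * a)) := by
    rw [map_sub, leib, leib, leib, ha2, hb2]; ring
  have hP : D (D (D (b * a))) = 2 * (X * (b * a)) + 4 * (X * D (b * a)) +
      C (μ ^ 2) * D (b * a) := by
    have h2 : D (D (b * a)) = 2 * (X * (b * a)) - C μ * (b * D a - a * D b) +
        2 * (D a * D b) := by
      rw [leib, map_add, leib, leib, ha2, hb2]; ring
    have h2D : D (2 : PowerSeries ℂ) = 0 := by
      have : (2 : PowerSeries ℂ) = C (2 : ℂ) := (map_ofNat C 2).symm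
      rw [this, hDC]
    rw [h2, map_add, map_sub, leib 2, leib 2, leib X, leib (C μ), leib (D a), hQ, hDX, hDC, h2D,
      leib b a, ha2, hb2, map_pow]
    ring
  have hcQ : ∀ j : ℕ, (j : ℂ) * coeff j (b * D a - a * D b) =
      (j : ℂ) * (-μ * coeff j (b * a)) := by
    intro j
    rw [← hDc, hQ, map_neg, coeff_C_mul, hDc]; ring
  have hrec : ∀ j : ℕ, ((j : ℂ) + 1) * (((j : ℂ) + 1) ^ 2 + (ν : ℂ) ^ 2) * coeff (j + 1) (b * a) =
      (4 * (j : ℂ) + 2) * coeff j (b * a) := by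
    intro j
    have h1 := congrArg (coeff (j + 1)) hP
    have e2 : (2 : PowerSeries ℂ) = C (2 : ℂ) := (map_ofNat C 2).symm
    have e4 : (4 : PowerSeries ℂ) = C (4 : ℂ) := (map_ofNat C 4).symm
    rw [map_add, map_add, e2, e4, coeff_C_mul, coeff_C_mul, coeff_C_mul, coeff_succ_X_mul,
      coeff_succ_X_mul, hDc, hDc, hDc, hDc] at h1
    have h3 : μ ^ 2 = -(ν : ℂ) ^ 2 := by rw [hμ, mul_pow, Complex.I_sq]; ring
    rw [h3] at h1
    push_cast at h1
    linear_combination h1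
  have hp : ∀ j : ℕ, coeff j (b * a) = (pCoeff ν j : ℂ) := by
    intro j
    induction j with
    | zero => simp [pCoeff, ha, hb, sCoeff_zero]
    | succ j ih =>
      have h1 := hrec j
      rw [ih] at h1
      have hr1 : (0 : ℝ) < (j : ℝ) + 1 := by positivity
      have hr2 : (0 : ℝ) < ((j : ℝ) + 1) ^ 2 + ν ^ 2 := by positivity
      have h2 : ((j : ℝ) + 1) * (((j : ℝ) + 1) ^ 2 + ν ^ 2) * pCoeff ν (j + 1) =
          (4 * (j : ℝ) + 2) * pCoeff ν j := by
        rw [pCoeff, pCoeff, Finset.prod_range_succ]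
        have hcb : ((j : ℝ) + 1) * ((j + 1).centralBinom : ℝ) =
            2 * (2 * (j : ℝ) + 1) * (j.centralBinom : ℝ) := by
          exact_mod_cast Nat.succ_mul_centralBinom_succ j
        have hr3 : (∏ i ∈ Finset.range j, (((i : ℝ) + 1) ^ 2 + ν ^ 2)) ≠ 0 :=
          Finset.prod_ne_zero_iff.2 fun i _ => by positivity
        field_simp
        linear_combination hcb
      have h3 : ((j : ℂ) + 1) * (((j : ℂ) + 1) ^ 2 + (ν : ℂ) ^ 2) ≠ 0 := by
        exact_mod_cast (mul_pos hr1 hr2).ne'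
      apply mul_left_cancel₀ h3
      rw [h1]
      exact_mod_cast h2.symm
  refine ⟨?_, hp k⟩
  rw [hDa, hDb]
  split_ifs with hk
  · subst hk
    have h0 : ∀ f, constantCoeff (D f) = 0 := fun f => by
      rw [← coeff_zero_eq_constantCoeff_apply, hDc]; simp
    simp [h0]
  · exact mul_left_cancel₀ (by exact_mod_cast hk) (hcQ k)

theorem norm_natCast_mul_sCoeff_summable (ν w : ℝ) :
    Summable (fun k : ℕ => ‖((k : ℂ) * sCoeff ν k) * (w : ℂ) ^ k‖) := by
  refine (summable_nat_add_iff 1).1 ?_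
  refine ((summable_mul_pow (norm_succ_mul_sCoeff_le ν) (w : ℂ)).mul_left |w|).congr fun k => ?_
  rw [← Real.norm_eq_abs, ← Complex.norm_real, ← norm_mul]
  congr 1
  push_cast
  ring

open PowerSeries in
theorem hasSum_coeff_mul_mul_pow {f g : ℕ → ℂ} {w : ℂ} (hf : Summable fun k => ‖f k * w ^ k‖)
    (hg : Summable fun k => ‖g k * w ^ k‖) :
    HasSum (fun k => coeff k (mk f * mk g) * w ^ k)
      ((∑' k, f k * w ^ k) * ∑' k, g k * w ^ k) := by
  have h1 := tsum_mul_tsum_eq_tsum_sum_antidiagonal_of_summable_norm hf hg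
  have h2 : ∀ k, coeff k (mk f * mk g) * w ^ k =
      ∑ p ∈ Finset.HasAntidiagonal.antidiagonal k, f p.1 * w ^ p.1 * (g p.2 * w ^ p.2) := by
    intro k
    rw [coeff_mul, Finset.sum_mul]
    refine Finset.sum_congr rfl fun p hp => ?_
    rw [← Finset.HasAntidiagonal.mem_antidiagonal.1 hp, pow_add, coeff_mk, coeff_mk]
    ring
  simp only [h2]
  rw [h1]
  exact (summable_norm_sum_mul_antidiagonal_of_summable_norm hf hg).of_norm.hasSum

/-- `|∑ w^k / (k! (1+iν)_k)|²`, as a series with positive terms that decrease in `ν`. -/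
theorem hasSum_pCoeff (ν w : ℝ) :
    HasSum (fun k => pCoeff ν k * w ^ k) (Complex.normSq (besselS ν w)) := by
  have h := hasSum_coeff_mul_mul_pow (summable_mul_pow (norm_sCoeff_le' (-ν)) (w : ℂ))
    (summable_mul_pow (norm_sCoeff_le' ν) (w : ℂ))
  have h1 : (∑' k, sCoeff (-ν) k * (w : ℂ) ^ k) * (∑' k, sCoeff ν k * (w : ℂ) ^ k) =
      (Complex.normSq (besselS ν w) : ℂ) := by
    have := besselS_neg ν w
    simp only [besselS] at this
    rw [this, mul_comm, Complex.mul_conj]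
    rfl
  rw [h1] at h
  simp only [(coeff_wronskian_and_modulus ν _).2] at h
  exact_mod_cast h

/-- The Wronskian relation between `I_{iν}` and its conjugate `I_{-iν}`. -/
theorem im_wronskian (ν w : ℝ) :
    w * (starRingEnd ℂ (besselS ν w) * besselS' ν w).im =
      -(ν * (Complex.normSq (besselS ν w) - 1)) / 2 := by
  have h1 := hasSum_coeff_mul_mul_pow (summable_mul_pow (norm_sCoeff_le' (-ν)) (w : ℂ))
    (norm_natCast_mul_sCoeff_summable ν w)
  have h2 := hasSum_coeff_mul_mul_pow (summable_mul_pow (norm_sCoeff_le' ν) (w : ℂ))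
    (norm_natCast_mul_sCoeff_summable (-ν) w)
  rw [← mul_besselS', ← besselS] at h1 h2
  have h3 := (Complex.hasSum_ofReal.2 (hasSum_pCoeff ν w))
  have h4 := ((hasSum_ite_eq 0 (1 : ℂ)).sub h3).mul_left (Complex.I * ν)
  have h5 := (h1.sub h2).unique (h4.congr_fun (fun k => ?_))
  · have h6 : starRingEnd ℂ (besselS' ν w) * (w : ℂ) = w * besselS' (-ν) w := by
      rw [mul_besselS', mul_comm, ← Complex.conj_ofReal w, ← map_mul, Complex.conj_ofReal,
        mul_besselS']
      simp only [Complex.conj_tsum, map_mul, map_pow, Complex.conj_ofReal, sCoeff_neg,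
        map_natCast]
    rw [← h6, besselS_neg] at h5
    have h7 := congrArg Complex.im h5
    simp at h7
    simp
    linarith
  · have := (coeff_wronskian_and_modulus ν k)
    rw [← sub_mul, ← map_sub, this.1, this.2]
    rcases eq_or_ne k 0 with rfl | hk
    · simp [pCoeff]
    · simp [hk, mul_assoc]

end BesselSeries

/-! ### The phase of `I_{iν}(x)` -/

section Phase

/-- `|∑ w^k / (k! (1+iν)_k)|²`. -/
noncomputable def besselP (ν w : ℝ) : ℝ := Complex.normSq (besselS ν w)

theorem pCoeff_nonneg (ν : ℝ) (k : ℕ) : 0 ≤ pCoeff ν k :=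
  div_nonneg (Nat.cast_nonneg _) (Finset.prod_nonneg fun _ _ => by positivity)

theorem pCoeff_anti {ν₁ ν₂ : ℝ} (h0 : 0 ≤ ν₁) (h : ν₁ ≤ ν₂) (k : ℕ) :
    pCoeff ν₂ k ≤ pCoeff ν₁ k := by
  rw [pCoeff, pCoeff]
  have hpos : 0 < ∏ j ∈ Finset.range k, (((j : ℝ) + 1) ^ 2 + ν₁ ^ 2) :=
    Finset.prod_pos fun _ _ => by positivity
  have hle : ∏ j ∈ Finset.range k, (((j : ℝ) + 1) ^ 2 + ν₁ ^ 2) ≤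
      ∏ j ∈ Finset.range k, (((j : ℝ) + 1) ^ 2 + ν₂ ^ 2) :=
    Finset.prod_le_prod (fun _ _ => by positivity) fun _ _ => by gcongr
  gcongr

theorem besselP_anti {ν₁ ν₂ : ℝ} (h0 : 0 ≤ ν₁) (h : ν₁ ≤ ν₂) {w : ℝ} (hw : 0 ≤ w) :
    besselP ν₂ w ≤ besselP ν₁ w :=
  hasSum_le (fun k => mul_le_mul_of_nonneg_right (pCoeff_anti h0 h k) (pow_nonneg hw k))
    (hasSum_pCoeff ν₂ w) (hasSum_pCoeff ν₁ w)

theorem one_add_le_besselP (ν : ℝ) {w : ℝ} (hw : 0 ≤ w) :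
    1 + 2 * w / (1 + ν ^ 2) ≤ besselP ν w := by
  have := sum_le_hasSum (Finset.range 2)
    (fun k _ => mul_nonneg (pCoeff_nonneg ν k) (pow_nonneg hw k)) (hasSum_pCoeff ν w)
  refine le_trans (le_of_eq ?_) this
  simp [Finset.sum_range_succ, pCoeff, Nat.centralBinom_eq_two_mul_choose]
  ring

theorem one_le_besselP (ν : ℝ) {w : ℝ} (hw : 0 ≤ w) : 1 ≤ besselP ν w := by
  have h := one_add_le_besselP ν hw
  have : 0 ≤ 2 * w / (1 + ν ^ 2) := by positivity
  linarith

theorem besselS_ne_zero (ν : ℝ) {w : ℝ} (hw : 0 ≤ w) : besselS ν w ≠ 0 := by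
  intro h
  have := one_le_besselP ν hw
  rw [besselP, h, map_zero] at this
  linarith

theorem one_le_norm_besselS (ν : ℝ) {w : ℝ} (hw : 0 ≤ w) : 1 ≤ ‖besselS ν w‖ := by
  have := one_le_besselP ν hw
  rw [besselP, Complex.normSq_eq_norm_sq] at this
  nlinarith [norm_nonneg (besselS ν w)]

/-- The logarithmic derivative of `besselS ν`, extended evenly to negative arguments, where
`besselS ν` may vanish. -/
noncomputable def besselLogDeriv (ν w : ℝ) : ℂ := besselS' ν |w| / besselS ν |w|

/-- The logarithm of `besselS ν` on `[0, ∞)` that vanishes at `0`. -/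
noncomputable def besselLog (ν w : ℝ) : ℂ := ∫ s in (0 : ℝ)..w, besselLogDeriv ν s

theorem continuous_besselLogDeriv : Continuous (fun p : ℝ × ℝ => besselLogDeriv p.1 p.2) := by
  have h : Continuous (fun p : ℝ × ℝ => ((p.1, |p.2|) : ℝ × ℝ)) := by fun_prop
  have h1 : Continuous (fun p : ℝ × ℝ => besselS' p.1 |p.2|) := continuous_besselS'.comp h
  have h2 : Continuous (fun p : ℝ × ℝ => besselS p.1 |p.2|) := continuous_besselS.comp h
  have h3 : ∀ p : ℝ × ℝ, besselS p.1 |p.2| ≠ 0 := fun p => besselS_ne_zero p.1 (abs_nonneg _)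
  unfold besselLogDeriv
  exact h1.div h2 h3

theorem hasDerivAt_besselLog (ν w : ℝ) : HasDerivAt (besselLog ν) (besselLogDeriv ν w) w := by
  have hsec : ∀ f : ℝ → ℝ → ℂ, Continuous (fun p : ℝ × ℝ => f p.1 p.2) → Continuous (f ν) :=
    fun f hf => hf.comp (Continuous.prodMk_right ν)
  have hc : Continuous (besselLogDeriv ν) := hsec _ continuous_besselLogDeriv
  exact intervalIntegral.integral_hasDerivAt_right (hc.intervalIntegrable _ _)
    (hc.stronglyMeasurableAtFilter _ _) hc.continuousAt

theorem continuous_besselLog (w : ℝ) : Continuous (fun ν => besselLog ν w) :=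
  intervalIntegral.continuous_parametric_intervalIntegral_of_continuous'
    continuous_besselLogDeriv 0 w

theorem besselS_eq_exp_besselLog (ν : ℝ) {w : ℝ} (hw : 0 ≤ w) :
    besselS ν w = Complex.exp (besselLog ν w) := by
  have hd : ∀ s, 0 ≤ s → HasDerivAt (fun s => besselS ν s * Complex.exp (-besselLog ν s)) 0 s := by
    intro s hs
    have := (hasDerivAt_besselS ν s).mul ((hasDerivAt_besselLog ν s).neg.cexp)
    convert! this using 1
    rw [besselLogDeriv, abs_of_nonneg hs]
    have := besselS_ne_zero ν hs
    simp only [Pi.neg_apply]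
    field_simp
    ring
  have h := constant_of_has_deriv_right_zero (a := 0) (b := w)
    (f := fun s => besselS ν s * Complex.exp (-besselLog ν s))
    (fun s hs => (hd s hs.1).continuousAt.continuousWithinAt)
    (fun s hs => (hd s hs.1).hasDerivWithinAt) w ⟨hw, le_rfl⟩
  have h0 : besselLog ν 0 = 0 := by simp [besselLog]
  simp only [besselS_zero, h0, neg_zero, Complex.exp_zero, mul_one] at h
  rw [Complex.exp_neg, mul_inv_eq_one₀ (Complex.exp_ne_zero _)] at h
  exact h

theorem hasDerivAt_im_besselLog (ν : ℝ) {w : ℝ} (hw : 0 < w) :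
    HasDerivAt (fun w => (besselLog ν w).im)
      (-(ν * (besselP ν w - 1)) / (2 * w * besselP ν w)) w := by
  have h1 : HasDerivAt (fun w => (besselLog ν w).im) (besselLogDeriv ν w).im w :=
    (Complex.imCLM.hasFDerivAt.comp_hasDerivAt w (hasDerivAt_besselLog ν w))
  convert! h1 using 1
  have h2 := im_wronskian ν w
  have hP : 0 < besselP ν w := lt_of_lt_of_le one_pos (one_le_besselP ν hw.le)
  have h3 : (besselLogDeriv ν w).im =
      (starRingEnd ℂ (besselS ν w) * besselS' ν w).im / besselP ν w := by
    rw [besselLogDeriv, abs_of_pos hw, div_eq_mul_inv, Complex.inv_def, besselP, mul_comm,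
      mul_right_comm, Complex.im_mul_ofReal, div_eq_mul_inv]
  rw [h3, div_eq_div_iff (by positivity) hP.ne']
  change _ = -(ν * (besselP ν w - 1)) / 2 at h2
  linear_combination (-2 * besselP ν w) * h2

theorem im_besselLog_zero {w : ℝ} (hw : 0 ≤ w) : (besselLog 0 w).im = 0 := by
  have h : ∀ w, 0 ≤ w → (besselLogDeriv 0 w).im = 0 := by
    intro w hw
    have hr : ∀ k, starRingEnd ℂ (sCoeff 0 k) = sCoeff 0 k := fun k => by
      rw [← sCoeff_neg, neg_zero]
    have h1 : starRingEnd ℂ (besselS 0 |w|) = besselS 0 |w| := by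
      rw [← besselS_neg, neg_zero]
    have h2 : starRingEnd ℂ (besselS' 0 |w|) = besselS' 0 |w| := by
      simp only [besselS', Complex.conj_tsum, map_mul, map_pow, Complex.conj_ofReal, hr,
        map_add, map_natCast, map_one]
    rw [← Complex.conj_eq_iff_im, besselLogDeriv, map_div₀, h1, h2]
  have hd : ∀ s, HasDerivAt (fun w => (besselLog 0 w).im) (besselLogDeriv 0 s).im s := fun s =>
    (Complex.imCLM.hasFDerivAt.comp_hasDerivAt s (hasDerivAt_besselLog 0 s))
  have := constant_of_has_deriv_right_zero (a := 0) (b := w)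
    (f := fun s => (besselLog 0 s).im)
    (fun s _ => (hd s).continuousAt.continuousWithinAt)
    (fun s hs => by have := (hd s).hasDerivWithinAt (s := Set.Ici s); rwa [h s hs.1] at this)
    w ⟨hw, le_rfl⟩
  rw [this]
  simp [besselLog]

theorem norm_succ_mul_sCoeff_le_div {ν : ℝ} (hν : 0 < ν) (k : ℕ) :
    ‖((k : ℂ) + 1) * sCoeff ν (k + 1)‖ ≤ 1 / (k.factorial : ℝ) / ν := by
  have h1 := sCoeff_succ ν k
  have h2 : ν ≤ ‖(k : ℂ) + 1 + Complex.I * ν‖ := by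
    have : ν = ((k : ℂ) + 1 + Complex.I * ν).im := by simp
    exact (le_of_eq this).trans (Complex.im_le_norm _)
  rw [le_div_iff₀ hν]
  calc _ ≤ ‖((k : ℂ) + 1) * sCoeff ν (k + 1)‖ * ‖(k : ℂ) + 1 + Complex.I * ν‖ := by gcongr
    _ = ‖sCoeff ν k‖ := by rw [← norm_mul, ← h1]; ring_nf
    _ ≤ _ := norm_sCoeff_le' ν k

theorem norm_besselLog_le {ν w : ℝ} (hν : 0 < ν) (hw : 0 ≤ w) :
    ‖besselLog ν w‖ ≤ (∑' k : ℕ, w ^ k / (k.factorial : ℝ)) * w / ν := by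
  have hb : ∀ s ∈ Set.uIoc 0 w, ‖besselLogDeriv ν s‖ ≤
      (∑' k : ℕ, w ^ k / (k.factorial : ℝ)) / ν := by
    intro s hs
    rw [Set.uIoc_of_le hw] at hs
    rw [besselLogDeriv, norm_div, abs_of_pos hs.1]
    refine (div_le_self (norm_nonneg _) (one_le_norm_besselS ν hs.1.le)).trans ?_
    rw [besselS', ← tsum_div_const]
    refine tsum_of_norm_bounded ((Real.summable_pow_div_factorial w).div_const ν).hasSum
      fun k => ?_
    rw [norm_mul, norm_pow, Complex.norm_real, Real.norm_eq_abs, abs_of_pos hs.1, mul_comm,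
      div_eq_mul_one_div (w ^ k), mul_div_assoc]
    exact mul_le_mul (pow_le_pow_left₀ hs.1.le hs.2 k) (norm_succ_mul_sCoeff_le_div hν k)
      (norm_nonneg _) (by positivity)
  have := intervalIntegral.norm_integral_le_of_norm_le_const hb
  rw [sub_zero, abs_of_nonneg hw] at this
  refine this.trans (le_of_eq ?_)
  ring

theorem tendsto_besselLog_atTop {w : ℝ} (hw : 0 ≤ w) :
    Tendsto (fun ν => besselLog ν w) atTop (𝓝 0) := by
  rw [tendsto_zero_iff_norm_tendsto_zero]
  refine squeeze_zero' (Eventually.of_forall fun _ => norm_nonneg _)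
    ((eventually_gt_atTop 0).mono fun ν hν => norm_besselLog_le hν hw) ?_
  exact tendsto_const_nhds.div_atTop tendsto_id

/-- The continuous argument of `I_{iν}(x)`, `ν > 0`, at `w = x²/4`. -/
noncomputable def besselPhase (ν w : ℝ) : ℝ :=
  ν / 2 * Real.log w - gammaPhase ν + (besselLog ν w).im

theorem hasDerivAt_besselPhase (ν : ℝ) {w : ℝ} (hw : 0 < w) :
    HasDerivAt (besselPhase ν) (ν / (2 * w * besselP ν w)) w := by
  have h := (((Real.hasDerivAt_log hw.ne').const_mul (ν / 2)).sub_const (gammaPhase ν)).add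
    (hasDerivAt_im_besselLog ν hw)
  convert! h using 1
  have hP : 0 < besselP ν w := lt_of_lt_of_le one_pos (one_le_besselP ν hw.le)
  field_simp
  ring

theorem continuousOn_besselPhase (w : ℝ) :
    ContinuousOn (fun ν => besselPhase ν w) (Set.Ioi 0) := by
  unfold besselPhase
  exact (ContinuousOn.sub (by fun_prop) continuousOn_gammaPhase).add
    (Complex.continuous_im.comp (continuous_besselLog w)).continuousOn

theorem tendsto_besselPhase_zero {w : ℝ} (hw : 0 < w) :
    Tendsto (fun ν => besselPhase ν w) (𝓝[>] 0) (𝓝 0) := by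
  have h1 : Tendsto (fun ν : ℝ => ν / 2 * Real.log w) (𝓝[>] 0) (𝓝 0) := by
    have : Continuous (fun ν : ℝ => ν / 2 * Real.log w) := by fun_prop
    have := (this.tendsto 0).mono_left (nhdsWithin_le_nhds (s := Set.Ioi 0))
    simpa using this
  have h2 : Tendsto (fun ν : ℝ => (besselLog ν w).im) (𝓝[>] 0) (𝓝 0) := by
    have := ((Complex.continuous_im.comp (continuous_besselLog w)).tendsto 0).mono_left
      (nhdsWithin_le_nhds (s := Set.Ioi 0))
    simp only [Function.comp_apply, im_besselLog_zero hw.le] at this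
    exact this
  simpa [besselPhase] using (h1.sub tendsto_gammaPhase_zero).add h2

theorem besselI_eq (ν : ℝ) (x : ℝ) : besselI (Complex.I * ν) x =
    ((x / 2 : ℝ) : ℂ) ^ (Complex.I * (ν : ℂ)) / Complex.Gamma (1 + Complex.I * ν) *
      besselS ν ((x / 2) ^ 2) := by
  rw [besselI, besselS]
  congr 1
  refine tsum_congr fun k => ?_
  rw [sCoeff, pow_mul]
  push_cast
  ring

theorem cpow_I_mul {ν : ℝ} {x : ℝ} (hx : 0 < x) : ((x / 2 : ℝ) : ℂ) ^ (Complex.I * (ν : ℂ)) =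
    Complex.exp (Complex.I * ((ν / 2 * Real.log ((x / 2) ^ 2) : ℝ) : ℂ)) := by
  have hx2 : (0 : ℝ) < x / 2 := by positivity
  rw [Complex.cpow_def_of_ne_zero (by exact_mod_cast hx2.ne'), ← Complex.ofReal_log hx2.le,
    Real.log_pow]
  push_cast
  ring_nf

theorem besselI_eq_mul_exp_besselPhase {ν x : ℝ} (hν : 0 < ν) (hx : 0 < x) :
    ∃ r : ℝ, 0 < r ∧ besselI (Complex.I * ν) x =
      r * Complex.exp (Complex.I * besselPhase ν ((x / 2) ^ 2)) := by
  obtain ⟨g, hg, hG⟩ := Gamma_eq_norm_mul_exp_gammaPhase hν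
  set w := (x / 2) ^ 2 with hw
  refine ⟨g⁻¹ * Real.exp (besselLog ν w).re, by positivity, ?_⟩
  have h1 : Complex.exp (besselLog ν w) = Complex.exp ((besselLog ν w).re : ℂ) *
      Complex.exp (Complex.I * (besselLog ν w).im) := by
    rw [← Complex.exp_add]
    congr 1
    rw [mul_comm]
    exact (Complex.re_add_im _).symm
  rw [besselI_eq, cpow_I_mul hx, hG, ← hw, besselS_eq_exp_besselLog ν (by positivity), h1, besselPhase]
  have h2 : Complex.exp (Complex.I * ((ν / 2 * Real.log w - gammaPhase ν +
      (besselLog ν w).im : ℝ) : ℂ)) = Complex.exp (Complex.I * ((ν / 2 * Real.log w : ℝ) : ℂ)) *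
      (Complex.exp (Complex.I * (gammaPhase ν : ℂ)))⁻¹ *
      Complex.exp (Complex.I * (besselLog ν w).im) := by
    rw [← Complex.exp_neg, ← Complex.exp_add, ← Complex.exp_add]
    push_cast
    ring_nf
  rw [h2]
  have hgc : (g : ℂ) ≠ 0 := by exact_mod_cast hg.ne'
  have := Complex.exp_ne_zero (Complex.I * (gammaPhase ν : ℂ))
  push_cast
  field_simp

end Phase

/-! ### The phase for large argument -/

section LargeArgument

/-- The sum `∑ w^k / (k!)²`, that is, `I₀(x)` at `w = x²/4`. -/
noncomputable def besselIZero (w : ℝ) : ℝ := ∑' k : ℕ, w ^ k / (k.factorial : ℝ) ^ 2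

theorem hasSum_besselIZero {w : ℝ} (hw : 0 ≤ w) :
    HasSum (fun k : ℕ => w ^ k / (k.factorial : ℝ) ^ 2) (besselIZero w) := by
  refine (Summable.of_nonneg_of_le (fun k => by positivity) (fun k => ?_)
    (Real.summable_pow_div_factorial w)).hasSum
  have := one_le_factorial_cast k
  gcongr
  nlinarith

theorem one_le_besselIZero {w : ℝ} (hw : 0 ≤ w) : 1 ≤ besselIZero w := by
  have := sum_le_hasSum (Finset.range 1) (fun k _ => by positivity) (hasSum_besselIZero hw)
  simpa using this

theorem hasSum_sq_mul_weight {w : ℝ} (hw : 0 ≤ w) :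
    HasSum (fun k : ℕ => w ^ k / (k.factorial : ℝ) ^ 2 * (k : ℝ) ^ 2) (w * besselIZero w) := by
  rw [← hasSum_nat_add_iff' 1]
  have h := (hasSum_besselIZero hw).mul_left w
  simp only [Finset.sum_range_one, Nat.cast_zero]
  convert! h using 1
  · ext k
    rw [Nat.factorial_succ]
    have h0 : (k.factorial : ℝ) ≠ 0 := by exact_mod_cast k.factorial_ne_zero
    have h1 : (k : ℝ) + 1 ≠ 0 := by positivity
    push_cast
    field_simp
    ring
  · simp

theorem hasSum_weight_div_succ_sq {w : ℝ} (hw : 0 < w) :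
    HasSum (fun k : ℕ => w ^ k / (k.factorial : ℝ) ^ 2 * (1 / ((k : ℝ) + 1) ^ 2))
      ((besselIZero w - 1) / w) := by
  have h := ((hasSum_nat_add_iff' 1).2 (hasSum_besselIZero hw.le)).div_const w
  convert! h using 1
  · ext k
    rw [Nat.factorial_succ]
    have h0 : (k.factorial : ℝ) ≠ 0 := by exact_mod_cast k.factorial_ne_zero
    have h1 : (k : ℝ) + 1 ≠ 0 := by positivity
    push_cast
    field_simp
    ring
  · simp

/-- The factor by which the `k`-th term of `I_{iν}` deviates from that of `I₀`, apart from
`((x/2)/(k+1))^{iν}`. -/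
noncomputable def termRatio (ν : ℝ) (k : ℕ) : ℂ :=
  Complex.exp (Complex.I * ν * Real.log (k + 1)) * (k.factorial : ℂ) /
    (Complex.Gamma (1 + Complex.I * ν) * (ascPochhammer ℂ k).eval (1 + Complex.I * ν))

theorem Gamma_one_add_I_mul_ne_zero (ν : ℝ) : Complex.Gamma (1 + Complex.I * ν) ≠ 0 :=
  Complex.Gamma_ne_zero_of_re_pos (by simp)

/-- This is Gauss's product for `Γ(1+iν)`. -/
theorem tendsto_termRatio {ν : ℝ} (hν : 0 < ν) : Tendsto (termRatio ν) atTop (𝓝 1) := by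
  have hI : Complex.I * (ν : ℂ) ≠ 0 := mul_ne_zero Complex.I_ne_zero (by exact_mod_cast hν.ne')
  have h1 := (Complex.GammaSeq_tendsto_Gamma (Complex.I * ν)).const_mul (Complex.I * ν)
  rw [← Complex.Gamma_add_one _ hI, add_comm] at h1
  have h2 : Tendsto (fun n : ℕ => Complex.exp (Complex.I * ν *
      ((Real.log (n + 1) - Real.log n : ℝ) : ℂ))) atTop (𝓝 1) := by
    have h3 : Tendsto (fun n : ℕ => ((Real.log (n + 1) - Real.log n : ℝ) : ℂ)) atTop
        (𝓝 ((0 : ℝ) : ℂ)) :=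
      (Complex.continuous_ofReal.tendsto _).comp Real.tendsto_log_nat_add_one_sub_log
    have h4 := (Complex.continuous_exp.tendsto _).comp (h3.const_mul (Complex.I * ν))
    rw [Complex.ofReal_zero, mul_zero, Complex.exp_zero] at h4
    exact h4
  have h5 := (h2.mul h1).div_const (Complex.Gamma (1 + Complex.I * ν))
  rw [one_mul, div_self (Gamma_one_add_I_mul_ne_zero ν)] at h5
  refine h5.congr' ?_
  filter_upwards [eventually_gt_atTop 0] with n hn
  have hn0 : (n : ℂ) ≠ 0 := by exact_mod_cast hn.ne'
  have hprod : ∀ m : ℕ, ∏ j ∈ Finset.range (m + 1), (Complex.I * (ν : ℂ) + j) =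
      Complex.I * ν * (ascPochhammer ℂ m).eval (1 + Complex.I * ν) := by
    intro m
    induction m with
    | zero => simp
    | succ m ih =>
      rw [Finset.prod_range_succ, ih, ascPochhammer_succ_eval]
      push_cast
      ring
  have hpow : (n : ℂ) ^ (Complex.I * (ν : ℂ)) = Complex.exp (Complex.I * ν * Real.log n) := by
    rw [Complex.cpow_def_of_ne_zero hn0, ← Complex.ofReal_natCast,
      ← Complex.ofReal_log (Nat.cast_nonneg n), mul_comm]
  have hexp : Complex.exp (Complex.I * ν * Real.log (n + 1)) =
      Complex.exp (Complex.I * ν * ((Real.log (n + 1) - Real.log n : ℝ) : ℂ)) *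
        Complex.exp (Complex.I * ν * Real.log n) := by
    rw [← Complex.exp_add]
    push_cast
    ring_nf
  have ha := ascPochhammer_eval_ne ν n
  have hG := Gamma_one_add_I_mul_ne_zero ν
  have hν0 : (ν : ℂ) ≠ 0 := by exact_mod_cast hν.ne'
  rw [termRatio, Complex.GammaSeq, hprod, hpow, hexp]
  field_simp

/-- As `|log u| ≤ |u - u⁻¹| / 2`, the logarithm is controlled by the rational function
`u² + u⁻² - 2 = (u - u⁻¹)²`. -/
theorem abs_log_le {u δ : ℝ} (hu : 0 < u) (hδ : 0 < δ) :
    |Real.log u| ≤ δ + (u ^ 2 + 1 / u ^ 2 - 2) / δ := by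
  have h1 : |Real.log u| ≤ |u - u⁻¹| / 2 := by
    have hs : Real.sinh (Real.log u) = (u - u⁻¹) / 2 := by
      rw [Real.sinh_eq, Real.exp_neg, Real.exp_log hu]
    have h2 : |Real.log u| ≤ |Real.sinh (Real.log u)| := by
      rw [Real.abs_sinh, Real.self_le_sinh_iff]
      exact abs_nonneg _
    rw [hs, abs_div] at h2
    simpa using h2
  have h2 : u ^ 2 + 1 / u ^ 2 - 2 = |u - u⁻¹| ^ 2 := by
    rw [sq_abs]; field_simp; ring
  rw [h2]
  refine h1.trans ?_
  rw [← sub_nonneg]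
  have : δ + |u - u⁻¹| ^ 2 / δ - |u - u⁻¹| / 2 =
      ((δ - |u - u⁻¹| / 4) ^ 2 + 15 / 16 * |u - u⁻¹| ^ 2) / δ := by
    field_simp; ring
  rw [this]
  positivity

/-- `I_{iν}(2X)` deviates from `I₀(2X)` by a relatively small amount, because the weights
`X^{2k}/(k!)²` concentrate at `k ≈ X`, where the terms of both series agree. The concentration is
expressed by the averages of `u² + u⁻² - 2`, `u = (k+1)/X`, which can be computed exactly. -/
theorem norm_besselI_sub_le {ν : ℝ} (hν : 0 < ν) :
    ∃ H : ℝ, 0 ≤ H ∧ ∀ δ : ℝ, 0 < δ → ∃ M : ℝ, ∀ X : ℝ, 0 < X →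
      ‖besselI (Complex.I * ν) (2 * X) - besselIZero (X ^ 2)‖ ≤ besselIZero (X ^ 2) *
        ((ν * H + 1) * δ + ν * H / δ * (2 / X + 1 / X ^ 2) + M / X ^ 2) := by
  have hlim := tendsto_termRatio hν
  obtain ⟨H, hH⟩ := hlim.norm.bddAbove_range
  have hH' : ∀ k, ‖termRatio ν k‖ ≤ H := fun k => hH ⟨k, rfl⟩
  have hH0 : 0 ≤ H := (norm_nonneg _).trans (hH' 0)
  refine ⟨H, hH0, fun δ hδ => ?_⟩
  obtain ⟨K, hK⟩ := (Metric.tendsto_atTop.1 hlim) δ hδ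
  refine ⟨(H + 1) * K ^ 2, fun X hX => ?_⟩
  have hdev : ∀ k, ‖termRatio ν k - 1‖ ≤ δ + (H + 1) * K ^ 2 * (1 / ((k : ℝ) + 1) ^ 2) := by
    intro k
    rcases lt_or_ge k K with h | h
    · have h1 : ‖termRatio ν k - 1‖ ≤ H + 1 := by
        refine (norm_sub_le _ _).trans ?_
        simpa using hH' k
      have h2 : ((k : ℝ) + 1) ^ 2 ≤ (K : ℝ) ^ 2 := by
        have : (k : ℝ) + 1 ≤ K := by exact_mod_cast h
        gcongr
      have h3 : 1 ≤ (K : ℝ) ^ 2 * (1 / ((k : ℝ) + 1) ^ 2) := by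
        rw [mul_one_div, le_div_iff₀ (by positivity)]; linarith
      nlinarith
    · have h1 := hK k h
      rw [dist_eq_norm] at h1
      have : 0 ≤ (H + 1) * (K : ℝ) ^ 2 * (1 / ((k : ℝ) + 1) ^ 2) := by positivity
      linarith
  set w := X ^ 2 with hw
  have hw0 : 0 < w := by positivity
  set c : ℕ → ℂ := fun k => Complex.exp (Complex.I * ((ν * Real.log (X / (k + 1)) : ℝ) : ℂ)) *
    termRatio ν k with hc
  have hcb : ∀ k : ℕ, ‖c k - 1‖ ≤
      (ν * H * δ + ν * H / δ * ((X + 1) / X ^ 2 - 2) + δ) +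
        ν * H / δ * ((1 + 1 / X) / X ^ 2) * (k : ℝ) ^ 2 +
        (ν * H / δ * X ^ 2 + (H + 1) * K ^ 2) * (1 / ((k : ℝ) + 1) ^ 2) := by
    intro k
    have hk : (0 : ℝ) < k + 1 := by positivity
    have h1 : c k - 1 = (Complex.exp (Complex.I * ((ν * Real.log (X / (k + 1)) : ℝ) : ℂ)) - 1) *
        termRatio ν k + (termRatio ν k - 1) := by rw [hc]; ring
    have h2 : ‖Complex.exp (Complex.I * ((ν * Real.log (X / (k + 1)) : ℝ) : ℂ)) - 1‖ ≤
        ν * |Real.log ((k + 1) / X)| := by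
      refine (Real.norm_exp_I_mul_ofReal_sub_one_le (x := ν * Real.log (X / (k + 1)))).trans ?_
      rw [Real.norm_eq_abs, abs_mul, abs_of_pos hν, ← inv_div, Real.log_inv, abs_neg]
    have h3 := abs_log_le (u := ((k : ℝ) + 1) / X) (by positivity) hδ
    -- `2k ≤ k²/X + X` removes the linear term, whose average has no closed form.
    have h4 : ((k : ℝ) + 1) ^ 2 ≤ (1 + 1 / X) * (k : ℝ) ^ 2 + (X + 1) := by
      have : (1 + 1 / X) * (k : ℝ) ^ 2 + (X + 1) - ((k : ℝ) + 1) ^ 2 = (k - X) ^ 2 / X := by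
        field_simp; ring
      have h5 : 0 ≤ ((k : ℝ) - X) ^ 2 / X := by positivity
      linarith
    have h5 : (((k : ℝ) + 1) / X) ^ 2 + 1 / (((k : ℝ) + 1) / X) ^ 2 - 2 ≤
        ((X + 1) / X ^ 2 - 2) + (1 + 1 / X) / X ^ 2 * (k : ℝ) ^ 2 +
          X ^ 2 * (1 / ((k : ℝ) + 1) ^ 2) := by
      have e1 : (((k : ℝ) + 1) / X) ^ 2 ≤ ((1 + 1 / X) * (k : ℝ) ^ 2 + (X + 1)) / X ^ 2 := by
        rw [div_pow]; gcongr
      have e2 : 1 / (((k : ℝ) + 1) / X) ^ 2 = X ^ 2 * (1 / ((k : ℝ) + 1) ^ 2) := by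
        field_simp
      have e3 : ((1 + 1 / X) * (k : ℝ) ^ 2 + (X + 1)) / X ^ 2 =
        (X + 1) / X ^ 2 + (1 + 1 / X) / X ^ 2 * (k : ℝ) ^ 2 := by ring
      rw [e2]
      linarith
    have h6 : |Real.log (((k : ℝ) + 1) / X)| ≤ δ + (((X + 1) / X ^ 2 - 2) +
        (1 + 1 / X) / X ^ 2 * (k : ℝ) ^ 2 + X ^ 2 * (1 / ((k : ℝ) + 1) ^ 2)) / δ := by
      refine h3.trans ?_
      gcongr
    rw [h1]
    refine (norm_add_le _ _).trans ?_
    rw [norm_mul]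
    have h7 : ‖Complex.exp (Complex.I * ((ν * Real.log (X / (k + 1)) : ℝ) : ℂ)) - 1‖ *
        ‖termRatio ν k‖ ≤ ν * (δ + (((X + 1) / X ^ 2 - 2) +
        (1 + 1 / X) / X ^ 2 * (k : ℝ) ^ 2 + X ^ 2 * (1 / ((k : ℝ) + 1) ^ 2)) / δ) * H :=
      mul_le_mul (h2.trans (mul_le_mul_of_nonneg_left h6 hν.le)) (hH' k) (norm_nonneg _)
        (mul_nonneg hν.le ((abs_nonneg _).trans h6))
    refine (add_le_add h7 (hdev k)).trans (le_of_eq ?_)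
    ring
  have hsumI : HasSum (fun k : ℕ => ((w ^ k / (k.factorial : ℝ) ^ 2 : ℝ) : ℂ) * c k)
      (besselI (Complex.I * ν) (2 * X)) := by
    have hX2 : 2 * X / 2 = X := by ring
    rw [besselI_eq, hX2, ← hw]
    have h1 := ((summable_mul_pow (norm_sCoeff_le' ν) (w : ℂ)).of_norm.hasSum).mul_left
      (((X : ℝ) : ℂ) ^ (Complex.I * (ν : ℂ)) / Complex.Gamma (1 + Complex.I * ν))
    rw [besselS]
    convert! h1 using 1
    ext k
    have hk : (0 : ℝ) < k + 1 := by positivity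
    have hpow : (X : ℂ) ^ (Complex.I * (ν : ℂ)) =
        Complex.exp (Complex.I * ((ν * Real.log (X / (k + 1)) : ℝ) : ℂ)) *
          Complex.exp (Complex.I * ν * Real.log (k + 1)) := by
      rw [Complex.cpow_def_of_ne_zero (by exact_mod_cast hX.ne'), ← Complex.ofReal_log hX.le,
        ← Complex.exp_add, Real.log_div hX.ne' hk.ne']
      push_cast
      ring_nf
    have h0 : (k.factorial : ℂ) ≠ 0 := by exact_mod_cast k.factorial_ne_zero
    have ha := ascPochhammer_eval_ne ν k
    have hG := Gamma_one_add_I_mul_ne_zero ν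
    rw [hc, hpow, sCoeff]
    simp only [termRatio]
    push_cast
    field_simp
  have hsum0 := Complex.hasSum_ofReal.2 (hasSum_besselIZero hw0.le)
  have hdiff := hsumI.sub hsum0
  have hmaj := (((hasSum_besselIZero hw0.le).mul_right
    (ν * H * δ + ν * H / δ * ((X + 1) / X ^ 2 - 2) + δ)).add
    ((hasSum_sq_mul_weight hw0.le).mul_left (ν * H / δ * ((1 + 1 / X) / X ^ 2)))).add
    ((hasSum_weight_div_succ_sq hw0).mul_left (ν * H / δ * X ^ 2 + (H + 1) * K ^ 2))
  have hle := tsum_of_norm_bounded hmaj (f := fun k : ℕ =>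
    ((w ^ k / (k.factorial : ℝ) ^ 2 : ℝ) : ℂ) * c k - ((w ^ k / (k.factorial : ℝ) ^ 2 : ℝ) : ℂ))
    (fun k => by
      have hp : 0 ≤ w ^ k / (k.factorial : ℝ) ^ 2 := by positivity
      rw [← mul_sub_one, norm_mul, Complex.norm_real, Real.norm_of_nonneg hp]
      refine (mul_le_mul_of_nonneg_left (hcb k) hp).trans (le_of_eq ?_)
      ring)
  rw [hdiff.tsum_eq] at hle
  refine hle.trans ?_
  have hI0 : 0 ≤ besselIZero w := zero_le_one.trans (one_le_besselIZero hw0.le)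
  have h8 : (ν * H / δ * X ^ 2 + (H + 1) * K ^ 2) * ((besselIZero w - 1) / w) ≤
      (ν * H / δ * X ^ 2 + (H + 1) * K ^ 2) * (besselIZero w / w) := by
    have : (besselIZero w - 1) / w ≤ besselIZero w / w := by gcongr; linarith
    exact mul_le_mul_of_nonneg_left this (by positivity)
  refine (add_le_add_right h8 _).trans (le_of_eq ?_)
  rw [hw]
  field_simp
  ring

theorem tendsto_exp_besselPhase {ν : ℝ} (hν : 0 < ν) :
    Tendsto (fun w => Complex.exp (Complex.I * besselPhase ν w)) atTop (𝓝 1) := by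
  set f : ℝ → ℂ := fun X => besselI (Complex.I * ν) (2 * X) / besselIZero (X ^ 2) with hf
  have hfl : Tendsto f atTop (𝓝 1) := by
    obtain ⟨H, hH0, hH⟩ := norm_besselI_sub_le hν
    rw [tendsto_iff_norm_sub_tendsto_zero, Metric.tendsto_nhds]
    intro ε hε
    have hνH : 0 < ν * H + 1 := by positivity
    obtain ⟨M, hM⟩ := hH (ε / (2 * (ν * H + 1))) (by positivity)
    have hsmall : Tendsto (fun X : ℝ => ν * H / (ε / (2 * (ν * H + 1))) * (2 / X + 1 / X ^ 2) +
        M / X ^ 2) atTop (𝓝 0) := by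
      have h1 : Tendsto (fun X : ℝ => X ^ 2) atTop atTop := tendsto_pow_atTop two_ne_zero
      have h2 := ((tendsto_const_nhds (x := (2 : ℝ))).div_atTop tendsto_id).add
        ((tendsto_const_nhds (x := (1 : ℝ))).div_atTop h1)
      have h3 := (h2.const_mul (ν * H / (ε / (2 * (ν * H + 1))))).add
        ((tendsto_const_nhds (x := M)).div_atTop h1)
      simpa using h3
    filter_upwards [eventually_gt_atTop 0, hsmall.eventually_lt_const (half_pos hε)] with X hX hs
    have hI0 : 0 < besselIZero (X ^ 2) :=
      zero_lt_one.trans_le (one_le_besselIZero (by positivity))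
    have hI0c : (besselIZero (X ^ 2) : ℂ) ≠ 0 := by exact_mod_cast hI0.ne'
    have hb := hM X hX
    have h4 : f X - 1 = (besselI (Complex.I * ν) (2 * X) - besselIZero (X ^ 2)) /
        besselIZero (X ^ 2) := by
      rw [sub_div, div_self hI0c]
    rw [Real.dist_eq, sub_zero, abs_norm, h4, norm_div, Complex.norm_real,
      Real.norm_of_nonneg hI0.le, div_lt_iff₀ hI0]
    refine hb.trans_lt ?_
    rw [mul_comm]
    refine mul_lt_mul_of_pos_right ?_ hI0
    have h5 : (ν * H + 1) * (ε / (2 * (ν * H + 1))) = ε / 2 := by field_simp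
    rw [h5]
    linarith
  have hsqrt : Tendsto (fun w : ℝ => f (Real.sqrt w)) atTop (𝓝 1) :=
    hfl.comp Real.tendsto_sqrt_atTop
  have hdiv : Tendsto (fun w : ℝ => f (Real.sqrt w) / (‖f (Real.sqrt w)‖ : ℂ)) atTop (𝓝 1) := by
    have h1 : Tendsto (fun w : ℝ => ((‖f (Real.sqrt w)‖ : ℝ) : ℂ)) atTop (𝓝 ((‖(1 : ℂ)‖ : ℝ) : ℂ)) :=
      (Complex.continuous_ofReal.tendsto _).comp hsqrt.norm
    have h2 := hsqrt.div h1 (by simp)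
    rw [norm_one, Complex.ofReal_one, div_one] at h2
    exact h2
  refine hdiv.congr' ?_
  filter_upwards [eventually_gt_atTop 0] with w hw
  have hsw : 0 < Real.sqrt w := Real.sqrt_pos.2 hw
  obtain ⟨r, hr, hI⟩ := besselI_eq_mul_exp_besselPhase hν (x := 2 * Real.sqrt w) (by positivity)
  have hw2 : (2 * Real.sqrt w / 2) ^ 2 = w := by
    rw [mul_div_cancel_left₀ _ (two_ne_zero), Real.sq_sqrt hw.le]
  rw [hw2] at hI
  have hI0 : 0 < besselIZero w := zero_lt_one.trans_le (one_le_besselIZero hw.le)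
  have hfw : f (Real.sqrt w) = ((r / besselIZero w : ℝ) : ℂ) *
      Complex.exp (Complex.I * besselPhase ν w) := by
    rw [hf]
    simp only
    rw [hI, Real.sq_sqrt hw.le]
    push_cast
    ring
  have hpos : 0 < r / besselIZero w := by positivity
  have hn : ‖f (Real.sqrt w)‖ = r / besselIZero w := by
    rw [hfw, norm_mul, mul_comm Complex.I, Complex.norm_exp_ofReal_mul_I, mul_one,
      Complex.norm_real, Real.norm_of_nonneg hpos.le]
  have hposc : ((r / besselIZero w : ℝ) : ℂ) ≠ 0 := by exact_mod_cast hpos.ne'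
  rw [hn, hfw, mul_div_cancel_left₀ _ hposc]

end LargeArgument

/-! ### Monotonicity of the phase and the zeros -/

section Zeros

theorem besselP_pos (ν : ℝ) {w : ℝ} (hw : 0 ≤ w) : 0 < besselP ν w :=
  zero_lt_one.trans_le (one_le_besselP ν hw)

theorem monotoneOn_besselPhase {ν : ℝ} (hν : 0 < ν) : MonotoneOn (besselPhase ν) (Set.Ioi 0) := by
  refine monotoneOn_of_deriv_nonneg (convex_Ioi 0)
    (fun w hw => (hasDerivAt_besselPhase ν hw).continuousAt.continuousWithinAt) ?_ ?_
  · rw [interior_Ioi]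
    exact fun w hw => (hasDerivAt_besselPhase ν hw).differentiableAt.differentiableWithinAt
  · rw [interior_Ioi]
    intro w hw
    rw [(hasDerivAt_besselPhase ν hw).deriv]
    have hw' : 0 < w := hw
    have := besselP_pos ν hw'.le
    positivity

/-- From `P ≥ 2w / (1+ν²)` the derivative of the phase is `O(w⁻²)`, which bounds its growth. -/
theorem antitoneOn_besselPhase_add {ν : ℝ} (hν : 0 < ν) :
    AntitoneOn (fun w => besselPhase ν w + ν * (1 + ν ^ 2) / 4 * w⁻¹) (Set.Ioi 0) := by
  have hd : ∀ w : ℝ, 0 < w → HasDerivAt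
      (fun w => besselPhase ν w + ν * (1 + ν ^ 2) / 4 * w⁻¹)
      (ν / (2 * w * besselP ν w) + ν * (1 + ν ^ 2) / 4 * -(w ^ 2)⁻¹) w := fun w hw =>
    (hasDerivAt_besselPhase ν hw).add ((hasDerivAt_inv hw.ne').const_mul _)
  refine antitoneOn_of_deriv_nonpos (convex_Ioi 0)
    (fun w hw => (hd w hw).continuousAt.continuousWithinAt) ?_ ?_
  · rw [interior_Ioi]
    exact fun w hw => (hd w hw).differentiableAt.differentiableWithinAt
  · rw [interior_Ioi]
    intro w hw
    have hw' : 0 < w := hw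
    rw [(hd w hw').deriv]
    have h1 := one_add_le_besselP ν hw'.le
    have h2 : 2 * w / (1 + ν ^ 2) ≤ besselP ν w := by linarith
    have h3 : ν / (2 * w * besselP ν w) ≤ ν / (2 * w * (2 * w / (1 + ν ^ 2))) := by
      gcongr
    have h4 : ν / (2 * w * (2 * w / (1 + ν ^ 2))) = ν * (1 + ν ^ 2) / 4 * (w ^ 2)⁻¹ := by
      field_simp
      ring
    linarith

/-- The phase has a limit for `w → ∞`; it is a multiple of `2π`, and it is approached at a rate that
is locally uniform in `ν`. -/
theorem exists_besselPhase_limit {ν : ℝ} (hν : 0 < ν) : ∃ k : ℤ, ∀ w : ℝ, 0 < w →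
    |besselPhase ν w - k * (2 * Real.pi)| ≤ ν * (1 + ν ^ 2) / 4 * w⁻¹ := by
  have hpos : ∀ n : ℕ, (0 : ℝ) < n + 1 := fun n => by positivity
  have hmono : Monotone (fun n : ℕ => besselPhase ν ((n : ℝ) + 1)) := fun m n h =>
    monotoneOn_besselPhase hν (hpos m) (hpos n) (by gcongr)
  have hbd : BddAbove (Set.range (fun n : ℕ => besselPhase ν ((n : ℝ) + 1))) := by
    refine ⟨besselPhase ν 1 + ν * (1 + ν ^ 2) / 4 * 1⁻¹, ?_⟩
    rintro _ ⟨n, rfl⟩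
    have h1 := antitoneOn_besselPhase_add hν (a := 1) (b := (n : ℝ) + 1) (Set.mem_Ioi.2 one_pos) (hpos n)
      (by simp)
    have h2 : 0 ≤ ν * (1 + ν ^ 2) / 4 * ((n : ℝ) + 1)⁻¹ := by positivity
    simp only at h1 ⊢
    linarith
  have hlim := tendsto_atTop_ciSup hmono hbd
  set L := ⨆ n : ℕ, besselPhase ν ((n : ℝ) + 1) with hL
  have hn : Tendsto (fun n : ℕ => (n : ℝ) + 1) atTop atTop :=
    tendsto_atTop_add_const_right _ _ tendsto_natCast_atTop_atTop
  have hexp : Complex.exp (Complex.I * L) = 1 := by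
    have h1 := (tendsto_exp_besselPhase hν).comp hn
    have h2 : Tendsto (fun n : ℕ => Complex.exp (Complex.I * besselPhase ν ((n : ℝ) + 1))) atTop
        (𝓝 (Complex.exp (Complex.I * L))) :=
      (Complex.continuous_exp.tendsto _).comp
        (((Complex.continuous_ofReal.tendsto _).comp hlim).const_mul _)
    exact tendsto_nhds_unique h2 h1
  obtain ⟨k, hk⟩ := Complex.exp_eq_one_iff.1 hexp
  have hLk : L = k * (2 * Real.pi) := by
    have h1 : Complex.I * L = Complex.I * ((k * (2 * Real.pi) : ℝ) : ℂ) := by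
      rw [hk]; push_cast; ring
    exact_mod_cast mul_left_cancel₀ Complex.I_ne_zero h1
  refine ⟨k, fun w hw => ?_⟩
  rw [← hLk]
  have hev := hn.eventually_ge_atTop w
  have h1 : besselPhase ν w ≤ L := ge_of_tendsto hlim (hev.mono fun n h =>
    monotoneOn_besselPhase hν hw (hpos n) h)
  have h2 : L ≤ besselPhase ν w + ν * (1 + ν ^ 2) / 4 * w⁻¹ := by
    refine le_of_tendsto hlim (hev.mono fun n h => ?_)
    have h3 := antitoneOn_besselPhase_add hν hw (hpos n) h
    have h4 : 0 ≤ ν * (1 + ν ^ 2) / 4 * ((n : ℝ) + 1)⁻¹ := by positivity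
    simp only at h3
    linarith
  rw [abs_le]
  constructor <;> linarith

/-- The multiple of `2π` does not depend on `ν`, by continuity, and it is `0` for small `ν`. -/
theorem tendsto_besselPhase_atTop {ν : ℝ} (hν : 0 < ν) :
    Tendsto (besselPhase ν) atTop (𝓝 0) := by
  have hκ : Tendsto (fun w : ℝ => ν * (1 + ν ^ 2) / 4 * w⁻¹) atTop (𝓝 0) := by
    simpa using (tendsto_inv_atTop_zero (𝕜 := ℝ)).const_mul (ν * (1 + ν ^ 2) / 4)
  obtain ⟨k, hk⟩ := exists_besselPhase_limit hν
  have hpi := Real.pi_gt_three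
  have hk0 : k = 0 := by
    by_contra hne
    obtain ⟨w, hw, hw'⟩ := ((eventually_gt_atTop (0 : ℝ)).and
      ((hκ).eventually_lt_const (half_pos one_pos))).exists
    have hkabs : 6 ≤ |(k : ℝ) * (2 * Real.pi)| := by
      have : (1 : ℝ) ≤ |(k : ℝ)| := by exact_mod_cast Int.one_le_abs hne
      rw [abs_mul, abs_of_pos (by positivity : 0 < 2 * Real.pi)]
      nlinarith
    have hlarge : 1 ≤ |besselPhase ν w| := by
      have h1 := hk w hw
      have h2 := abs_sub_abs_le_abs_sub ((k : ℝ) * (2 * Real.pi)) (besselPhase ν w)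
      rw [abs_sub_comm] at h2
      linarith
    have hsmall : ∀ᶠ τ in 𝓝[>] (0 : ℝ), |besselPhase τ w| < 1 := by
      have := (tendsto_besselPhase_zero hw).abs
      rw [abs_zero] at this
      exact this.eventually_lt_const one_pos
    have hmem : ∀ᶠ τ in 𝓝[>] (0 : ℝ), τ ∈ Set.Ioo 0 ν := Ioo_mem_nhdsGT hν
    -- Between `0` and `ν` the modulus of the phase takes the value `1`, which is too far from all
    -- multiples of `2π`.
    obtain ⟨τ, hτ1, hτ0, hτν⟩ := (hsmall.and hmem).exists
    have hcont : ContinuousOn (fun τ => |besselPhase τ w|) (Set.Icc τ ν) :=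
      (continuousOn_besselPhase w).abs.mono fun s hs => hτ0.trans_le hs.1
    obtain ⟨s, hs, hs1⟩ := intermediate_value_Icc hτν.le hcont ⟨hτ1.le, hlarge⟩
    have hs0 : 0 < s := hτ0.trans_le hs.1
    obtain ⟨j, hj⟩ := exists_besselPhase_limit hs0
    have h1 := hj w hw
    have h2 : s * (1 + s ^ 2) / 4 * w⁻¹ ≤ ν * (1 + ν ^ 2) / 4 * w⁻¹ := by
      have := hs.2
      gcongr
    simp only at hs1
    have h3 := abs_sub_abs_le_abs_sub ((j : ℝ) * (2 * Real.pi)) (besselPhase s w)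
    have h4 := abs_sub_abs_le_abs_sub (besselPhase s w) ((j : ℝ) * (2 * Real.pi))
    rw [abs_sub_comm] at h3
    rcases eq_or_ne j 0 with rfl | hj0
    · simp at h4
      simp at h1
      linarith
    · have : (1 : ℝ) ≤ |(j : ℝ)| := by exact_mod_cast Int.one_le_abs hj0
      have h5 : 6 ≤ |(j : ℝ) * (2 * Real.pi)| := by
        rw [abs_mul, abs_of_pos (by positivity : 0 < 2 * Real.pi)]
        nlinarith
      linarith
  rw [tendsto_zero_iff_norm_tendsto_zero]
  refine squeeze_zero' (Eventually.of_forall fun _ => norm_nonneg _)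
    ((eventually_gt_atTop 0).mono fun w hw => ?_) (hκ)
  have := hk w hw
  simpa [hk0] using this

/-- The phase decreases with `ν`: the difference of the phases for two values of `ν` is a strictly
decreasing function of `w` that vanishes at infinity, since `P` decreases with `ν`. -/
theorem besselPhase_lt {ν₁ ν₂ w : ℝ} (h1 : 0 < ν₁) (h12 : ν₁ < ν₂) (hw : 0 < w) :
    besselPhase ν₂ w < besselPhase ν₁ w := by
  have h2 : 0 < ν₂ := h1.trans h12
  have hd : ∀ w : ℝ, 0 < w → HasDerivAt (fun w => besselPhase ν₁ w - besselPhase ν₂ w)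
      (ν₁ / (2 * w * besselP ν₁ w) - ν₂ / (2 * w * besselP ν₂ w)) w := fun w hw =>
    (hasDerivAt_besselPhase ν₁ hw).sub (hasDerivAt_besselPhase ν₂ hw)
  have hanti : StrictAntiOn (fun w => besselPhase ν₁ w - besselPhase ν₂ w) (Set.Ioi 0) := by
    refine strictAntiOn_of_deriv_neg (convex_Ioi 0)
      (fun w hw => (hd w hw).continuousAt.continuousWithinAt) ?_
    rw [interior_Ioi]
    intro w hw
    have hw' : 0 < w := hw
    rw [(hd w hw').deriv, sub_neg]
    have hP1 := besselP_pos ν₁ hw'.le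
    have hP2 := besselP_pos ν₂ hw'.le
    have hP := besselP_anti h1.le h12.le hw'.le
    calc ν₁ / (2 * w * besselP ν₁ w) ≤ ν₁ / (2 * w * besselP ν₂ w) := by gcongr
      _ < ν₂ / (2 * w * besselP ν₂ w) := by gcongr
  have hlim : Tendsto (fun w => besselPhase ν₁ w - besselPhase ν₂ w) atTop (𝓝 0) := by
    simpa using (tendsto_besselPhase_atTop h1).sub (tendsto_besselPhase_atTop h2)
  have hw1 : (0 : ℝ) < w + 1 := by linarith
  have h3 : 0 ≤ besselPhase ν₁ (w + 1) - besselPhase ν₂ (w + 1) :=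
    le_of_tendsto hlim ((eventually_ge_atTop (w + 1)).mono fun u hu =>
      hanti.antitoneOn hw1 (hw1.trans_le hu) hu)
  have h4 := hanti hw hw1 (by linarith)
  simp only at h4
  linarith

theorem besselPhase_lt_zero {ν w : ℝ} (hν : 0 < ν) (hw : 0 < w) : besselPhase ν w < 0 := by
  have h1 : besselPhase (ν / 2) w ≤ 0 := by
    refine ge_of_tendsto (tendsto_besselPhase_zero hw) ?_
    filter_upwards [Ioo_mem_nhdsGT (half_pos hν)] with τ hτ
    exact (besselPhase_lt hτ.1 hτ.2 hw).le
  exact (besselPhase_lt (half_pos hν) (half_lt_self hν) hw).trans_le h1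

theorem tendsto_inv_I_mul : Tendsto (fun ν : ℝ => (Complex.I * (ν : ℂ))⁻¹) atTop (𝓝 0) := by
  rw [tendsto_zero_iff_norm_tendsto_zero]
  refine (tendsto_inv_atTop_zero (𝕜 := ℝ)).congr' ?_
  filter_upwards [eventually_gt_atTop 0] with ν hν
  simp [abs_of_pos hν]

theorem binetJ_isBigO (N : ℕ) : (fun ν : ℝ => binetJ (Complex.I * ν) -
    ∑ j ∈ Finset.range (N + 1), (stirlingBeta j : ℂ) * ((Complex.I * (ν : ℂ))⁻¹) ^ (j + 1)) =O[atTop]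
      (fun ν : ℝ => ((Complex.I * (ν : ℂ))⁻¹) ^ N) := by
  obtain ⟨C, hC⟩ := binetJ_expansion N
  refine IsBigO.of_bound C ?_
  filter_upwards [eventually_ge_atTop 1] with ν hν
  rw [norm_pow]
  refine hC _ (by simp) ?_
  simpa using hν.trans (le_abs_self ν)

theorem tendsto_binetJ : Tendsto (fun ν : ℝ => binetJ (Complex.I * ν)) atTop (𝓝 0) := by
  have h1 : Tendsto (fun ν : ℝ => ((Complex.I * (ν : ℂ))⁻¹) ^ 1) atTop (𝓝 0) := by
    simpa using tendsto_inv_I_mul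
  have h2 := (binetJ_isBigO 1).trans_tendsto h1
  have h3 : Tendsto (fun ν : ℝ => ∑ j ∈ Finset.range (1 + 1),
      (stirlingBeta j : ℂ) * ((Complex.I * (ν : ℂ))⁻¹) ^ (j + 1)) atTop
      (𝓝 (∑ j ∈ Finset.range (1 + 1), (stirlingBeta j : ℂ) * 0 ^ (j + 1))) :=
    tendsto_finsetSum _ fun j _ => (tendsto_inv_I_mul.pow _).const_mul _
  have h4 := h2.add h3
  simpa using h4

theorem tendsto_besselPhase_atBot {w : ℝ} (hw : 0 ≤ w) :
    Tendsto (fun ν => besselPhase ν w) atTop atBot := by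
  have h1 : Tendsto (fun ν : ℝ => ν * (Real.log ν - 1 - Real.log w / 2)) atTop atTop := by
    refine tendsto_id.atTop_mul_atTop₀ ?_
    have := tendsto_atTop_add_const_right atTop (-1 - Real.log w / 2) Real.tendsto_log_atTop
    refine this.congr fun ν => by ring
  have h2 : Tendsto (fun ν : ℝ => (besselLog ν w).im - (binetJ (Complex.I * ν)).im - Real.pi / 4)
      atTop (𝓝 ((0 : ℂ).im - (0 : ℂ).im - Real.pi / 4)) :=
    (((Complex.continuous_im.tendsto _).comp (tendsto_besselLog_atTop hw)).sub
      ((Complex.continuous_im.tendsto _).comp tendsto_binetJ)).sub_const _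
  have h3 := (tendsto_neg_atTop_atBot.comp h1).atBot_add h2
  refine h3.congr fun ν => ?_
  simp only [Function.comp_apply, besselPhase, gammaPhase]
  ring

theorem besselI_neg (ν : ℝ) {x : ℝ} (hx : 0 < x) :
    besselI (-(Complex.I * ν)) x = starRingEnd ℂ (besselI (Complex.I * ν) x) := by
  have h : -(Complex.I * (ν : ℂ)) = Complex.I * ((-ν : ℝ) : ℂ) := by push_cast; ring
  rw [h, besselI_eq, besselI_eq, besselS_neg, cpow_I_mul hx, cpow_I_mul hx, map_mul, map_div₀,
    ← Complex.exp_conj, ← Complex.Gamma_conj]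
  simp only [map_mul, map_add, map_one, Complex.conj_I, Complex.conj_ofReal]
  push_cast
  ring_nf

theorem besselKImag_eq_zero_iff {ν x : ℝ} (hν : 0 < ν) (hx : 0 < x) :
    besselKImag ν x = 0 ↔ ∃ k : ℤ, (k : ℝ) * Real.pi = besselPhase ν ((x / 2) ^ 2) := by
  obtain ⟨r, hr, hI⟩ := besselI_eq_mul_exp_besselPhase hν hx
  have hs : 0 < Real.sinh (Real.pi * ν) := Real.sinh_pos_iff.2 (by positivity)
  have hpi : (Real.pi : ℂ) ≠ 0 := by exact_mod_cast Real.pi_ne_zero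
  have h2 : (besselI (Complex.I * ν) x).im = r * Real.sin (besselPhase ν ((x / 2) ^ 2)) := by
    rw [hI, mul_comm Complex.I, Complex.im_ofReal_mul, Complex.exp_ofReal_mul_I_im]
  rw [besselKImag, besselI_neg ν hx, Complex.sub_conj, h2, ← Real.sin_eq_zero_iff]
  have hs' : ((2 * Real.sinh (Real.pi * ν) : ℝ) : ℂ) ≠ 0 := by exact_mod_cast (by positivity)
  have hr' : (r : ℂ) ≠ 0 := by exact_mod_cast hr.ne'
  rw [mul_eq_zero, or_iff_right (div_ne_zero (mul_ne_zero hpi Complex.I_ne_zero) hs'),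
    mul_eq_zero, or_iff_left Complex.I_ne_zero, Complex.ofReal_eq_zero]
  constructor
  · intro h
    have : 2 * r ≠ 0 := by positivity
    rw [← mul_assoc] at h
    exact (mul_eq_zero.1 h).resolve_left this
  · intro h
    rw [h]; simp

/-- The positive zeros, enumerated by the value of the phase. -/
theorem exists_zeros {x : ℝ} (hx : 0 < x) : ∃ ν : ℕ → ℝ, StrictMonoOn ν (Set.Ici 1) ∧
    ν '' Set.Ici 1 = positiveZeros x ∧ Tendsto ν atTop atTop ∧
    ∀ n, 1 ≤ n → 0 < ν n ∧ besselPhase (ν n) ((x / 2) ^ 2) = -(n * Real.pi) := by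
  set w := (x / 2) ^ 2 with hw
  have hw0 : 0 < w := by positivity
  have hanti : ∀ {a b : ℝ}, 0 < a → 0 < b → besselPhase a w < besselPhase b w → b < a := by
    intro a b ha hb h
    by_contra hle
    rcases (not_lt.1 hle).eq_or_lt with h1 | h1
    · rw [h1] at h; exact lt_irrefl _ h
    · exact lt_asymm h (besselPhase_lt ha h1 hw0)
  have hex : ∀ n : ℕ, 1 ≤ n → ∃ ν : ℝ, 0 < ν ∧ besselPhase ν w = -(n * Real.pi) := by
    intro n hn
    have hn' : (1 : ℝ) ≤ n := by exact_mod_cast hn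
    have hneg : -(n * Real.pi) < 0 := by
      have := Real.pi_pos
      nlinarith
    obtain ⟨a, ha1, ha⟩ := (((tendsto_besselPhase_zero hw0).eventually_const_lt hneg).and
      self_mem_nhdsWithin).exists
    have ha0 : 0 < a := ha
    obtain ⟨b, hb1, hb⟩ := (((tendsto_besselPhase_atBot hw0.le).eventually_lt_atBot
      (-(n * Real.pi))).and (eventually_ge_atTop a)).exists
    have hcont : ContinuousOn (fun τ => besselPhase τ w) (Set.Icc a b) :=
      (continuousOn_besselPhase w).mono fun s hs => ha0.trans_le hs.1
    obtain ⟨s, hs, hs1⟩ := intermediate_value_Icc' hb hcont ⟨hb1.le, ha1.le⟩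
    exact ⟨s, ha0.trans_le hs.1, hs1⟩
  have hex' : ∀ n : ℕ, ∃ ν : ℝ, 1 ≤ n → 0 < ν ∧ besselPhase ν w = -(n * Real.pi) := by
    intro n
    by_cases hn : 1 ≤ n
    · obtain ⟨s, hs⟩ := hex n hn
      exact ⟨s, fun _ => hs⟩
    · exact ⟨0, fun h => absurd h hn⟩
  choose ν hν using hex'
  refine ⟨ν, ?_, ?_, ?_, hν⟩
  · intro m hm n hn hmn
    obtain ⟨h1, h2⟩ := hν m hm
    obtain ⟨h3, h4⟩ := hν n hn
    refine hanti h3 h1 ?_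
    rw [h2, h4]
    have : (m : ℝ) < n := by exact_mod_cast hmn
    have := Real.pi_pos
    nlinarith
  · ext s
    constructor
    · rintro ⟨n, hn, rfl⟩
      obtain ⟨h1, h2⟩ := hν n hn
      refine ⟨h1, (besselKImag_eq_zero_iff h1 hx).2 ⟨-n, ?_⟩⟩
      rw [← hw, h2]
      push_cast
      ring
    · rintro ⟨h1, h2⟩
      obtain ⟨k, hk⟩ := (besselKImag_eq_zero_iff h1 hx).1 h2
      rw [← hw] at hk
      have hneg := besselPhase_lt_zero h1 hw0
      rw [← hk] at hneg
      have hk0 : (k : ℝ) < 0 := by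
        have := Real.pi_pos
        nlinarith
      have hk0' : k < 0 := by exact_mod_cast hk0
      have hn1 : 1 ≤ (-k).toNat := by omega
      have hcast : (((-k).toNat : ℕ) : ℝ) = -(k : ℝ) := by
        have : (((-k).toNat : ℤ) : ℝ) = ((-k : ℤ) : ℝ) := by
          rw [Int.toNat_of_nonneg (by omega)]
        push_cast at this
        exact this
      refine ⟨(-k).toNat, hn1, ?_⟩
      obtain ⟨h3, h4⟩ := hν _ hn1
      rw [hcast] at h4
      have h5 : besselPhase (ν (-k).toNat) w = besselPhase s w := by
        rw [h4, ← hk]; ring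
      rcases lt_trichotomy (ν (-k).toNat) s with h | h | h
      · exact absurd h5 (besselPhase_lt h3 h hw0).ne'
      · exact h
      · exact absurd h5 (besselPhase_lt h1 h hw0).ne
  · rw [tendsto_atTop]
    intro V
    have hV : 0 < max V 1 := lt_max_of_lt_right one_pos
    have hlim : Tendsto (fun n : ℕ => (n : ℝ) * Real.pi) atTop atTop :=
      tendsto_natCast_atTop_atTop.atTop_mul_const Real.pi_pos
    filter_upwards [hlim.eventually_gt_atTop (-besselPhase (max V 1) w), eventually_ge_atTop 1]
      with n hn hn1
    obtain ⟨h3, h4⟩ := hν n hn1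
    refine (le_max_left V 1).trans (hanti h3 hV ?_).le
    rw [h4]; linarith

end Zeros

/-! ### The expansion of the phase -/

section PhaseExpansion

open PowerSeries

theorem coeff_pow_eq_zero_of_lt {R : Type*} [CommRing R] {p : PowerSeries R}
    (hp : constantCoeff p = 0) {k j : ℕ} (h : k < j) : coeff k (p ^ j) = 0 :=
  X_pow_dvd_iff.1 (pow_dvd_pow_of_dvd (X_dvd_iff.2 hp) j) k h

theorem coeff_sum_C_mul_pow_of_lt {R : Type*} [CommRing R] {p : PowerSeries R}
    (hp : constantCoeff p = 0) (c : ℕ → R) {k M N : ℕ} (hM : k < M) (hN : k < N) :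
    coeff k (∑ j ∈ Finset.range M, C (c j) * p ^ j) =
      coeff k (∑ j ∈ Finset.range N, C (c j) * p ^ j) := by
  have key : ∀ K, k < K → coeff k (∑ j ∈ Finset.range K, C (c j) * p ^ j) =
      coeff k (∑ j ∈ Finset.range (k + 1), C (c j) * p ^ j) := by
    intro K hK
    rw [map_sum, map_sum]
    symm
    refine Finset.sum_subset (Finset.range_subset_range.2 hK) fun j _ hj => ?_
    have hj' : k < j := by simpa using hj
    rw [coeff_C_mul, coeff_pow_eq_zero_of_lt hp hj', mul_zero]
  rw [key M hM, key N hN]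

/-- The small quantity `1/(iν)`. -/
noncomputable def invI (ν : ℝ) : ℂ := (Complex.I * (ν : ℂ))⁻¹

theorem invI_isBigO : invI =O[atTop] (fun _ => (1 : ℝ)) := tendsto_inv_I_mul.isBigO_one ℝ

/-- A real power series, regarded as a complex one. -/
noncomputable def toComplex (p : PowerSeries ℝ) : PowerSeries ℂ := PowerSeries.map Complex.ofRealHom p

theorem coeff_toComplex (p : PowerSeries ℝ) (k : ℕ) :
    coeff k (toComplex p) = ((coeff k p : ℝ) : ℂ) := by
  simp [toComplex]

theorem hasExpansion_neg_binetJ (N : ℕ) : HasExpansion atTop invI N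
    (fun ν => -binetJ (Complex.I * ν)) (fun _ => toComplex stirlingExponent) := by
  have h1 : HasExpansion atTop invI (N + 2) _ (fun _ => toComplex stirlingExponent) :=
    hasExpansion_partialSum fun k _ => isBigO_const_const _ one_ne_zero _
  refine (h1.mono invI_isBigO (by omega : N ≤ N + 2)).of_sub_isBigO ?_
  refine (binetJ_isBigO N).neg_left.congr_left fun ν => ?_
  rw [Finset.sum_range_succ' _ (N + 1)]
  have h2 : ∀ k : ℕ, coeff (k + 1) (toComplex stirlingExponent) = -(stirlingBeta k : ℂ) := by
    intro k
    rw [coeff_toComplex, stirlingExponent, coeff_mk, stirlingBeta, if_neg (Nat.succ_ne_zero k)]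
    push_cast
    ring
  have h0 : coeff 0 (toComplex stirlingExponent) = 0 := by
    rw [coeff_toComplex, stirlingExponent, coeff_mk]; simp
  simp only [h2, h0, invI, neg_mul, Finset.sum_neg_distrib, zero_mul]
  ring

theorem hasExpansion_exp_neg_binetJ (N : ℕ) : HasExpansion atTop invI N
    (fun ν => Complex.exp (-binetJ (Complex.I * ν)))
    (fun _ => toComplex (mk stirlingCoeff)) := by
  have hO : (fun ν : ℝ => -binetJ (Complex.I * ν)) =O[atTop] invI := by
    have := (hasExpansion_neg_binetJ 1).2
    simp only [Finset.sum_range_one, coeff_toComplex, stirlingExponent, coeff_mk, if_true,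
      Complex.ofReal_zero, zero_mul, sub_zero, pow_one] at this
    exact this
  have hlim : Tendsto (fun ν : ℝ => -binetJ (Complex.I * ν)) atTop (𝓝 0) := by
    simpa using tendsto_binetJ.neg
  have h := (hasExpansion_neg_binetJ N).comp invI_isBigO hO
    (g := fun ν => Complex.exp (-binetJ (Complex.I * ν))) (fun j => 1 / (j.factorial : ℂ))
    (((Complex.exp_sub_sum_range_isBigO_pow N).comp_tendsto hlim).congr_left fun ν => by
      simp only [Function.comp_apply]
      congr 1
      exact Finset.sum_congr rfl fun j _ => by ring)
  refine h.congr_coeff fun ν k hk => ?_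
  have hc : constantCoeff (toComplex stirlingExponent) = 0 := by
    rw [← coeff_zero_eq_constantCoeff_apply, coeff_toComplex, stirlingExponent, coeff_mk]; simp
  rw [coeff_sum_C_mul_pow_of_lt hc _ hk (Nat.lt_succ_self k), coeff_toComplex, coeff_mk,
    stirlingCoeff, ← coeff_toComplex, toComplex]
  simp [toComplex]

/-- The expansion of `1 / (1+z)_j` in powers of `1/z`, whose coefficients are Stirling numbers of the
second kind. -/
noncomputable def pochhammerSeries (j : ℕ) : PowerSeries ℂ :=
  mk fun k => (-1 : ℂ) ^ (k - j) * (Nat.stirlingSecond k j : ℂ)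

theorem pochhammerSeries_succ (j : ℕ) :
    pochhammerSeries (j + 1) = pochhammerSeries j * (X * (1 + C ((j : ℂ) + 1) * X)⁻¹) := by
  have h0 : constantCoeff (1 + C ((j : ℂ) + 1) * X) ≠ 0 := by simp
  rw [← mul_assoc, PowerSeries.eq_mul_inv_iff_mul_eq h0]
  ext k
  rw [mul_add, mul_one, map_add, mul_left_comm, coeff_C_mul]
  cases k with
  | zero => simp [pochhammerSeries]
  | succ k =>
    rw [coeff_succ_mul_X, coeff_succ_mul_X, pochhammerSeries, pochhammerSeries, coeff_mk, coeff_mk,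
      coeff_mk, Nat.stirlingSecond_succ_succ]
    rcases lt_trichotomy k j with h | h | h
    · rw [Nat.stirlingSecond_eq_zero_of_lt h, Nat.stirlingSecond_eq_zero_of_lt (by omega)]
      simp
    · subst h
      rw [Nat.stirlingSecond_eq_zero_of_lt (Nat.lt_succ_self k)]
      simp
    · obtain ⟨i, rfl⟩ := Nat.exists_eq_add_of_lt h
      rw [show j + i + 1 + 1 - (j + 1) = i + 1 by omega, show j + i + 1 - (j + 1) = i by omega,
        show j + i + 1 - j = i + 1 by omega]
      push_cast
      ring

theorem hasExpansion_inv_pochhammer (N j : ℕ) : HasExpansion atTop invI N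
    (fun ν => ((ascPochhammer ℂ j).eval (1 + Complex.I * (ν : ℂ)))⁻¹)
    (fun _ => pochhammerSeries j) := by
  induction j with
  | zero =>
    have h := hasExpansion_const (l := atTop) (v := invI) (N := N) (c := fun _ => (1 : ℂ))
      (isBigO_const_const _ one_ne_zero _)
    have h2 := h.congr_coeff (q := fun _ => pochhammerSeries 0) fun ν k hk => by
      rw [pochhammerSeries, coeff_mk, coeff_C]
      rcases k with _ | k <;> simp
    simpa using h2
  | succ j ih =>
    have hf : HasExpansion atTop invI N (fun ν => 1 + ((j : ℂ) + 1) * invI ν)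
        (fun _ => 1 + C ((j : ℂ) + 1) * X) := by
      have h1 := hasExpansion_const (l := atTop) (v := invI) (N := N) (c := fun _ => (1 : ℂ))
        (isBigO_const_const _ one_ne_zero _)
      have h2 := (hasExpansion_var (N := N) invI_isBigO).const_mul invI_isBigO
        (c := fun _ => ((j : ℂ) + 1)) (isBigO_const_const _ one_ne_zero _)
      simpa using h1.add h2
    have hlim : Tendsto (fun ν => 1 + ((j : ℂ) + 1) * invI ν) atTop (𝓝 1) := by
      have := (tendsto_inv_I_mul.const_mul ((j : ℂ) + 1)).const_add 1
      simpa [invI] using this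
    have h := ih.mul invI_isBigO ((hasExpansion_var invI_isBigO).mul invI_isBigO
      (hf.inv invI_isBigO (fun _ => by simp) hlim))
    simp only [pochhammerSeries_succ]
    refine h.congr_left ?_
    filter_upwards [eventually_gt_atTop 0] with ν hν
    rw [ascPochhammer_succ_eval]
    have hI : Complex.I * (ν : ℂ) ≠ 0 :=
      mul_ne_zero Complex.I_ne_zero (by exact_mod_cast hν.ne')
    have h1 := one_add_I_mul_add_nat_ne ν j
    have h2 : (1 + ((j : ℂ) + 1) * invI ν) = (1 + Complex.I * ν + j) * invI ν := by
      have hc : (Complex.I * (ν : ℂ)) * invI ν = 1 := mul_inv_cancel₀ hI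
      linear_combination -hc
    have h3 : invI ν ≠ 0 := inv_ne_zero hI
    rw [h2, mul_inv, mul_inv]
    field_simp

theorem pow_le_norm_ascPochhammer {ν : ℝ} (hν : 0 ≤ ν) (k : ℕ) :
    ν ^ k ≤ ‖(ascPochhammer ℂ k).eval (1 + Complex.I * ν)‖ := by
  induction k with
  | zero => simp
  | succ k ih =>
    rw [ascPochhammer_succ_eval, norm_mul, pow_succ]
    have h2 : ν ≤ ‖1 + Complex.I * ν + (k : ℂ)‖ := by
      have : ν = (1 + Complex.I * ν + (k : ℂ)).im := by simp
      exact (le_of_eq this).trans (Complex.im_le_norm _)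
    exact mul_le_mul ih h2 hν (norm_nonneg _)

/-- The first `N` terms of the series are expanded separately; the tail is `O(ν^(-N))`. -/
theorem hasExpansion_besselS (w : ℝ) (N : ℕ) : HasExpansion atTop invI N
    (fun ν => besselS ν w) (fun _ => toComplex (mk (sumCoeff w))) := by
  have h1 : HasExpansion atTop invI N (fun ν => ∑ j ∈ Finset.range N,
      ((w : ℂ) ^ j / (j.factorial : ℂ)) *
        ((ascPochhammer ℂ j).eval (1 + Complex.I * (ν : ℂ)))⁻¹)
      (fun _ => ∑ j ∈ Finset.range N, C ((w : ℂ) ^ j / (j.factorial : ℂ)) * pochhammerSeries j) :=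
    HasExpansion.sum _ fun j _ => (hasExpansion_inv_pochhammer N j).const_mul invI_isBigO
      (isBigO_const_const _ one_ne_zero _)
  have h2 : HasExpansion atTop invI N (fun ν => besselS ν w)
      (fun _ => ∑ j ∈ Finset.range N, C ((w : ℂ) ^ j / (j.factorial : ℂ)) * pochhammerSeries j) := by
    refine h1.of_sub_isBigO ?_
    refine IsBigO.of_bound (∑' j : ℕ, |w| ^ (j + N) / ((j + N).factorial : ℝ)) ?_
    filter_upwards [eventually_ge_atTop 1] with ν hν
    have hν0 : 0 < ν := by linarith
    have hs := (summable_mul_pow (norm_sCoeff_le' ν) (w : ℂ)).of_norm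
    have e1 : besselS ν w - ∑ j ∈ Finset.range N, ((w : ℂ) ^ j / (j.factorial : ℂ)) *
        ((ascPochhammer ℂ j).eval (1 + Complex.I * (ν : ℂ)))⁻¹ =
        ∑' j : ℕ, sCoeff ν (j + N) * (w : ℂ) ^ (j + N) := by
      rw [besselS, ← hs.sum_add_tsum_nat_add N, sub_eq_iff_eq_add', add_left_inj]
      refine Finset.sum_congr rfl fun j _ => ?_
      rw [sCoeff, one_div, mul_inv, div_eq_mul_inv]
      ring
    rw [e1]
    have hsum : Summable (fun j : ℕ => |w| ^ (j + N) / ((j + N).factorial : ℝ)) :=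
      (summable_nat_add_iff N).2 (Real.summable_pow_div_factorial |w|)
    have hn : ‖invI ν ^ N‖ = (ν ^ N)⁻¹ := by
      rw [invI, norm_pow, norm_inv, norm_mul, Complex.norm_I, one_mul, Complex.norm_real,
        Real.norm_of_nonneg hν0.le, inv_pow]
    rw [← tsum_mul_right, hn]
    refine tsum_of_norm_bounded (hsum.mul_right _).hasSum fun j => ?_
    have h3 : ν ^ N ≤ ‖(ascPochhammer ℂ (j + N)).eval (1 + Complex.I * (ν : ℂ))‖ :=
      (pow_le_pow_right₀ hν (Nat.le_add_left N j)).trans (pow_le_norm_ascPochhammer hν0.le _)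
    have h4 : (0 : ℝ) < (j + N).factorial := by exact_mod_cast (j + N).factorial_pos
    rw [sCoeff, norm_mul, norm_div, norm_one, norm_mul, norm_pow, Complex.norm_real,
      Real.norm_eq_abs, Complex.norm_natCast]
    calc 1 / (((j + N).factorial : ℝ) * ‖(ascPochhammer ℂ (j + N)).eval
          (1 + Complex.I * (ν : ℂ))‖) * |w| ^ (j + N)
        ≤ 1 / (((j + N).factorial : ℝ) * ν ^ N) * |w| ^ (j + N) := by gcongr
      _ = _ := by field_simp
  refine h2.congr_coeff fun ν k hk => ?_
  rw [coeff_toComplex, coeff_mk, map_sum, sumCoeff]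
  have hs : Finset.range (k + 1) ⊆ Finset.range N := Finset.range_subset_range.2 hk
  rw [← Finset.sum_subset hs]
  · push_cast
    refine Finset.sum_congr rfl fun j _ => ?_
    rw [coeff_C_mul, pochhammerSeries, coeff_mk]
    ring
  · intro j _ hj
    have : k < j := by simpa using hj
    rw [coeff_C_mul, pochhammerSeries, coeff_mk, Nat.stirlingSecond_eq_zero_of_lt this]
    simp

/-- The exponential of minus `i` times the phase correction, apart from a positive factor. -/
noncomputable def phaseFactor (w ν : ℝ) : ℂ :=
  Complex.exp (-binetJ (Complex.I * ν)) * besselS ν w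

theorem hasExpansion_phaseFactor (x : ℝ) (N : ℕ) : HasExpansion atTop invI N
    (phaseFactor (x ^ 2 / 4)) (fun _ => toComplex (mk (aCoeff x))) := by
  refine ((hasExpansion_exp_neg_binetJ N).mul invI_isBigO
    (hasExpansion_besselS (x ^ 2 / 4) N)).congr_coeff fun ν k _ => ?_
  rw [coeff_toComplex, coeff_mk, aCoeff, coeff_mul,
    Finset.Nat.sum_antidiagonal_eq_sum_range_succ_mk]
  push_cast
  refine Finset.sum_congr rfl fun j _ => ?_
  simp [coeff_toComplex]

theorem neg_I_pow (k : ℕ) : (-Complex.I) ^ k =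
    if Even k then (((-1 : ℝ) ^ (k / 2) : ℝ) : ℂ) else -(((-1 : ℝ) ^ (k / 2) : ℝ) : ℂ) * Complex.I := by
  have h2 : (-Complex.I) ^ 2 = -1 := by simp
  split_ifs with h
  · obtain ⟨j, rfl⟩ := h
    rw [← two_mul, pow_mul, h2, Nat.mul_div_cancel_left j two_pos]
    push_cast; rfl
  · obtain ⟨j, rfl⟩ := Nat.not_even_iff_odd.1 h
    rw [pow_succ, pow_mul, h2, show (2 * j + 1) / 2 = j by omega]
    push_cast; ring

theorem invI_eq (ν : ℝ) : invI ν = -Complex.I * ((ν⁻¹ : ℝ) : ℂ) := by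
  rw [invI, mul_inv, Complex.inv_I]
  push_cast; rfl

theorem inv_isBigO : (fun ν : ℝ => ν⁻¹) =O[atTop] (fun _ => (1 : ℝ)) :=
  (tendsto_inv_atTop_zero (𝕜 := ℝ)).isBigO_one ℝ

theorem norm_invI (ν : ℝ) : ‖invI ν‖ = ‖ν⁻¹‖ := by
  rw [invI_eq, norm_mul, norm_neg, Complex.norm_I, one_mul, Complex.norm_real]

theorem hasExpansion_phaseFactor_re (x : ℝ) (N : ℕ) : HasExpansion atTop (fun ν : ℝ => ν⁻¹) N
    (fun ν => (phaseFactor (x ^ 2 / 4) ν).re) (fun _ => evenSeries x) := by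
  refine ⟨fun k _ => isBigO_const_const _ one_ne_zero _, ?_⟩
  have h := (hasExpansion_phaseFactor x N).2
  refine IsBigO.trans (IsBigO.of_bound 1 (Eventually.of_forall fun ν => ?_))
    (h.trans (IsBigO.of_bound 1 (Eventually.of_forall fun ν => ?_)))
  · rw [one_mul, Real.norm_eq_abs]
    refine le_trans (le_of_eq ?_) (Complex.abs_re_le_norm _)
    rw [Complex.sub_re, Complex.re_sum]
    congr 2
    refine Finset.sum_congr rfl fun k _ => ?_
    rw [coeff_toComplex, coeff_mk, invI_eq, mul_pow, neg_I_pow, coeff_evenSeries,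
      Complex.re_ofReal_mul, ← Complex.ofReal_pow, Complex.re_mul_ofReal]
    split_ifs with hk
    · rw [Complex.ofReal_re]; ring
    · rw [← Complex.ofReal_neg, Complex.re_ofReal_mul]; simp
  · rw [one_mul, norm_pow, norm_pow, norm_invI]

theorem hasExpansion_phaseFactor_im (x : ℝ) (N : ℕ) : HasExpansion atTop (fun ν : ℝ => ν⁻¹) N
    (fun ν => -(phaseFactor (x ^ 2 / 4) ν).im) (fun _ => oddSeries x) := by
  refine ⟨fun k _ => isBigO_const_const _ one_ne_zero _, ?_⟩
  have h := (hasExpansion_phaseFactor x N).2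
  refine IsBigO.trans (IsBigO.of_bound 1 (Eventually.of_forall fun ν => ?_))
    (h.trans (IsBigO.of_bound 1 (Eventually.of_forall fun ν => ?_)))
  · rw [one_mul, Real.norm_eq_abs]
    refine le_trans (le_of_eq ?_) (Complex.abs_im_le_norm _)
    rw [Complex.sub_im, Complex.im_sum, ← abs_neg, neg_sub, sub_neg_eq_add, add_comm,
      ← sub_neg_eq_add, ← Finset.sum_neg_distrib]
    congr 2
    refine Finset.sum_congr rfl fun k _ => ?_
    rw [coeff_toComplex, coeff_mk, invI_eq, mul_pow, neg_I_pow, coeff_oddSeries,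
      Complex.im_ofReal_mul, ← Complex.ofReal_pow, Complex.im_mul_ofReal]
    split_ifs with hk
    · rw [Complex.ofReal_im]; ring
    · rw [← Complex.ofReal_neg, Complex.im_ofReal_mul]; simp; ring
  · rw [one_mul, norm_pow, norm_pow, norm_invI]

/-- The correction `ε` in `-besselPhase = ν log (λ ν) + π/4 + ε`, given as a difference of continuous
arguments and not as an arctangent, so that no branch has to be chosen. -/
noncomputable def phaseCorrection (w ν : ℝ) : ℝ :=
  (binetJ (Complex.I * ν)).im - (besselLog ν w).im

theorem tendsto_phaseCorrection {w : ℝ} (hw : 0 ≤ w) :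
    Tendsto (phaseCorrection w) atTop (𝓝 0) := by
  have := ((Complex.continuous_im.tendsto _).comp tendsto_binetJ).sub
    ((Complex.continuous_im.tendsto _).comp (tendsto_besselLog_atTop hw))
  unfold phaseCorrection
  simpa [Function.comp_def] using this

theorem phaseFactor_eq_exp {w : ℝ} (hw : 0 ≤ w) (ν : ℝ) :
    phaseFactor w ν = Complex.exp (besselLog ν w - binetJ (Complex.I * ν)) := by
  rw [phaseFactor, besselS_eq_exp_besselLog ν hw, ← Complex.exp_add]
  ring_nf

theorem tendsto_phaseFactor {w : ℝ} (hw : 0 ≤ w) : Tendsto (phaseFactor w) atTop (𝓝 1) := by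
  have := (Complex.continuous_exp.tendsto _).comp ((tendsto_besselLog_atTop hw).sub tendsto_binetJ)
  rw [sub_zero, Complex.exp_zero] at this
  exact this.congr fun ν => (phaseFactor_eq_exp hw ν).symm

theorem phaseCorrection_eq_arctan {w : ℝ} (hw : 0 ≤ w) : ∀ᶠ ν in atTop,
    phaseCorrection w ν = Real.arctan (-(phaseFactor w ν).im * ((phaseFactor w ν).re)⁻¹) := by
  have h := tendsto_phaseCorrection hw
  have hpi := Real.pi_pos
  filter_upwards [h.eventually_const_lt (by linarith : -(Real.pi / 2) < 0),
    h.eventually_lt_const (by linarith : (0 : ℝ) < Real.pi / 2)] with ν h1 h2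
  have h3 : (besselLog ν w - binetJ (Complex.I * ν)).im = -phaseCorrection w ν := by
    simp [phaseCorrection]
  rw [phaseFactor_eq_exp hw, Complex.exp_im, Complex.exp_re, h3, Real.sin_neg, Real.cos_neg,
    mul_neg, neg_neg, ← div_eq_mul_inv, mul_div_mul_left _ _ (Real.exp_ne_zero _),
    ← Real.tan_eq_sin_div_cos, Real.arctan_tan h1 h2]

/-- The Taylor coefficients of the arctangent. -/
noncomputable def arctanCoeff (j : ℕ) : ℝ := if Even j then 0 else (-1 : ℝ) ^ (j / 2) / j

theorem sum_arctanCoeff_mul {R : Type*} [AddCommMonoid R] (f : ℕ → R) (hf : ∀ j, Even j → f j = 0)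
    (N : ℕ) : ∑ j ∈ Finset.range (2 * N + 1), f j = ∑ i ∈ Finset.range N, f (2 * i + 1) := by
  induction N with
  | zero => simp [hf 0 Even.zero]
  | succ N ih =>
    rw [show 2 * (N + 1) + 1 = 2 * N + 1 + 1 + 1 by ring, Finset.sum_range_succ,
      Finset.sum_range_succ, ih, Finset.sum_range_succ, hf (2 * N + 1 + 1) ⟨N + 1, by ring⟩, add_zero]

/-- Taylor's formula, from the geometric sum for the derivative `1 / (1+z²)`. -/
theorem arctan_sub_sum_isBigO (N : ℕ) :
    (fun y : ℝ => Real.arctan y - ∑ j ∈ Finset.range (2 * N + 1), arctanCoeff j * y ^ j) =O[𝓝 0]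
      (fun y => y ^ (2 * N + 1)) := by
  refine IsBigO.of_bound 1 (Eventually.of_forall fun y => ?_)
  set f : ℝ → ℝ := fun y => Real.arctan y -
    ∑ i ∈ Finset.range N, (-1 : ℝ) ^ i / (2 * i + 1 : ℕ) * y ^ (2 * i + 1) with hf
  have hf' : ∀ z, HasDerivAt f ((-z ^ 2) ^ N / (1 + z ^ 2)) z := by
    intro z
    have h1 := (Real.hasDerivAt_arctan z).sub (HasDerivAt.fun_sum (u := Finset.range N)
      fun i _ => (hasDerivAt_pow (2 * i + 1) z).const_mul ((-1 : ℝ) ^ i / (2 * i + 1 : ℕ)))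
    convert! h1 using 1
    have h2 : ∀ i : ℕ, (-1 : ℝ) ^ i / (2 * i + 1 : ℕ) * (((2 * i + 1 : ℕ) : ℝ) *
        z ^ (2 * i + 1 - 1)) = (-z ^ 2) ^ i := by
      intro i
      have : ((2 * i + 1 : ℕ) : ℝ) ≠ 0 := by positivity
      rw [Nat.add_sub_cancel, neg_pow (z ^ 2), pow_mul]
      field_simp
    simp only [h2]
    have h3 := mul_neg_geom_sum (-z ^ 2) N
    have h4 : (1 + z ^ 2) ≠ 0 := by positivity
    rw [eq_sub_iff_add_eq]
    field_simp
    linear_combination h3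
  have hb := Convex.norm_image_sub_le_of_norm_hasDerivWithin_le (s := Set.Icc (-|y|) |y|)
    (f := f) (C := |y| ^ (2 * N)) (fun z _ => (hf' z).hasDerivWithinAt) (fun z hz => by
      rw [norm_div, norm_pow, norm_neg, norm_pow, ← pow_mul, Real.norm_eq_abs, Real.norm_eq_abs,
        abs_of_pos (by positivity : 0 < 1 + z ^ 2)]
      refine (div_le_self (by positivity) (by nlinarith [sq_nonneg z])).trans ?_
      have := abs_le.2 hz
      gcongr) (convex_Icc _ _) (x := 0) (y := y) (by simp) (by simp [neg_abs_le, le_abs_self])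
  have h0 : f 0 = 0 := by simp [hf]
  rw [h0, sub_zero, sub_zero] at hb
  have hfy : f y = Real.arctan y - ∑ j ∈ Finset.range (2 * N + 1), arctanCoeff j * y ^ j := by
    rw [sum_arctanCoeff_mul (fun j => arctanCoeff j * y ^ j)
      (fun j hj => by simp [arctanCoeff, hj])]
    simp only [hf]
    congr 1
    refine Finset.sum_congr rfl fun i _ => ?_
    have : ¬ Even (2 * i + 1) := by simp
    rw [arctanCoeff, if_neg this, show (2 * i + 1) / 2 = i by omega]
  rw [← hfy, one_mul, norm_pow, pow_succ]
  exact hb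

/-- Odd powers of the quotient are odd series. -/
theorem coeff_tangentSeries_pow_even (x : ℝ) (i k : ℕ) :
    coeff (2 * k) (tangentSeries x ^ (2 * i + 1)) = 0 := by
  have he : rescale (-1 : ℝ) (evenSeries x) = evenSeries x := by
    ext j
    rw [coeff_rescale, coeff_evenSeries]
    split_ifs with h
    · rw [h.neg_one_pow, one_mul]
    · simp
  have ho : rescale (-1 : ℝ) (oddSeries x) = -oddSeries x := by
    ext j
    rw [coeff_rescale, map_neg, coeff_oddSeries]
    split_ifs with h
    · simp
    · rw [(Nat.not_even_iff_odd.1 h).neg_one_pow]; ring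
  have h1 : constantCoeff (evenSeries x) ≠ 0 := by
    rw [constantCoeff_evenSeries]; exact one_ne_zero
  have hi : rescale (-1 : ℝ) (evenSeries x)⁻¹ = (evenSeries x)⁻¹ := by
    rw [PowerSeries.eq_inv_iff_mul_eq_one h1]
    conv_lhs => rw [← he]
    rw [← map_mul, he, PowerSeries.inv_mul_cancel _ h1, map_one]
  have ht : rescale (-1 : ℝ) (tangentSeries x ^ (2 * i + 1)) =
      -(tangentSeries x ^ (2 * i + 1)) := by
    rw [map_pow, tangentSeries, map_mul, ho, hi, neg_mul, Odd.neg_pow ⟨i, rfl⟩]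
  have h2 := congrArg (coeff (2 * k)) ht
  rw [coeff_rescale, map_neg, pow_mul] at h2
  norm_num at h2
  linarith

theorem constantCoeff_tangentSeries (x : ℝ) : constantCoeff (tangentSeries x) = 0 := by
  rw [tangentSeries, map_mul, constantCoeff_oddSeries, zero_mul]

/-- The expansion of the phase correction, `ε ~ A₀/ν + A₁/ν³ + ⋯`. -/
theorem phaseCorrection_isBigO (x : ℝ) (N : ℕ) :
    (fun ν : ℝ => phaseCorrection (x ^ 2 / 4) ν -
      ∑ i ∈ Finset.range N, ACoeff x i * (ν⁻¹) ^ (2 * i + 1)) =O[atTop]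
      (fun ν : ℝ => (ν⁻¹) ^ (2 * N + 1)) := by
  have hw : 0 ≤ x ^ 2 / 4 := by positivity
  set T : ℝ → ℝ := fun ν => -(phaseFactor (x ^ 2 / 4) ν).im *
    ((phaseFactor (x ^ 2 / 4) ν).re)⁻¹ with hT
  have hre : Tendsto (fun ν => (phaseFactor (x ^ 2 / 4) ν).re) atTop (𝓝 1) := by
    have := (Complex.continuous_re.tendsto _).comp (tendsto_phaseFactor hw)
    simpa [Function.comp_def] using this
  have hTexp : ∀ M, HasExpansion atTop (fun ν : ℝ => ν⁻¹) M T (fun _ => tangentSeries x) :=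
    fun M => (hasExpansion_phaseFactor_im x M).mul inv_isBigO
      ((hasExpansion_phaseFactor_re x M).inv inv_isBigO (fun _ => constantCoeff_evenSeries x) hre)
  have hTO : T =O[atTop] (fun ν : ℝ => ν⁻¹) := by
    have := (hTexp 1).2
    simpa [constantCoeff_tangentSeries] using this
  have hT0 : Tendsto T atTop (𝓝 0) := hTO.trans_tendsto tendsto_inv_atTop_zero
  have hE := ((hTexp (2 * N + 1)).comp inv_isBigO hTO arctanCoeff
    (g := fun ν => Real.arctan (T ν))
    ((arctan_sub_sum_isBigO N).comp_tendsto hT0)).2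
  refine (hE.congr' ?_ (EventuallyEq.refl _ _))
  filter_upwards [phaseCorrection_eq_arctan hw] with ν hν
  have hser : ∑ j ∈ Finset.range (2 * N + 1), C (arctanCoeff j) * tangentSeries x ^ j =
      ∑ i ∈ Finset.range N, C ((-1 : ℝ) ^ i / (2 * (i : ℝ) + 1)) *
        tangentSeries x ^ (2 * i + 1) := by
    rw [sum_arctanCoeff_mul (fun j => C (arctanCoeff j) * tangentSeries x ^ j)
      (fun j hj => by simp [arctanCoeff, hj])]
    refine Finset.sum_congr rfl fun i _ => ?_
    have : ¬ Even (2 * i + 1) := by simp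
    rw [arctanCoeff, if_neg this, show (2 * i + 1) / 2 = i by omega]
    push_cast
    rfl
  rw [hν]
  congr 1
  rw [sum_arctanCoeff_mul]
  · refine Finset.sum_congr rfl fun k hk => ?_
    have hk' := Finset.mem_range.1 hk
    congr 1
    rw [hser, ACoeff, ← tangentSeries]
    have hs : Finset.range (k + 1) ⊆ Finset.range N := Finset.range_subset_range.2 hk'
    rw [map_sum, map_sum]
    symm
    refine Finset.sum_subset hs fun i _ hi => ?_
    have hi' : k < i := by simpa using hi
    rw [coeff_C_mul, coeff_pow_eq_zero_of_lt (constantCoeff_tangentSeries x) (by omega), mul_zero]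
  · intro j hj
    obtain ⟨k, rfl⟩ := hj
    rw [hser, ← two_mul, map_sum, Finset.sum_eq_zero, zero_mul]
    intro i _
    rw [coeff_C_mul, coeff_tangentSeries_pow_even, mul_zero]

end PhaseExpansion

/-! ### Inversion of the equation for the zeros -/

section Inversion

theorem lam_pos {x : ℝ} (hx : 0 < x) : 0 < lam x := by unfold lam; positivity

theorem log_lam {x : ℝ} (hx : 0 < x) : Real.log (lam x) = -1 - Real.log (x / 2) := by
  rw [lam, Real.log_div two_ne_zero (by positivity), Real.log_mul (Real.exp_ne_zero _) hx.ne',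
    Real.log_exp, Real.log_div hx.ne' two_ne_zero]
  ring

/-- At a zero the left side is `nπ`, so that `ν log (λν) + ε(ν) = (n - 1/4) π`. -/
theorem neg_besselPhase_eq {x ν : ℝ} (hx : 0 < x) (hν : 0 < ν) :
    -besselPhase ν ((x / 2) ^ 2) =
      ν * Real.log (lam x * ν) + Real.pi / 4 + phaseCorrection (x ^ 2 / 4) ν := by
  rw [besselPhase, gammaPhase, phaseCorrection, Real.log_mul (lam_pos hx).ne' hν.ne', log_lam hx,
    Real.log_pow, show (x / 2) ^ 2 = x ^ 2 / 4 by ring]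
  push_cast
  ring

theorem log_lam_mul_xi {x m : ℝ} (hx : 0 < x) (hm : 0 < m) :
    0 < xi x m ∧ Real.log (lam x * xi x m) = lambertW (lam x * m) ∧
      xi x m * lambertW (lam x * m) = m := by
  obtain ⟨h1, h2⟩ := lambertW_spec (mul_pos (lam_pos hx) hm)
  refine ⟨div_pos hm h1, ?_, div_mul_cancel₀ m h1.ne'⟩
  have : lam x * xi x m = Real.exp (lambertW (lam x * m)) := by
    rw [xi, ← mul_div_assoc, div_eq_iff h1.ne']
    linear_combination -h2
  rw [this, Real.log_exp]

theorem tendsto_lambertW : Tendsto lambertW atTop atTop := by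
  refine tendsto_atTop.2 fun c => ?_
  filter_upwards [eventually_gt_atTop 0, eventually_gt_atTop (|c| * Real.exp |c|)] with z hz hzc
  obtain ⟨h1, h2⟩ := lambertW_spec hz
  by_contra hlt
  have h3 : lambertW z ≤ |c| := (not_le.1 hlt).le.trans (le_abs_self c)
  have : z ≤ |c| * Real.exp |c| := by
    rw [← h2]
    gcongr
  linarith

theorem tendsto_log_div_lambertW : Tendsto (fun z => Real.log z / lambertW z) atTop (𝓝 1) := by
  have h1 : Tendsto (fun z => Real.log (lambertW z) / lambertW z) atTop (𝓝 0) :=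
    Real.isLittleO_log_id_atTop.tendsto_div_nhds_zero.comp tendsto_lambertW
  have h2 := h1.add_const 1
  rw [zero_add] at h2
  refine h2.congr' ?_
  filter_upwards [eventually_gt_atTop 0] with z hz
  obtain ⟨h3, h4⟩ := lambertW_spec hz
  conv_rhs => rw [← h4, Real.log_mul h3.ne' (Real.exp_ne_zero _), Real.log_exp, h4]
  field_simp

/-- The function `ν ↦ ν log (λν)` is expanding at the rate of its derivative at the left end. -/
theorem mul_abs_sub_le_abs_mul_log_sub {r a b c : ℝ} (hr : 0 < r) (hc : 0 < c) (ha : c ≤ a)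
    (hb : c ≤ b) :
    (1 + Real.log (r * c)) * |a - b| ≤ |a * Real.log (r * a) - b * Real.log (r * b)| := by
  wlog hab : b ≤ a generalizing a b
  · rw [abs_sub_comm a b, abs_sub_comm (a * _)]
    exact this hb ha (not_le.1 hab).le
  have hb0 : 0 < b := hc.trans_le hb
  have ha0 : 0 < a := hc.trans_le ha
  have h1 : Real.log b - Real.log a ≤ b / a - 1 := by
    rw [← Real.log_div hb0.ne' ha0.ne']
    exact Real.log_le_sub_one_of_pos (by positivity)
  have h2 : a * (Real.log b - Real.log a) ≤ b - a := by
    calc a * (Real.log b - Real.log a) ≤ a * (b / a - 1) := by gcongr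
      _ = b - a := by field_simp
  have h3 : Real.log (r * c) ≤ Real.log (r * b) := by gcongr
  rw [abs_of_nonneg (sub_nonneg.2 hab)]
  refine le_trans ?_ (le_abs_self _)
  rw [Real.log_mul hr.ne' hc.ne', Real.log_mul hr.ne' hb0.ne'] at h3
  rw [Real.log_mul hr.ne' hc.ne', Real.log_mul hr.ne' hb0.ne', Real.log_mul hr.ne' ha0.ne']
  nlinarith [mul_le_mul_of_nonneg_right h3 (sub_nonneg.2 hab)]

theorem abs_inv_pow_sub_le {a b : ℝ} (ha : 1 ≤ a) (hb : 1 ≤ b) (j : ℕ) :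
    |(a⁻¹) ^ j - (b⁻¹) ^ j| ≤ j * |a - b| := by
  have h1 : |a⁻¹ - b⁻¹| ≤ |a - b| := by
    have ha0 : a ≠ 0 := by positivity
    have hb0 : b ≠ 0 := by positivity
    rw [inv_sub_inv ha0 hb0, abs_div, abs_sub_comm b a, abs_of_pos (by positivity : 0 < a * b)]
    exact div_le_self (abs_nonneg _) (by nlinarith)
  have h2 : |a⁻¹| ≤ 1 := by
    rw [abs_of_nonneg (by positivity)]; exact inv_le_one_of_one_le₀ ha
  have h3 : |b⁻¹| ≤ 1 := by
    rw [abs_of_nonneg (by positivity)]; exact inv_le_one_of_one_le₀ hb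
  induction j with
  | zero => simp
  | succ j ih =>
    have : (a⁻¹) ^ (j + 1) - (b⁻¹) ^ (j + 1) =
        ((a⁻¹) ^ j - (b⁻¹) ^ j) * a⁻¹ + (b⁻¹) ^ j * (a⁻¹ - b⁻¹) := by ring
    rw [this]
    refine (abs_add_le _ _).trans ?_
    rw [abs_mul, abs_mul, abs_pow]
    push_cast
    have h4 := mul_le_mul ih h2 (abs_nonneg _) (by positivity)
    have h5 := mul_le_mul (pow_le_one₀ (n := j) (abs_nonneg _) h3) h1 (abs_nonneg _) zero_le_one
    linarith

/-- The product of `1 + y` with a Taylor polynomial of `log (1 + y)`, in closed form. -/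
theorem one_add_mul_log_taylor (y : ℝ) (n : ℕ) :
    (1 + y) * (-∑ i ∈ Finset.range (n + 1), (-y) ^ (i + 1) / ((i : ℝ) + 1)) - y =
      ∑ j ∈ Finset.Icc 2 (n + 1), (-1 : ℝ) ^ j / ((j : ℝ) * ((j : ℝ) - 1)) * y ^ j +
        (-1 : ℝ) ^ n * y ^ (n + 2) / ((n : ℝ) + 1) := by
  induction n with
  | zero => simp; ring
  | succ n ih =>
    rw [Finset.sum_range_succ, ← Finset.insert_Icc_right_eq_Icc_add_one (by omega),
      Finset.sum_insert (by simp), neg_add, mul_add, add_sub_right_comm, ih]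
    have h1 : (n : ℝ) + 1 ≠ 0 := by positivity
    have h2 : (n : ℝ) + 2 ≠ 0 := by positivity
    rw [neg_pow y]
    push_cast
    rw [show (n : ℝ) + 1 + 1 - 1 = n + 1 by ring, show (n : ℝ) + 1 + 1 = n + 2 by ring]
    field_simp
    ring

theorem one_add_mul_log_isBigO (n : ℕ) :
    (fun y : ℝ => (1 + y) * Real.log (1 + y) - y -
      ∑ j ∈ Finset.Icc 2 (n + 1), (-1 : ℝ) ^ j / ((j : ℝ) * ((j : ℝ) - 1)) * y ^ j) =O[𝓝 0]
      (fun y => y ^ (n + 1)) := by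
  refine IsBigO.of_bound 4 ?_
  filter_upwards [Metric.ball_mem_nhds (0 : ℝ) (by norm_num : (0 : ℝ) < 1 / 2)] with y hy
  have hy' : |y| < 1 / 2 := by simpa using hy
  have h1 := Real.abs_log_sub_add_sum_range_le (x := -y) (by rw [abs_neg]; linarith) (n + 1)
  rw [abs_neg, sub_neg_eq_add] at h1
  have h2 := one_add_mul_log_taylor y n
  set S := ∑ i ∈ Finset.range (n + 1), (-y) ^ (i + 1) / ((i : ℝ) + 1)
  set P := ∑ j ∈ Finset.Icc 2 (n + 1), (-1 : ℝ) ^ j / ((j : ℝ) * ((j : ℝ) - 1)) * y ^ j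
  have h3 : (1 + y) * Real.log (1 + y) - y - P = (1 + y) * (S + Real.log (1 + y)) +
      (-1 : ℝ) ^ n * y ^ (n + 2) / ((n : ℝ) + 1) := by linear_combination h2
  have h4 : |y| ^ (n + 2) ≤ |y| ^ (n + 1) * (1 / 2) := by
    rw [pow_succ]; gcongr
  have h5 : |S + Real.log (1 + y)| ≤ |y| ^ (n + 1) := by
    refine h1.trans ?_
    rw [div_le_iff₀ (by linarith)]
    have : 0 ≤ |y| ^ (n + 1) := by positivity
    nlinarith [this]
  have h6 : |(-1 : ℝ) ^ n * y ^ (n + 2) / ((n : ℝ) + 1)| ≤ |y| ^ (n + 1) := by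
    rw [abs_div, abs_mul, abs_pow, abs_pow, abs_neg, abs_one, one_pow, one_mul,
      abs_of_pos (by positivity : (0 : ℝ) < n + 1)]
    refine (div_le_self (by positivity) (by linarith [n.cast_nonneg (α := ℝ)])).trans ?_
    have : 0 ≤ |y| ^ (n + 1) := by positivity
    linarith
  have h7 : |1 + y| ≤ 2 := by
    rw [abs_le]; rw [abs_lt] at hy'; constructor <;> linarith
  rw [h3, norm_pow, Real.norm_eq_abs, Real.norm_eq_abs]
  refine (abs_add_le _ _).trans ?_
  rw [abs_mul]
  have h8 := mul_le_mul h7 h5 (abs_nonneg _) (by norm_num)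
  have : 0 ≤ |y| ^ (n + 1) := by positivity
  linarith

section Remainder

open PowerSeries

variable {ι : Type*} {l : Filter ι} {v δ : ι → ℝ} {p : ι → PowerSeries ℝ} {N : ℕ}

theorem hasExpansion_formalRemainder (x : ℝ) (K : ℕ) (hv : v =O[l] (fun _ => (1 : ℝ)))
    (hδ : HasExpansion l v N δ p) (hp : ∀ i, constantCoeff (p i) = 0) (hδ0 : Tendsto δ l (𝓝 0)) :
    HasExpansion l v N (fun i => ∑ j ∈ Finset.Icc 2 (K + 1),
        (-1 : ℝ) ^ j / ((j : ℝ) * ((j : ℝ) - 1)) * δ i ^ j +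
      ∑ k ∈ Finset.range (K + 1), ACoeff x k * v i ^ (k + 1) * ((1 + δ i)⁻¹) ^ (2 * k + 1))
      (fun i => formalRemainder x K (p i)) := by
  have hone : HasExpansion l v N (fun i => 1 + δ i) (fun i => 1 + p i) := by
    simpa using (hasExpansion_const (c := fun _ => (1 : ℝ))
      (isBigO_const_const _ one_ne_zero _)).add hδ
  have hinv := hone.inv hv (fun i => by simp [hp i]) (by simpa using hδ0.const_add 1)
  exact (HasExpansion.sum _ fun j _ => (hδ.pow hv j).const_mul hv
      (isBigO_const_const _ one_ne_zero _)).add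
    (HasExpansion.sum _ fun k _ => (((hasExpansion_var hv).pow hv (k + 1)).const_mul hv
      (isBigO_const_const _ one_ne_zero _)).mul hv (hinv.pow hv (2 * k + 1)))

/-- The value of the truncated formal solution `b₀ v + ⋯ + b_{N-1} v^N`. -/
noncomputable def deltaSum (x q v : ℝ) (N : ℕ) : ℝ :=
  ∑ j ∈ Finset.range N, bCoeff x q j * v ^ (j + 1)

theorem hasExpansion_deltaSum (x : ℝ) {q : ι → ℝ} (hv : v =O[l] (fun _ => (1 : ℝ))) (K : ℕ)
    (hb : ∀ j < K, (fun i => bCoeff x (q i) j) =O[l] (fun _ => (1 : ℝ))) :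
    HasExpansion l v N (fun i => deltaSum x (q i) (v i) K) (fun i => deltaSeries x (q i) K) :=
  HasExpansion.sum _ fun j hj => ((hasExpansion_var hv).pow hv (j + 1)).const_mul hv
    (hb j (Finset.mem_range.1 hj))

theorem deltaSum_isBigO (x : ℝ) {q : ι → ℝ} (hv : v =O[l] (fun _ => (1 : ℝ))) (K : ℕ)
    (hb : ∀ j < K, (fun i => bCoeff x (q i) j) =O[l] (fun _ => (1 : ℝ))) :
    (fun i => deltaSum x (q i) (v i) K) =O[l] v := by
  refine IsBigO.fun_sum fun j hj => ?_
  have h := (hb j (Finset.mem_range.1 hj)).mul (pow_isBigO_pow hv (Nat.le_add_left 1 j))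
  simpa using h

/-- The `b_k` are bounded as functions of `q > 0`, since `0 < q / (1 + q) < 1` in their
recursion. -/
theorem bCoeff_isBigO_one (x : ℝ) {q : ι → ℝ} (hq : ∀ᶠ i in l, 0 < q i) (k : ℕ) :
    (fun i => bCoeff x (q i) k) =O[l] (fun _ => (1 : ℝ)) := by
  induction k using Nat.strong_induction_on with
  | _ k ih =>
    -- The bounds for the coefficients do not involve the small quantity, for which `0` is taken.
    have hv : (fun _ : ι => (0 : ℝ)) =O[l] (fun _ => (1 : ℝ)) := isBigO_zero _ _
    have h0 := (deltaSum_isBigO x hv k ih).trans_tendsto tendsto_const_nhds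
    have h := (hasExpansion_formalRemainder x k hv
      (hasExpansion_deltaSum (N := k + 2) x hv k ih)
      (fun i => constantCoeff_deltaSeries x (q i) k) h0).1 (k + 1) (by omega)
    have h2 : (fun i => -(q i / (1 + q i))) =O[l] (fun _ => (1 : ℝ)) := by
      refine IsBigO.of_bound 1 ?_
      filter_upwards [hq] with i hi
      rw [norm_neg, Real.norm_of_nonneg (by positivity), norm_one, mul_one]
      exact div_le_one_of_le₀ (by linarith) (by positivity)
    have h3 := h2.mul h
    simp only [mul_one] at h3
    exact h3.congr_left fun i => (bCoeff_eq x (q i) k).symm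

/-- The truncated formal solution satisfies the equation for `δ` up to the order of the first
omitted term. -/
theorem residual_isBigO (x : ℝ) {q : ι → ℝ} (hq : ∀ᶠ i in l, 0 < q i) (hv : Tendsto v l (𝓝 0))
    (N : ℕ) :
    (fun i => (1 + q i) / q i * deltaSum x (q i) (v i) N +
      ((1 + deltaSum x (q i) (v i) N) * Real.log (1 + deltaSum x (q i) (v i) N) -
        deltaSum x (q i) (v i) N) +
      ∑ k ∈ Finset.range (N + 1), ACoeff x k * v i ^ (k + 1) *
        ((1 + deltaSum x (q i) (v i) N)⁻¹) ^ (2 * k + 1)) =O[l] (fun i => v i ^ (N + 1)) := by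
  have hv1 := hv.isBigO_one ℝ
  have hb : ∀ j < N, (fun i => bCoeff x (q i) j) =O[l] (fun _ => (1 : ℝ)) :=
    fun j _ => bCoeff_isBigO_one x hq j
  have hδO := deltaSum_isBigO x hv1 N hb
  have hδ0 := hδO.trans_tendsto hv
  have h1 := (hasExpansion_formalRemainder x N hv1
      (hasExpansion_deltaSum (N := N + 1) x hv1 N hb)
      (fun i => constantCoeff_deltaSeries x (q i) N) hδ0).2
  have h2 := ((one_add_mul_log_isBigO N).comp_tendsto hδ0).trans (hδO.pow (N + 1))
  refine (h1.add h2).congr' ?_ (EventuallyEq.refl _ _)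
  filter_upwards [hq] with i hi
  have h3 : ∑ k ∈ Finset.range (N + 1), coeff k (formalRemainder x N (deltaSeries x (q i) N)) *
      v i ^ k = -((1 + q i) / q i * deltaSum x (q i) (v i) N) := by
    rw [Finset.sum_range_succ', coeff_zero_eq_constantCoeff_apply,
      constantCoeff_formalRemainder x N (constantCoeff_deltaSeries x (q i) N), zero_mul, add_zero,
      deltaSum, Finset.mul_sum, ← Finset.sum_neg_distrib]
    refine Finset.sum_congr rfl fun k hk => ?_
    rw [coeff_formalRemainder_deltaSeries x hi (Finset.mem_range.1 hk)]
    ring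
  rw [h3, Function.comp_apply]
  ring

end Remainder

end Inversion

/-! ### The expansion of the zeros -/

section ZeroExpansion

variable {ι : Type*} {l : Filter ι} {ν m : ι → ℝ} {x : ℝ}

theorem tendsto_lambertW_lam_mul (hx : 0 < x) (hm : Tendsto m l atTop) :
    Tendsto (fun i => lambertW (lam x * m i)) l atTop :=
  tendsto_lambertW.comp (hm.const_mul_atTop (lam_pos hx))

theorem tendsto_xi (hx : 0 < x) (hm : Tendsto m l atTop) :
    Tendsto (fun i => xi x (m i)) l atTop := by
  have h := (Real.tendsto_exp_atTop.comp (tendsto_lambertW_lam_mul hx hm)).const_mul_atTop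
    (inv_pos.2 (lam_pos hx))
  refine h.congr' ?_
  filter_upwards [hm.eventually_gt_atTop 0] with i hi
  obtain ⟨h1, h2, -⟩ := log_lam_mul_xi hx hi
  rw [Function.comp_apply, ← h2, Real.exp_log (mul_pos (lam_pos hx) h1), inv_mul_cancel_left₀
    (lam_pos hx).ne']

/-- The difference between the root and the leading term tends to zero, because the correction
does and the function `ν ↦ ν log (λν)` expands distances. -/
theorem tendsto_sub_xi (hx : 0 < x) (hm : Tendsto m l atTop) (hν : Tendsto ν l atTop)
    (heq : ∀ᶠ i in l, ν i * Real.log (lam x * ν i) + phaseCorrection (x ^ 2 / 4) (ν i) = m i) :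
    Tendsto (fun i => ν i - xi x (m i)) l (𝓝 0) := by
  have hε := ((tendsto_phaseCorrection (w := x ^ 2 / 4) (by positivity)).comp hν).norm
  rw [norm_zero] at hε
  refine squeeze_zero_norm' ?_ hε
  have hl := lam_pos hx
  filter_upwards [hm.eventually_gt_atTop 0, heq, hν.eventually_ge_atTop (lam x)⁻¹,
    (tendsto_xi hx hm).eventually_ge_atTop (lam x)⁻¹] with i h1 h2 h3 h4
  obtain ⟨-, h5, h6⟩ := log_lam_mul_xi hx h1
  have h7 := mul_abs_sub_le_abs_mul_log_sub hl (inv_pos.2 hl) h3 h4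
  rw [mul_inv_cancel₀ hl.ne', Real.log_one, add_zero, one_mul, h5, h6,
    show ν i * Real.log (lam x * ν i) - m i = -phaseCorrection (x ^ 2 / 4) (ν i) by
      linear_combination h2, abs_neg] at h7
  exact h7

theorem tendsto_div_xi (hx : 0 < x) (hm : Tendsto m l atTop) (hν : Tendsto ν l atTop)
    (heq : ∀ᶠ i in l, ν i * Real.log (lam x * ν i) + phaseCorrection (x ^ 2 / 4) (ν i) = m i) :
    Tendsto (fun i => ν i / xi x (m i)) l (𝓝 1) := by
  have hξ := tendsto_xi hx hm
  have h := ((tendsto_sub_xi hx hm hν heq).div_atTop hξ).add_const 1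
  rw [zero_add] at h
  refine h.congr' ?_
  filter_upwards [hξ.eventually_gt_atTop 0] with i hi
  field_simp
  ring

/-- The partial sums of the expansion of the correction are Lipschitz continuous away from `0`. -/
theorem abs_sum_ACoeff_sub_le (x : ℝ) (M : ℕ) : ∃ K, 0 ≤ K ∧ ∀ a b : ℝ, 1 ≤ a → 1 ≤ b →
    |∑ k ∈ Finset.range M, ACoeff x k * (a⁻¹) ^ (2 * k + 1) -
      ∑ k ∈ Finset.range M, ACoeff x k * (b⁻¹) ^ (2 * k + 1)| ≤ K * |a - b| := by
  refine ⟨∑ k ∈ Finset.range M, |ACoeff x k| * ((2 * k + 1 : ℕ) : ℝ),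
    Finset.sum_nonneg fun k _ => by positivity, fun a b ha hb => ?_⟩
  rw [← Finset.sum_sub_distrib, Finset.sum_mul]
  refine (Finset.abs_sum_le_sum_abs _ _).trans (Finset.sum_le_sum fun k _ => ?_)
  rw [← mul_sub, abs_mul, mul_assoc]
  exact mul_le_mul_of_nonneg_left (abs_inv_pow_sub_le ha hb _) (abs_nonneg _)

theorem mul_inv_sq_pow {a : ℝ} (ha : a ≠ 0) (k : ℕ) :
    a * ((a⁻¹) ^ 2) ^ (k + 1) = (a⁻¹) ^ (2 * k + 1) := by
  rw [← pow_mul, show 2 * (k + 1) = 2 * k + 1 + 1 by ring, pow_succ, mul_left_comm,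
    mul_inv_cancel₀ ha, mul_one]

/-- The value of the expansion up to the order `N` is `ξ (1 + δ)`. -/
theorem add_sum_BCoeff_eq (hx : 0 < x) {μ : ℝ} (hμ : 0 < μ) (N : ℕ) :
    μ / lambertW (lam x * μ) + ∑ k ∈ Finset.range N, BCoeff x μ k / μ ^ (2 * k + 1) =
      xi x μ * (1 + deltaSum x (ratio x μ) ((xi x μ)⁻¹ ^ 2) N) := by
  obtain ⟨h1, -, -⟩ := log_lam_mul_xi hx hμ
  rw [← xi, mul_add, mul_one, deltaSum, Finset.mul_sum]
  congr 1
  refine Finset.sum_congr rfl fun k _ => ?_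
  rw [mul_left_comm, mul_inv_sq_pow h1.ne', BCoeff, div_div, ← mul_pow, ratio,
    div_mul_cancel₀ _ hμ.ne', inv_pow, div_eq_mul_inv]

theorem ratio_eq (hx : 0 < x) {μ : ℝ} (hμ : 0 < μ) :
    0 < ratio x μ ∧ (1 + ratio x μ) / ratio x μ = 1 + lambertW (lam x * μ) := by
  obtain ⟨h1, -, h3⟩ := log_lam_mul_xi hx hμ
  have hq : 0 < ratio x μ := div_pos h1 hμ
  refine ⟨hq, ?_⟩
  have : lambertW (lam x * μ) * ratio x μ = 1 := by
    rw [ratio, ← mul_div_assoc, mul_comm, h3, div_self hμ.ne']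
  rw [div_eq_iff hq.ne', add_mul, this]
  ring

/-- Absorption of a Lipschitz term into a factor tending to infinity. -/
theorem isBigO_div_of_mul_le {W D g S : ι → ℝ} {K : ℝ} (hW : Tendsto W l atTop)
    (hS : S =O[l] g) (h : ∀ᶠ i in l, W i * |D i| ≤ |S i| + K * |D i|) :
    D =O[l] (fun i => g i / W i) := by
  obtain ⟨C, hC⟩ := hS.bound
  refine IsBigO.of_bound (2 * C) ?_
  filter_upwards [hC, h, hW.eventually_ge_atTop (2 * K), hW.eventually_gt_atTop 0] with i h1 h2 h3 h4
  rw [norm_div, Real.norm_of_nonneg h4.le, ← mul_div_assoc, le_div_iff₀ h4]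
  simp only [Real.norm_eq_abs] at h1 ⊢
  nlinarith [mul_le_mul_of_nonneg_right h3 (abs_nonneg (D i))]

/-- The asymptotic expansion of the solution of `ν log (λν) + ε(ν) = m`. -/
theorem sub_expansion_isBigO (hx : 0 < x) (hm : Tendsto m l atTop) (hν : Tendsto ν l atTop)
    (heq : ∀ᶠ i in l, ν i * Real.log (lam x * ν i) + phaseCorrection (x ^ 2 / 4) (ν i) = m i)
    (N : ℕ) :
    (fun i => ν i - (m i / lambertW (lam x * m i) +
      ∑ k ∈ Finset.range N, BCoeff x (m i) k / m i ^ (2 * k + 1))) =O[l]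
      (fun i => lambertW (lam x * m i) ^ (2 * N) / m i ^ (2 * N + 1)) := by
  have hξ := tendsto_xi hx hm
  have hW := tendsto_lambertW_lam_mul hx hm
  set ξ : ι → ℝ := fun i => xi x (m i) with hξdef
  set W : ι → ℝ := fun i => lambertW (lam x * m i) with hWdef
  set q : ι → ℝ := fun i => ratio x (m i) with hqdef
  have hl := lam_pos hx
  have hq : ∀ᶠ i in l, 0 < q i := by
    filter_upwards [hm.eventually_gt_atTop 0] with i hi using (ratio_eq hx hi).1
  have hξi := tendsto_inv_atTop_zero.comp hξ
  have ht : Tendsto (fun i => (ξ i)⁻¹ ^ 2) l (𝓝 0) := by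
    simpa using hξi.pow 2
  set δ : ι → ℝ := fun i => deltaSum x (q i) ((ξ i)⁻¹ ^ 2) N with hδdef
  have hδ0 : Tendsto δ l (𝓝 0) := (deltaSum_isBigO x (ht.isBigO_one ℝ) N
    fun j _ => bCoeff_isBigO_one x hq j).trans_tendsto ht
  obtain ⟨K, hK0, hK⟩ := abs_sum_ACoeff_sub_le x (N + 1)
  -- The residual of the truncated solution in the equation for `ν`.
  have hres := residual_isBigO x hq ht N
  set E : ι → ℝ := fun i => (1 + q i) / q i * δ i + ((1 + δ i) * Real.log (1 + δ i) - δ i) +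
    ∑ k ∈ Finset.range (N + 1), ACoeff x k * ((ξ i)⁻¹ ^ 2) ^ (k + 1) *
      ((1 + δ i)⁻¹) ^ (2 * k + 1) with hE
  have hξE : (fun i => ξ i * E i) =O[l] (fun i => (ξ i)⁻¹ ^ (2 * N + 1)) := by
    refine ((isBigO_refl ξ l).mul hres).congr' (EventuallyEq.refl _ _) ?_
    filter_upwards [hξ.eventually_gt_atTop 0] with i hi using mul_inv_sq_pow hi.ne' N
  have hratio := tendsto_div_xi hx hm hν heq
  -- The truncation error of the correction at `ν`.
  have hε : (fun i => phaseCorrection (x ^ 2 / 4) (ν i) -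
      ∑ k ∈ Finset.range (N + 1), ACoeff x k * ((ν i)⁻¹) ^ (2 * k + 1)) =O[l]
      (fun i => (ξ i)⁻¹ ^ (2 * N + 1)) := by
    have h1 := (phaseCorrection_isBigO x (N + 1)).trans
      (pow_isBigO_pow inv_isBigO (by omega : 2 * N + 1 ≤ 2 * (N + 1) + 1))
    have h2 : (fun i => (ν i)⁻¹) =O[l] (fun i => (ξ i)⁻¹) := by
      refine IsBigO.of_bound 2 ?_
      filter_upwards [hξ.eventually_gt_atTop 0,
        hratio.eventually_const_lt (by norm_num : (1 / 2 : ℝ) < 1)] with i h3 h4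
      rw [lt_div_iff₀ h3] at h4
      rw [Real.norm_of_nonneg (by rw [inv_nonneg]; linarith),
        Real.norm_of_nonneg (inv_nonneg.2 h3.le)]
      calc (ν i)⁻¹ ≤ (1 / 2 * ξ i)⁻¹ := by gcongr
        _ = 2 * (ξ i)⁻¹ := by rw [mul_inv]; norm_num
    exact (h1.comp_tendsto hν).trans (h2.pow (2 * N + 1))
  have key : (fun i => ν i - ξ i * (1 + δ i)) =O[l] (fun i => (ξ i)⁻¹ ^ (2 * N + 1) / W i) := by
    refine isBigO_div_of_mul_le (K := K) hW (hε.add hξE) ?_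
    filter_upwards [hm.eventually_gt_atTop 0, heq, hξ.eventually_ge_atTop 2,
      hratio.eventually_const_lt (by norm_num : (1 / 2 : ℝ) < 1),
      hδ0.eventually_const_lt (by norm_num : (-(1 / 2) : ℝ) < 0)] with i h1 h2 h3 h4 h5
    obtain ⟨h6, h7, h8⟩ := log_lam_mul_xi hx h1
    rw [lt_div_iff₀ h6] at h4
    have hδ1 : 0 < 1 + δ i := by linarith
    have ha : ξ i / 2 ≤ ν i := by simp only [hξdef]; linarith
    have hb : ξ i / 2 ≤ ξ i * (1 + δ i) := by
      have : ξ i * (1 / 2) ≤ ξ i * (1 + δ i) := mul_le_mul_of_nonneg_left (by linarith) h6.le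
      linarith
    have h9 := mul_abs_sub_le_abs_mul_log_sub hl (half_pos h6) ha hb
    -- The loss of `log 2` from the smaller left end `ξ/2` is covered by the summand `1`.
    have h10 : W i ≤ 1 + Real.log (lam x * (ξ i / 2)) := by
      rw [← mul_div_assoc, Real.log_div (by positivity) two_ne_zero, h7]
      have := Real.log_two_lt_d9
      simp only [hWdef]
      linarith
    -- The truncated solution satisfies the equation for `ν` up to `ξ E`.
    have h11 : ξ i * (1 + δ i) * Real.log (lam x * (ξ i * (1 + δ i))) +
        ∑ k ∈ Finset.range (N + 1), ACoeff x k * ((ξ i * (1 + δ i))⁻¹) ^ (2 * k + 1) =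
        m i + ξ i * E i := by
      have h12 : ∑ k ∈ Finset.range (N + 1), ACoeff x k * ((ξ i * (1 + δ i))⁻¹) ^ (2 * k + 1) =
          ξ i * ∑ k ∈ Finset.range (N + 1), ACoeff x k * ((ξ i)⁻¹ ^ 2) ^ (k + 1) *
            ((1 + δ i)⁻¹) ^ (2 * k + 1) := by
        rw [Finset.mul_sum]
        refine Finset.sum_congr rfl fun k _ => ?_
        rw [mul_inv, mul_pow, ← mul_inv_sq_pow (a := ξ i) h6.ne']
        ring
      rw [h12, ← mul_assoc (lam x), Real.log_mul (mul_pos hl h6).ne' hδ1.ne', h7]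
      simp only [hE, hqdef, (ratio_eq hx h1).2]
      simp only [hξdef] at h8 ⊢
      linear_combination (1 + δ i) * h8 - δ i * h8
    have h13 := hK (ν i) (ξ i * (1 + δ i)) (by linarith) (by linarith)
    have h14 : ν i * Real.log (lam x * ν i) -
        ξ i * (1 + δ i) * Real.log (lam x * (ξ i * (1 + δ i))) =
        -((phaseCorrection (x ^ 2 / 4) (ν i) -
          ∑ k ∈ Finset.range (N + 1), ACoeff x k * ((ν i)⁻¹) ^ (2 * k + 1)) + ξ i * E i) -
        (∑ k ∈ Finset.range (N + 1), ACoeff x k * ((ν i)⁻¹) ^ (2 * k + 1) -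
          ∑ k ∈ Finset.range (N + 1), ACoeff x k * ((ξ i * (1 + δ i))⁻¹) ^ (2 * k + 1)) := by
      linear_combination h2 - h11
    rw [h14] at h9
    refine (mul_le_mul_of_nonneg_right h10 (abs_nonneg _)).trans (h9.trans ?_)
    refine (abs_sub _ _).trans ?_
    rw [abs_neg]
    exact add_le_add le_rfl h13
  refine key.congr' ?_ ?_
  · filter_upwards [hm.eventually_gt_atTop 0] with i hi
    rw [add_sum_BCoeff_eq hx hi]
  · filter_upwards [hm.eventually_gt_atTop 0, hW.eventually_gt_atTop 0] with i hi hWi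
    have : (ξ i)⁻¹ = W i / m i := inv_div _ _
    rw [this, div_pow, pow_succ, div_div, mul_comm (m i ^ _), ← div_div,
      mul_div_cancel_right₀ _ hWi.ne']

theorem isEquivalent_div_log (hx : 0 < x) (hm : Tendsto m l atTop) (hν : Tendsto ν l atTop)
    (heq : ∀ᶠ i in l, ν i * Real.log (lam x * ν i) + phaseCorrection (x ^ 2 / 4) (ν i) = m i) :
    IsEquivalent l ν (fun i => m i / Real.log (lam x * m i)) := by
  have h1 := (tendsto_div_xi hx hm hν heq).mul
    (tendsto_log_div_lambertW.comp (hm.const_mul_atTop (lam_pos hx)))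
  rw [one_mul] at h1
  refine isEquivalent_of_tendsto_one (h1.congr' ?_)
  filter_upwards [hm.eventually_gt_atTop 0, (tendsto_lambertW_lam_mul hx hm).eventually_gt_atTop 0]
    with i hi hWi
  simp only [Function.comp_apply, Pi.div_apply, xi]
  rw [div_div_eq_mul_div, div_div_eq_mul_div, div_mul_div_comm, mul_right_comm,
    mul_div_mul_right _ _ hWi.ne']

theorem tendsto_mMinus : Tendsto mMinus atTop atTop :=
  (tendsto_atTop_add_const_right _ _ tendsto_natCast_atTop_atTop).atTop_mul_const Real.pi_pos

theorem mMinus_pos {n : ℕ} (hn : 1 ≤ n) : 0 < mMinus n := by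
  have : (1 : ℝ) ≤ n := by exact_mod_cast hn
  exact mul_pos (by linarith) Real.pi_pos

theorem BCoeff_closed_forms (hx : 0 < x) {μ : ℝ} (hμ : 0 < μ) {q b₀ b₁ : ℝ} (hq : q = xi x μ / μ)
    (hb₀ : b₀ = -ACoeff x 0 / (1 + Real.log (lam x * xi x μ)))
    (hb₁ : b₁ = (ACoeff x 0 * b₀ - ACoeff x 1 - b₀ ^ 2 / 2) /
      (1 + Real.log (lam x * xi x μ))) :
    BCoeff x μ 0 = -ACoeff x 0 / (1 + q) ∧
      BCoeff x μ 1 = (ACoeff x 0 * b₀ - ACoeff x 1 - b₀ ^ 2 / 2) / (q ^ 2 * (1 + q)) ∧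
      BCoeff x μ 2 =
        (3 * ACoeff x 1 * b₀ - ACoeff x 0 * (b₀ ^ 2 - b₁) - ACoeff x 2 - b₀ * b₁ + b₀ ^ 3 / 6) /
          (q ^ 4 * (1 + q)) := by
  obtain ⟨hq0, hq1⟩ := ratio_eq hx hμ
  rw [← ratio] at hq
  rw [(log_lam_mul_xi hx hμ).2.1, ← hq1, ← hq] at hb₀ hb₁
  rw [← hq] at hq0
  have hq2 : 1 + q ≠ 0 := by positivity
  have e0 : bCoeff x q 0 = b₀ := by
    rw [bCoeff_zero, hb₀]; field_simp
  have e1 : bCoeff x q 1 = b₁ := by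
    rw [bCoeff_one, e0, hb₁]; field_simp; ring
  refine ⟨?_, ?_, ?_⟩
  · rw [BCoeff, ← hq, bCoeff_zero, mul_zero, zero_add, pow_one]; field_simp
  · rw [BCoeff, ← hq, bCoeff_one, e0]; field_simp; ring
  · rw [BCoeff, ← hq, bCoeff_two, e0, e1]; field_simp; ring

end ZeroExpansion

end NuZeros

open NuZeros in
theorem theorem2 (x : ℝ) (hx : 0 < x) :
    -- the positive zeros form an infinite increasing sequence `ν 1 < ν 2 < ⋯`, and
    (∃ ν : ℕ → ℝ, StrictMonoOn ν (Set.Ici 1) ∧ ν '' Set.Ici 1 = positiveZeros x ∧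
      -- the expansion holds to every order, the remainder having the order of the next term,
      (∀ N : ℕ, Asymptotics.IsBigO Filter.atTop
        (fun n : ℕ => ν n - (mMinus n / lambertW (lam x * mMinus n) +
          ∑ k ∈ Finset.range N, BCoeff x (mMinus n) k / mMinus n ^ (2 * k + 1)))
        (fun n : ℕ => lambertW (lam x * mMinus n) ^ (2 * N) / mMinus n ^ (2 * N + 1))) ∧
      -- with the leading behaviour
      Asymptotics.IsEquivalent Filter.atTop ν
        (fun n : ℕ => mMinus n / Real.log (lam x * mMinus n))) ∧
    -- the first coefficients have the closed forms
    (ACoeff x 0 = aCoeff x 1 ∧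
      ACoeff x 1 = aCoeff x 1 * aCoeff x 2 - aCoeff x 3 - aCoeff x 1 ^ 3 / 3 ∧
      ACoeff x 2 = aCoeff x 1 * aCoeff x 2 ^ 2 + aCoeff x 1 ^ 2 * aCoeff x 3
        - aCoeff x 1 ^ 3 * aCoeff x 2 - aCoeff x 2 * aCoeff x 3 - aCoeff x 1 * aCoeff x 4
        + aCoeff x 5 + aCoeff x 1 ^ 5 / 5) ∧
    (∀ n : ℕ, 1 ≤ n → ∀ q b₀ b₁ : ℝ, q = xi x (mMinus n) / mMinus n →
      b₀ = -ACoeff x 0 / (1 + Real.log (lam x * xi x (mMinus n))) →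
      b₁ = (ACoeff x 0 * b₀ - ACoeff x 1 - b₀ ^ 2 / 2) /
        (1 + Real.log (lam x * xi x (mMinus n))) →
      BCoeff x (mMinus n) 0 = -ACoeff x 0 / (1 + q) ∧
      BCoeff x (mMinus n) 1 =
        (ACoeff x 0 * b₀ - ACoeff x 1 - b₀ ^ 2 / 2) / (q ^ 2 * (1 + q)) ∧
      BCoeff x (mMinus n) 2 =
        (3 * ACoeff x 1 * b₀ - ACoeff x 0 * (b₀ ^ 2 - b₁) - ACoeff x 2 - b₀ * b₁ + b₀ ^ 3 / 6) /
          (q ^ 4 * (1 + q))) := by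
  refine ⟨?_, ⟨ACoeff_zero x, ACoeff_one x, ACoeff_two x⟩,
    fun n hn q b₀ b₁ hq hb₀ hb₁ => BCoeff_closed_forms hx (mMinus_pos hn) hq hb₀ hb₁⟩
  obtain ⟨ν, hmono, himg, htend, hphase⟩ := exists_zeros hx
  have heq : ∀ᶠ n in Filter.atTop, ν n * Real.log (lam x * ν n) +
      phaseCorrection (x ^ 2 / 4) (ν n) = mMinus n := by
    filter_upwards [Filter.eventually_ge_atTop 1] with n hn
    obtain ⟨h1, h2⟩ := hphase n hn
    have h3 := neg_besselPhase_eq hx h1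
    rw [h2] at h3
    rw [mMinus]
    linear_combination -h3
  exact ⟨ν, hmono, himg, sub_expansion_isBigO hx tendsto_mMinus htend heq,
    isEquivalent_div_log hx tendsto_mMinus htend heq⟩
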